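/- **Setting.** Let $X_0\subset\mathbb R^n$ be nonempty, closed and convex, $\mathcal O_0\supseteq X_0$ open and convex, $p\ge 1$, and let $\xi$ be a random element of $\Xi$ with law $P$. Let $F(\cdot,\xi),G_1(\cdot,\xi),\dots,G_p(\cdot,\xi):\mathcal O_0\to\mathbb R$ be differentiable, with $F(x,\cdot)$, $G_i(x,\cdot)$ measurable and $F(x,\cdot)$ $P$-integrable for $x\in\mathcal O_0$. Put $G=(G_1,\dots,G_p)$, $f(x)=\mathbb E[F(x,\xi)]$, $g_i(x)=\mathbb E[G_i(x,\xi)]$, $L(x,\lambda)=f(x)+\sum_j\lambda_jg_j(x)$. All norms are Euclidean (spectral for matrices). Assume that there are positive constants $D_0,\nu_g,\kappa_f,\kappa_g,\epsilon_0,L_0,\dots,L_p$ such that * $\|x-z\|\le D_0$ for $x,z\in X_0$; * $\|G(x,\xi)\|\le\nu_g$, $\|\nabla_xF(x,\xi)\|\le\kappa_f$, $\|\nabla_xG_i(x,\xi)\|\le\kappa_g$ for all $x\in\mathcal O_0$, $\xi\in\Xi$ and all $i$; * there is $\hat x\in X_0$ with $g_i(\hat x)\le-\epsilon_0$ for all $i$;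 * $F(\cdot,\xi)$ is $L_0$-weakly convex and $G_i(\cdot,\xi)$ is $L_i$-weakly convex on $\mathcal O_0$ for every $\xi\in\Xi$ ($h$ is $\ell$-weakly convex if $h+\frac{\ell}{2}\|\cdot\|^2$ is convex). **Algorithm (PMQSopt).** Let $T\ge1$, $\sigma,\alpha,\tau>0$, let $\xi_1,\dots,\xi_T$ be i.i.d. with law $P$, $x^1\in X_0$ deterministic and $\lambda^1=0\in\mathbb R^p$. For $t=1,\dots,T$ select symmetric matrices $\Sigma^t_1,\dots,\Sigma^t_p$, put $\Sigma^t_0=-\sum_i\lambda^t_i\Sigma^t_i+\tau I$, $$q^t_0(x)=F(x^t,\xi_t)+\langle\nabla_xF(x^t,\xi_t),x-x^t\rangle+\tfrac12\langle\Sigma^t_0(x-x^t),x-x^t\rangle,$$ $$q^t_i(x)=G_i(x^t,\xi_t)+\langle\nabla_xG_i(x^t,\xi_t),x-x^t\rangle+\tfrac12\langle\Sigma^t_i(x-x^t),x-x^t\rangle\quad(1\le i\le p),$$ let $x^{t+1}$ be a minimizer over $x\in X_0$ of $$q^t_0(x)+\frac1{2\sigma}\Big[\sum_{i=1}^p[\lambda^t_i+\sigma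 q^t_i(x)]_+^2-\|\lambda^t\|^2\Big]+\frac\alpha2\|x-x^t\|^2,$$ and let $\lambda^{t+1}_i=[\lambda^t_i+\sigma q^t_i(x^{t+1})]_+$. The iterates $x^t,\lambda^t$ are measurable functions of $\xi_1,\dots,\xi_{t-1}$. **Constants.** Let $\kappa_\Sigma>0$ and $$\gamma_1=\nu_g+\sqrt p\big(\kappa_gD_0+\tfrac12\kappa_\Sigma D_0^2\big),\qquad \gamma_2=\nu_g+\kappa_gD_0+\tfrac12\kappa_\Sigma D_0^2,\qquad \beta_k(\sigma)=L_0+\Big(\sum_{j=1}^pL_j\gamma_2\Big)k\sigma,$$ $$\rho_1=[2\kappa_g+\kappa_\Sigma D_0]\kappa_f,\qquad \rho_2=[2\kappa_g+\kappa_\Sigma D_0](\kappa_g+\kappa_\Sigma D_0/2)\sqrt p,$$ and, for real $s\ge1$ and $\theta>0$, with $\Gamma(a,b)=\int_b^\infty u^{a-1}e^{-u}du$, $$\psi=\psi(\sigma,\alpha,\tau,s)=\frac{\epsilon_0\sigma s}4+\gamma_1\sigma(s-1)+\frac{2(\alpha+\tau)D_0^2}{\epsilon_0s}+\frac{4\kappa_fD_0}{\epsilon_0}+\frac{2\sigma\nu_g^2}{\epsilon_0}+\Big[\gamma_1+\frac{16\gamma_1^2}{\epsilon_0}\log\frac{128\gamma_1^2}{\epsilon_0^2}\Big]\sigma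 s,$$ $$\begin{aligned}\pi={}&\psi^2+32\psi\frac{\gamma_1^2}{\epsilon_0}\sigma s\frac{T^\theta}{\theta+1}+256\frac{\gamma_1^4}{\epsilon_0^2}\sigma^2s^2\frac{T^{2\theta}}{2\theta+1}+2\sigma\nu_g\Big[\psi+16\frac{\gamma_1^2}{\epsilon_0}\sigma s\frac{T^\theta}{\theta+1}\Big]+(\sigma\nu_g)^2\\&+\frac{(\sigma\nu_g)^2}{T\theta}\Big[\Gamma\big(\tfrac3\theta,1\big)+2\Gamma\big(\tfrac2\theta,1\big)+\Gamma\big(\tfrac1\theta,1\big)\Big].\end{aligned}$$ **Proposition.** Suppose that $\Sigma^t_i\preceq-L_iI$ and $\|\Sigma^t_i\|\le\kappa_\Sigma$ for all $i=1,\dots,p$ and $t=1,\dots,T$ (for instance $\Sigma^t_i=-L_iI$ and $\kappa_\Sigma=\max\{L_1,\dots,L_p\}$), that $\sqrt p\,\kappa_\Sigma D_0^2\le\epsilon_0$, and that $$\alpha>\max\big\{2\beta_k(\sigma),\;p(\kappa_g+\kappa_\Sigma D_0/2)^2\sigma\big\}\qquad(k=1,\dots,T).$$ Let $\phi^t_{1/\alpha}(x)=\inf_{z\in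 X_0}\{L(z,\lambda^t)+\frac\alpha2\|z-x\|^2\}$ be the Moreau envelope of $L(\cdot,\lambda^t)+\delta_{X_0}$. Then for every real $s\ge1$ (in particular $s=\tau$ if $\tau\ge1$) and every $\theta>0$: (i) For $t=1,\dots,T$ the function $\phi^t_{1/\alpha}$ is differentiable at $x^t$, $\|\nabla\phi^t_{1/\alpha}(x^t)\|^2$ is integrable, and $$\begin{aligned}\mathbb E\,\frac1T\sum_{t=1}^T\|\nabla\phi^t_{1/\alpha}(x^t)\|^2\le{}&\frac{4(\alpha+\tau)}T\Big[f(x^1)-\inf_{z\in X_0}f(z)\Big]+\frac{4\nu_g\psi(\alpha+\tau)}T+4(\alpha+\tau)\nu_g\gamma_1\sigma\\&+4\alpha\sigma D_0\gamma_2p[\kappa_g+\kappa_\Sigma D_0]+\frac{4\alpha}{\alpha+\tau}\big[\kappa_f+\sigma\gamma_2p(\kappa_g+\kappa_\Sigma D_0)\big]^2\\&+\frac{4p\kappa_g^2\alpha}{\alpha+\tau}\,\pi+\frac{8\alpha}{\alpha+\tau}\,\sigma p\kappa_g^2\gamma_1\psi+\frac{4\alpha}{\alpha+\tau}\,\sigma^2\gamma_1^2p\kappa_g^2.\end{aligned}$$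 (ii) For every $i=1,\dots,p$ the variables $g_i(x^t)$, $t=1,\dots,T$, are integrable and $$\frac1T\,\mathbb E\Big[\sum_{t=1}^Tg_i(x^t)\Big]\le\frac1{\sigma T}\psi+\frac1{\alpha+\tau}\big\{\rho_1+\rho_2\nu_g\sigma+\rho_2\psi\big\}.$$ -/

import Mathlib

open MeasureTheory ProbabilityTheory

namespace PMQS

noncomputable section

/-- Euclidean space `ℝⁿ`. -/
abbrev E (n : ℕ) := EuclideanSpace ℝ (Fin n)

/-! ### Problem data -/

/-- The expectation `h(x) = 𝔼[H(x, ξ)]` for `ξ` with law `P`. -/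
def expVal {n : ℕ} {Ξ : Type*} [MeasurableSpace Ξ] (P : Measure Ξ) (H : E n → Ξ → ℝ)
    (x : E n) : ℝ :=
  ∫ z, H x z ∂P

/-- `h` is `L`-weakly convex on `O`: `h + (L/2)‖·‖²` is convex on `O`. -/
def WeaklyConvexOn {n : ℕ} (O : Set (E n)) (L : ℝ) (h : E n → ℝ) : Prop :=
  ConvexOn ℝ O (fun x => h x + L / 2 * ‖x‖ ^ 2)

/-- The Lagrangian `L(x, λ) = f(x) + ∑ⱼ λⱼ gⱼ(x)` of the expectation-constrained problem. -/
def lagrangian {n p : ℕ} {Ξ : Type*} [MeasurableSpace Ξ] (P : Measure Ξ) (F : E n → Ξ → ℝ)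
    (G : Fin p → E n → Ξ → ℝ) (lam : E p) (x : E n) : ℝ :=
  expVal P F x + ∑ j, lam j * expVal P (G j) x

/-- Moreau envelope with parameter `1/α` of `h + δ_X`, where `δ_X` is the indicator
(`0` on `X`, `+∞` off `X`), evaluated at `x`:
`inf_z { h(z) + δ_X(z) + (α/2)‖z - x‖² }`; the points off `X` do not contribute. -/
def moreauEnv {n : ℕ} (X : Set (E n)) (h : E n → ℝ) (α : ℝ) (x : E n) : ℝ :=
  ⨅ z : X, (h z + α / 2 * ‖(z : E n) - x‖ ^ 2)

/-! ### The algorithm -/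

/-- The quadratic form `⟨S v, v⟩`. -/
def quadForm {n : ℕ} (S : Matrix (Fin n) (Fin n) ℝ) (v : E n) : ℝ :=
  inner ℝ (Matrix.toEuclideanCLM (𝕜 := ℝ) S v) v

/-- Quadratic model of `h` at `y` with second-order matrix `S`. -/
def quadModel {n : ℕ} (h : E n → ℝ) (S : Matrix (Fin n) (Fin n) ℝ) (y x : E n) : ℝ :=
  h y + inner ℝ (gradient h y) (x - y) + 1 / 2 * quadForm S (x - y)

/-- Augmented Lagrange function of `min q₀` subject to `qᵢ ≤ 0`. -/
def augLag {n p : ℕ} (σ : ℝ) (q₀ : E n → ℝ) (q : Fin p → E n → ℝ) (lam : E p) (x : E n) : ℝ :=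
  q₀ x + 1 / (2 * σ) * ((∑ i, (max (lam i + σ * q i x) 0) ^ 2) - ‖lam‖ ^ 2)

/-- The objective-model matrix `Σ₀ = -∑ᵢ λᵢ Σᵢ + τ I`. -/
def Sigma0 {n p : ℕ} (τ : ℝ) (lam : E p) (S : Fin p → Matrix (Fin n) (Fin n) ℝ) :
    Matrix (Fin n) (Fin n) ℝ :=
  -(∑ i, lam i • S i) + τ • (1 : Matrix (Fin n) (Fin n) ℝ)

/-- The σ-algebra generated by `ξ₁, …, ξ_{t-1}`. -/
abbrev history {Ω Ξ : Type*} [MeasurableSpace Ξ] (ξ : ℕ → Ω → Ξ) (t : ℕ) : MeasurableSpace Ω :=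
  ⨆ k ∈ Finset.Ico 1 t, MeasurableSpace.comap (ξ k) inferInstance

/-- `(x^t, λ^t)` is generated by `T` rounds of the method (PMQSopt) from `x¹ = x₁`, `λ¹ = 0`,
with samples `ξ_t` and matrices `Σᵗᵢ = S t i` (which may depend on the realization).
The iterates `x^t`, `λ^t` are measurable functions of `ξ₁, …, ξ_{t-1}`. -/
structure IsRun {n p : ℕ} {Ω Ξ : Type*} [MeasurableSpace Ξ] (X₀ : Set (E n))
    (F : E n → Ξ → ℝ) (G : Fin p → E n → Ξ → ℝ) (σ α τ : ℝ) (T : ℕ) (x₁ : E n)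
    (ξ : ℕ → Ω → Ξ) (S : ℕ → Fin p → Ω → Matrix (Fin n) (Fin n) ℝ)
    (x : ℕ → Ω → E n) (lam : ℕ → Ω → E p) : Prop where
  x_one : ∀ ω, x 1 ω = x₁
  lam_one : ∀ ω, lam 1 ω = 0
  x_adapted : ∀ t ∈ Finset.Icc 1 (T + 1), Measurable[history ξ t] (x t)
  lam_adapted : ∀ t ∈ Finset.Icc 1 (T + 1), Measurable[history ξ t] (lam t)
  S_symm : ∀ t ∈ Finset.Icc 1 T, ∀ i ω, (S t i ω).IsSymm
  x_mem : ∀ t ∈ Finset.Icc 1 T, ∀ ω, x (t + 1) ω ∈ X₀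
  x_argmin : ∀ t ∈ Finset.Icc 1 T, ∀ ω,
    IsMinOn (fun y =>
      augLag σ
        (quadModel (fun z => F z (ξ t ω)) (Sigma0 τ (lam t ω) (fun i => S t i ω)) (x t ω))
        (fun i => quadModel (fun z => G i z (ξ t ω)) (S t i ω) (x t ω)) (lam t ω) y
      + α / 2 * ‖y - x t ω‖ ^ 2) X₀ (x (t + 1) ω)
  lam_step : ∀ t ∈ Finset.Icc 1 T, ∀ ω i,
    lam (t + 1) ω i =
      max (lam t ω i
        + σ * quadModel (fun z => G i z (ξ t ω)) (S t i ω) (x t ω) (x (t + 1) ω)) 0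

/-! ### Constants -/

/-- `γ₁ = ν_g + √p (κ_g D₀ + κ_Σ D₀² / 2)`. -/
def gamma1 (p : ℕ) (νg κg κS D₀ : ℝ) : ℝ :=
  νg + Real.sqrt p * (κg * D₀ + 1 / 2 * κS * D₀ ^ 2)

/-- `γ₂ = ν_g + κ_g D₀ + κ_Σ D₀² / 2`. -/
def gamma2 (νg κg κS D₀ : ℝ) : ℝ :=
  νg + (κg * D₀ + κS * D₀ ^ 2 / 2)

/-- `β_k(σ) = L₀ + (∑ⱼ Lⱼ γ₂) k σ`. -/
def betaK {p : ℕ} (L₀ : ℝ) (L : Fin p → ℝ) (γ₂ : ℝ) (k : ℕ) (σ : ℝ) : ℝ :=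
  L₀ + (∑ j, L j * γ₂) * k * σ

/-- The threshold `ϑ(σ, α, τ, s)`. -/
def vartheta (γ₁ ε₀ D₀ κf νg σ α τ s : ℝ) : ℝ :=
  ε₀ * σ * s / 4 + γ₁ * σ * (s - 1) + 2 * (α + τ) * D₀ ^ 2 / (ε₀ * s) + 4 * κf * D₀ / ε₀
    + 2 * σ * νg ^ 2 / ε₀

/-- `ψ(σ, α, τ, s)`. -/
def psi (γ₁ ε₀ D₀ κf νg σ α τ s : ℝ) : ℝ :=
  vartheta γ₁ ε₀ D₀ κf νg σ α τ s
    + (γ₁ + 16 * γ₁ ^ 2 / ε₀ * Real.log (128 * γ₁ ^ 2 / ε₀ ^ 2)) * σ * s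

/-- The upper incomplete Gamma function `Γ(a, b) = ∫_b^∞ u^{a-1} e^{-u} du`. -/
def upperGamma (a b : ℝ) : ℝ :=
  ∫ u in Set.Ioi b, u ^ (a - 1) * Real.exp (-u)

/-- The second-moment quantity `π`, as a function of `σ`, `s`, `θ`, `T` and of the value
`ψ = ψ(σ, α, τ, s)`. -/
def piBound (γ₁ ε₀ νg σ s θ ψ : ℝ) (T : ℕ) : ℝ :=
  ψ ^ 2 + 32 * ψ * (γ₁ ^ 2 / ε₀) * σ * s * ((T : ℝ) ^ θ / (θ + 1))
    + 256 * (γ₁ ^ 4 / ε₀ ^ 2) * σ ^ 2 * s ^ 2 * ((T : ℝ) ^ (2 * θ) / (2 * θ + 1))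
    + 2 * σ * νg * (ψ + 16 * (γ₁ ^ 2 / ε₀) * σ * s * ((T : ℝ) ^ θ / (θ + 1)))
    + (σ * νg) ^ 2
    + (σ * νg) ^ 2 / (T * θ)
        * (upperGamma (3 / θ) 1 + 2 * upperGamma (2 / θ) 1 + upperGamma (1 / θ) 1)

end

end PMQS

/-! The engine is a bound E‖λ^t‖² ≤ ψ², uniform in t; given it, both conclusions follow by
telescoping.

Most one-round estimates come from testing the first-order condition of the subproblem
(`subproblem_variational_inequality`) at a suitable y. Since Σ₀ contains -∑ λ_i Σ_i, the curvature
terms enter through λ^{t+1} - λ^t, which is of order σ, up to terms that have a good sign or are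
controlled by κ_Σ.

Multipliers. At the Slater point, `multiplier_drift` bounds ‖λ^{t+1}‖² - ‖λ^t‖². As λ^t is known
before ξ_t is drawn, G_i may be replaced in expectation by g_i ≤ -ε₀, which yields -2σε₀‖λ^t‖; the
condition √p κ_Σ D₀² ≤ ε₀ ensures that the curvature error spends at most half of it. Over ⌈s⌉
rounds the proximal distances telescope (`weighted_multistep_drift`). A process whose increments are
bounded and whose square drifts downward when it is large has a uniformly bounded exponential moment
(`integral_exp_le_of_drift`), hence a bounded second moment; `multiplier_threshold_le_psi` compares
the resulting threshold with ψ.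

Feasibility. The update gives σ q_i(x^{t+1}) ≤ λ_i^{t+1} - λ_i^t, and G_i(x^t) exceeds q_i(x^{t+1})
by at most a multiple of ‖x^{t+1} - x^t‖, which `step_length_le` controls by (1 + ‖λ^t‖)/(α+τ) up to
constants. Summing over t leaves λ_i^{T+1}/σ.

Stationarity. The gradient of the envelope at x^t is α(x^t - Y_t), with Y_t the proximal point
(`hasGradientAt_moreauEnv`). The optimality condition is tested at Y_t, which is determined by the
past; so the sampled Lagrangian difference has the expectation of L(Y_t, λ^t) - L(x^t, λ^t). Weak
convexity and 2β_t < α make this at most -(α+β_t)/2 ‖Y_t - x^t‖². As Y_t also competes in the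
envelope at time t+1, the inequalities telescope (`expected_descent`, `sum_integral_prox_dist_le`).
The bound obtained has factors 2 and ψ² where the claim has 4 and π. -/

/-! ### Elementary inequalities. -/

theorem nonneg_of_forall_quadratic_nonneg {a b : ℝ}
    (h : ∀ t : ℝ, 0 < t → t ≤ 1 → 0 ≤ t * a + t ^ 2 * b) : 0 ≤ a := by
  by_contra ha
  push Not at ha
  have hb : 0 < |b| + 1 := by positivity
  -- For this t the term t|b| is at most -a/2, so a + t b stays negative.
  set t := min 1 (-a / (2 * (|b| + 1))) with ht
  have h1 : 0 < -a / (2 * (|b| + 1)) := div_pos (by linarith) (by linarith)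
  have ht0 : 0 < t := lt_min one_pos h1
  have h2 := h t ht0 (min_le_left _ _)
  have h3 : t * (2 * (|b| + 1)) ≤ -a := by
    rw [← le_div_iff₀ (by linarith)]; exact min_le_right _ _
  have h4 : 0 ≤ a + t * b := by
    have : t * (a + t * b) = t * a + t ^ 2 * b := by ring
    rw [← this] at h2
    exact nonneg_of_mul_nonneg_right h2 ht0
  nlinarith [le_abs_self b, mul_le_mul_of_nonneg_left (le_abs_self b) ht0.le]

/-- The squared positive part has the 2-Lipschitz derivative 2[·]₊; this is its descent inequality.
It allows the penalty to be perturbed to first order across the kink. -/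
theorem max_zero_add_sq_le (a b : ℝ) :
    (max (a + b) 0) ^ 2 ≤ (max a 0) ^ 2 + 2 * max a 0 * b + b ^ 2 := by
  rcases max_cases (a + b) 0 with h | h <;> rcases max_cases a 0 with h' | h' <;>
    rw [h.1, h'.1] <;> nlinarith

theorem sum_mul_le_norm_mul_norm {p : ℕ} (a b : PMQS.E p) : ∑ i, a i * b i ≤ ‖a‖ * ‖b‖ := by
  have := real_inner_le_norm b a
  simp only [PiLp.inner_apply, RCLike.inner_apply, conj_trivial] at this
  linarith [mul_comm ‖a‖ ‖b‖]

theorem sum_abs_le_sqrt_mul_norm {p : ℕ} (a : PMQS.E p) : ∑ i, |a i| ≤ Real.sqrt p * ‖a‖ := by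
  have h := sum_mul_le_norm_mul_norm (WithLp.toLp 2 (fun i => |a i|) : PMQS.E p)
    (WithLp.toLp 2 (fun _ => (1 : ℝ)))
  have h1 : ‖(WithLp.toLp 2 (fun i => |a i|) : PMQS.E p)‖ = ‖a‖ := by
    simp [EuclideanSpace.norm_eq]
  have h2 : ‖(WithLp.toLp 2 (fun _ => (1 : ℝ)) : PMQS.E p)‖ = Real.sqrt p := by
    simp [EuclideanSpace.norm_eq]
  rw [h1, h2] at h
  simpa [mul_comm] using h

theorem norm_le_sum_of_nonneg {p : ℕ} (a : PMQS.E p) (ha : ∀ i, 0 ≤ a i) : ‖a‖ ≤ ∑ i, a i := by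
  rw [EuclideanSpace.norm_eq]
  refine Real.sqrt_le_iff.2 ⟨Finset.sum_nonneg fun i _ => ha i, ?_⟩
  have := Finset.sum_sq_le_sq_sum_of_nonneg (s := Finset.univ) (f := fun i => a i)
    (fun i _ => ha i)
  simpa using this

theorem abs_apply_le_norm {p : ℕ} (a : PMQS.E p) (i : Fin p) : |a i| ≤ ‖a‖ := by
  simpa using PiLp.norm_apply_le a i

theorem norm_le_of_abs_le {p : ℕ} (a b : PMQS.E p) (h : ∀ i, |a i| ≤ |b i|) : ‖a‖ ≤ ‖b‖ := by
  rw [EuclideanSpace.norm_eq, EuclideanSpace.norm_eq]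
  refine Real.sqrt_le_sqrt (Finset.sum_le_sum fun i _ => ?_)
  simpa using sq_le_sq.2 (h i)

/-! ### First-order optimality of the subproblem. -/

section Step

variable {V : Type*} [NormedAddCommGroup V] [InnerProductSpace ℝ V] {p : ℕ}

theorem inner_clm_add_self (A : V →L[ℝ] V) (hA : ∀ u v, inner ℝ (A u) v = inner ℝ (A v) u)
    (d e : V) (t : ℝ) : inner ℝ (A (d + t • e)) (d + t • e)
      = inner ℝ (A d) d + t * (2 * inner ℝ (A d) e) + t ^ 2 * inner ℝ (A e) e := by
  simp only [map_add, map_smul, inner_add_left, inner_add_right, inner_smul_left,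
    inner_smul_right, conj_trivial]
  rw [hA e d]; ring

theorem norm_add_smul_sq (d e : V) (t : ℝ) :
    ‖d + t • e‖ ^ 2 = ‖d‖ ^ 2 + t * (2 * inner ℝ d e) + t ^ 2 * ‖e‖ ^ 2 := by
  rw [norm_add_sq_real, inner_smul_right, norm_smul, mul_pow, Real.norm_eq_abs, sq_abs]; ring

/-- First-order optimality condition of the proximal augmented Lagrangian subproblem. -/
theorem subproblem_variational_inequality {X : Set V} (hX : Convex ℝ X) {x xp y : V}
    (hxp : xp ∈ X) (hy : y ∈ X) (c₀ : ℝ) (v : V) (c : Fin p → ℝ) (w : Fin p → V)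
    (A : Fin p → V →L[ℝ] V) (hA : ∀ i u v, inner ℝ (A i u) v = inner ℝ (A i v) u)
    (lam : PMQS.E p) {σ α τ : ℝ} (hσ : 0 < σ) (q : Fin p → V → ℝ)
    (hq : ∀ i z, q i z = c i + inner ℝ (w i) (z - x) + 1 / 2 * inner ℝ (A i (z - x)) (z - x))
    (hmin : ∀ z ∈ X,
      c₀ + inner ℝ v (xp - x) + 1 / 2 * (-(∑ i, lam i * inner ℝ (A i (xp - x)) (xp - x))
        + τ * ‖xp - x‖ ^ 2)
        + 1 / (2 * σ) * ((∑ i, (max (lam i + σ * q i xp) 0) ^ 2) - ‖lam‖ ^ 2)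
        + α / 2 * ‖xp - x‖ ^ 2 ≤
      c₀ + inner ℝ v (z - x) + 1 / 2 * (-(∑ i, lam i * inner ℝ (A i (z - x)) (z - x))
        + τ * ‖z - x‖ ^ 2)
        + 1 / (2 * σ) * ((∑ i, (max (lam i + σ * q i z) 0) ^ 2) - ‖lam‖ ^ 2)
        + α / 2 * ‖z - x‖ ^ 2) :
    0 ≤ inner ℝ v (y - xp)
      + ∑ i, max (lam i + σ * q i xp) 0
          * (inner ℝ (w i) (y - xp) + inner ℝ (A i (xp - x)) (y - xp))
      - ∑ i, lam i * inner ℝ (A i (xp - x)) (y - xp) + (α + τ) * inner ℝ (xp - x) (y - xp) := by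
  set d := xp - x with hd
  set e := y - xp with he
  set P : Fin p → ℝ := fun i => inner ℝ (w i) e + inner ℝ (A i d) e with hP
  set R : Fin p → ℝ := fun i => inner ℝ (A i e) e with hR
  set m : Fin p → ℝ := fun i => max (lam i + σ * q i xp) 0 with hm
  -- Along xp + t e every term outside the penalty is quadratic in t, and the penalty is majorized
  -- by a quadratic through `max_zero_add_sq_le`. The value b collects the t² coefficients; its last
  -- summand covers the second-order remainder of the penalty.
  refine nonneg_of_forall_quadratic_nonneg (b := -(1 / 2 * ∑ i, lam i * R i)
    + (α + τ) / 2 * ‖e‖ ^ 2 + 1 / 2 * ∑ i, m i * R i + σ / 2 * ∑ i, (|P i| + |R i|) ^ 2)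
    fun t ht0 ht1 => ?_
  have hz : xp + t • e ∈ X := by
    have := hX hxp hy (a := 1 - t) (b := t) (by linarith) ht0.le (by ring)
    convert this using 1
    rw [he, smul_sub, sub_smul, one_smul]; abel
  have hzx : xp + t • e - x = d + t • e := by rw [hd]; abel
  have h := hmin _ hz
  rw [hzx, norm_add_smul_sq, inner_add_right, inner_smul_right] at h
  have hqz : ∀ i, q i (xp + t • e) = q i xp + (t * P i + t ^ 2 / 2 * R i) := by
    intro i
    rw [hq, hq, hzx, inner_clm_add_self _ (hA i), inner_add_right, inner_smul_right]
    simp only [hP, hR, ← hd]; ring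
  have hsq : ∑ i, (max (lam i + σ * q i (xp + t • e)) 0) ^ 2 ≤
      ∑ i, (m i) ^ 2 + 2 * σ * (t * ∑ i, m i * P i + t ^ 2 * (1 / 2 * ∑ i, m i * R i))
        + σ ^ 2 * (t ^ 2 * ∑ i, (|P i| + |R i|) ^ 2) := by
    simp only [Finset.mul_sum, ← Finset.sum_add_distrib]
    refine Finset.sum_le_sum fun i _ => ?_
    have h1 := max_zero_add_sq_le (lam i + σ * q i xp) (σ * (t * P i + t ^ 2 / 2 * R i))
    -- Since t ≤ 1, the part t²/2 · R is absorbed in t|R|, which keeps the majorant purely quadratic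
    -- in t.
    have h2 : (t * P i + t ^ 2 / 2 * R i) ^ 2 ≤ t ^ 2 * (|P i| + |R i|) ^ 2 := by
      rw [← mul_pow]
      refine sq_le_sq' ?_ ?_ <;>
        nlinarith [neg_abs_le (P i), le_abs_self (P i), neg_abs_le (R i), le_abs_self (R i),
          abs_nonneg (R i), mul_le_mul_of_nonneg_left (le_abs_self (P i)) ht0.le,
          mul_le_mul_of_nonneg_left (neg_abs_le (P i)) ht0.le,
          mul_le_mul_of_nonneg_left (le_abs_self (R i)) (sq_nonneg t),
          mul_le_mul_of_nonneg_left (neg_abs_le (R i)) (sq_nonneg t),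
          mul_le_mul_of_nonneg_right (show t ^ 2 ≤ t by nlinarith) (abs_nonneg (R i))]
    rw [hqz, mul_add, ← add_assoc]
    refine h1.trans ?_
    have h3 := mul_le_mul_of_nonneg_left h2 (sq_nonneg σ)
    simp only [hm]
    nlinarith
  have hsA : ∑ i, lam i * inner ℝ (A i (d + t • e)) (d + t • e)
      = ∑ i, lam i * inner ℝ (A i d) d + t * (2 * ∑ i, lam i * inner ℝ (A i d) e)
        + t ^ 2 * ∑ i, lam i * R i := by
    simp only [Finset.mul_sum, ← Finset.sum_add_distrib]
    refine Finset.sum_congr rfl fun i _ => ?_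
    rw [inner_clm_add_self _ (hA i)]; simp only [hR]; ring
  rw [hsA] at h
  have hsq' := mul_le_mul_of_nonneg_left hsq (show 0 ≤ 1 / (2 * σ) by positivity)
  have e1 : 1 / (2 * σ) * (∑ i, (m i) ^ 2 + 2 * σ * (t * ∑ i, m i * P i
        + t ^ 2 * (1 / 2 * ∑ i, m i * R i)) + σ ^ 2 * (t ^ 2 * ∑ i, (|P i| + |R i|) ^ 2))
      = 1 / (2 * σ) * ∑ i, (m i) ^ 2 + (t * ∑ i, m i * P i
        + t ^ 2 * (1 / 2 * ∑ i, m i * R i)) + t ^ 2 * (σ / 2 * ∑ i, (|P i| + |R i|) ^ 2) := by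
    field_simp
  rw [e1] at hsq'
  simp only [mul_sub] at h
  linarith

end Step

/-! ### Deterministic estimates for one round: multiplier drift, step length, descent. -/

theorem norm_le_sqrt_mul {p : ℕ} (a : PMQS.E p) {C : ℝ} (hC : 0 ≤ C) (h : ∀ i, |a i| ≤ C) :
    ‖a‖ ≤ Real.sqrt p * C := by
  refine (norm_le_of_abs_le a (WithLp.toLp 2 (fun _ => C)) fun i => ?_).trans_eq ?_
  · simpa using (h i).trans (le_abs_self C)
  · simp [EuclideanSpace.norm_eq, Real.sqrt_sq hC]

theorem abs_max_add_zero_sub_le {a b : ℝ} (ha : 0 ≤ a) : |max (a + b) 0 - a| ≤ |b| := by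
  rcases max_cases (a + b) 0 with h | h <;> rw [h.1]
  · simp
  · rw [zero_sub, abs_neg, abs_of_nonneg ha, abs_of_neg (by linarith)]; linarith

section Step

variable {V : Type*} [NormedAddCommGroup V] [InnerProductSpace ℝ V] {p : ℕ}

theorem abs_inner_clm_le (A : V →L[ℝ] V) {κ : ℝ} (hA : ‖A‖ ≤ κ) (u v : V) :
    |inner ℝ (A u) v| ≤ κ * ‖u‖ * ‖v‖ :=
  (abs_real_inner_le_norm _ _).trans (mul_le_mul_of_nonneg_right
    ((A.le_opNorm u).trans (mul_le_mul_of_nonneg_right hA (norm_nonneg _))) (norm_nonneg _))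

theorem abs_inner_add_quad_le {A : V →L[ℝ] V} {κ κg D₀ : ℝ} (hA : ‖A‖ ≤ κ) {w : V}
    (hw : ‖w‖ ≤ κg) {u : V} (hu : ‖u‖ ≤ D₀) :
    |inner ℝ w u + 1 / 2 * inner ℝ (A u) u| ≤ (κg + κ * D₀ / 2) * ‖u‖ := by
  have h1 := abs_inner_clm_le A hA u u
  have h2 : |inner ℝ w u| ≤ κg * ‖u‖ :=
    (abs_real_inner_le_norm _ _).trans (mul_le_mul_of_nonneg_right hw (norm_nonneg _))
  have hκ : 0 ≤ κ := (norm_nonneg _).trans hA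
  have h3 : κ * ‖u‖ * ‖u‖ ≤ κ * D₀ * ‖u‖ := by gcongr
  calc _ ≤ |inner ℝ w u| + |1 / 2 * inner ℝ (A u) u| := abs_add_le _ _
    _ ≤ κg * ‖u‖ + 1 / 2 * (κ * D₀ * ‖u‖) := by
        rw [abs_mul, abs_of_pos (by norm_num : (0 : ℝ) < 1 / 2)]
        linarith
    _ = _ := by ring

/-- One-step drift of the squared norm of the multiplier. -/
theorem multiplier_drift {x xp y v : V} (c g : Fin p → ℝ) (w : Fin p → V)
    (A : Fin p → V →L[ℝ] V) (hA : ∀ i u v, inner ℝ (A i u) v = inner ℝ (A i v) u)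
    (hAneg : ∀ i u, inner ℝ (A i u) u ≤ 0) {κS : ℝ} (hAn : ∀ i, ‖A i‖ ≤ κS)
    (lam mu : PMQS.E p) (hlam : ∀ i, 0 ≤ lam i)
    {σ α τ κf D₀ ε₀ γ₁ : ℝ} (hσ : 0 < σ) (hατ : 0 ≤ α + τ) (q : Fin p → V → ℝ)
    (hq : ∀ i z, q i z = c i + inner ℝ (w i) (z - x) + 1 / 2 * inner ℝ (A i (z - x)) (z - x))
    (hmu : ∀ i, mu i = max (lam i + σ * q i xp) 0)
    (hvi : 0 ≤ inner ℝ v (y - xp)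
      + ∑ i, mu i * (inner ℝ (w i) (y - xp) + inner ℝ (A i (xp - x)) (y - xp))
      - ∑ i, lam i * inner ℝ (A i (xp - x)) (y - xp) + (α + τ) * inner ℝ (xp - x) (y - xp))
    (hκS : 0 ≤ κS) (hv : ‖v‖ ≤ κf) (hyp : ‖y - xp‖ ≤ D₀)
    (hg : ∀ i, c i + inner ℝ (w i) (y - x) ≤ g i + κS * D₀ ^ 2 / 2)
    (hqy : ‖(WithLp.toLp 2 (fun i => q i y) : PMQS.E p)‖ ≤ γ₁)
    (hmulam : ‖mu - lam‖ ≤ σ * γ₁)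
    (hε : Real.sqrt p * κS * D₀ ^ 2 ≤ ε₀) (hεγ : ε₀ ≤ γ₁) (hε0 : 0 ≤ ε₀) :
    ‖mu‖ ^ 2 - ‖lam‖ ^ 2 ≤ 2 * σ * κf * D₀ + 2 * σ ^ 2 * γ₁ ^ 2
      + σ * (α + τ) * (‖y - x‖ ^ 2 - ‖y - xp‖ ^ 2) + 2 * σ * ∑ i, lam i * g i
      + σ * ε₀ * ‖lam‖ := by
  set d := xp - x with hd
  set e := y - xp with he
  have hyx : y - x = d + (1 : ℝ) • e := by rw [hd, he, one_smul]; abel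
  -- Complementarity: either mu i vanishes or the positive part is inactive. The negative squared
  -- increment will pay for the terms linear in ‖mu - lam‖.
  have hcomp : ∀ i, mu i ^ 2 - lam i ^ 2 = 2 * σ * (mu i * q i xp) - (mu i - lam i) ^ 2 := by
    intro i
    have : mu i * (mu i - (lam i + σ * q i xp)) = 0 := by
      rw [hmu]
      rcases max_cases (lam i + σ * q i xp) 0 with h | h <;> rw [h.1] <;> ring
    nlinarith
  have hsum : ‖mu‖ ^ 2 - ‖lam‖ ^ 2 = 2 * σ * ∑ i, mu i * q i xp - ‖mu - lam‖ ^ 2 := by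
    simp only [EuclideanSpace.real_norm_sq_eq, PiLp.sub_apply, Finset.mul_sum,
      ← Finset.sum_sub_distrib]
    exact Finset.sum_congr rfl fun i _ => hcomp i
  have hqd : ∀ i, q i y = q i xp + (inner ℝ (w i) e + inner ℝ (A i d) e)
      + 1 / 2 * inner ℝ (A i e) e := by
    intro i
    rw [hq, hq, hyx, inner_clm_add_self _ (hA i), one_smul, inner_add_right]
    simp only [← hd]; ring
  have hly : ∀ i, q i y = c i + inner ℝ (w i) (y - x) + 1 / 2 * inner ℝ (A i d) d
      + inner ℝ (A i d) e + 1 / 2 * inner ℝ (A i e) e := by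
    intro i
    rw [hq]
    nth_rewrite 2 3 [hyx]
    rw [inner_clm_add_self _ (hA i)]; ring
  -- decomposition of `∑ μᵢ qᵢ(x⁺)`
  have hterm : ∀ i, mu i * q i xp = (mu i - lam i) * q i y
      + lam i * (c i + inner ℝ (w i) (y - x)) + 1 / 2 * (lam i * inner ℝ (A i d) d)
      + 1 / 2 * ((lam i - mu i) * inner ℝ (A i e) e)
      - mu i * (inner ℝ (w i) e + inner ℝ (A i d) e) + lam i * inner ℝ (A i d) e := by
    intro i
    have h1 := hqd i
    have h2 := hly i
    linear_combination (-mu i) * h1 + lam i * h2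
  have hdec : ∑ i, mu i * q i xp = ∑ i, (mu i - lam i) * q i y
      + ∑ i, lam i * (c i + inner ℝ (w i) (y - x)) + 1 / 2 * ∑ i, lam i * inner ℝ (A i d) d
      + 1 / 2 * ∑ i, (lam i - mu i) * inner ℝ (A i e) e
      - ∑ i, mu i * (inner ℝ (w i) e + inner ℝ (A i d) e) + ∑ i, lam i * inner ℝ (A i d) e := by
    rw [Finset.sum_congr rfl fun i _ => hterm i]
    simp only [Finset.sum_add_distrib, Finset.sum_sub_distrib, Finset.mul_sum]
  have b1 : ∑ i, (mu i - lam i) * q i y ≤ ‖mu - lam‖ * γ₁ :=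
    (sum_mul_le_norm_mul_norm (mu - lam) (WithLp.toLp 2 (fun i => q i y))).trans
      (mul_le_mul_of_nonneg_left hqy (norm_nonneg _))
  -- After the factor 2σ this error becomes σε₀‖lam‖, half of the decrease 2σε₀‖lam‖ that a Slater
  -- point supplies.
  have b2 : ∑ i, lam i * (c i + inner ℝ (w i) (y - x)) ≤ ∑ i, lam i * g i + ε₀ / 2 * ‖lam‖ := by
    calc _ ≤ ∑ i, (lam i * g i + |lam i| * (κS * D₀ ^ 2 / 2)) :=
          Finset.sum_le_sum fun i _ => by
            rw [abs_of_nonneg (hlam i), ← mul_add]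
            exact mul_le_mul_of_nonneg_left (hg i) (hlam i)
      _ = ∑ i, lam i * g i + (∑ i, |lam i|) * (κS * D₀ ^ 2 / 2) := by
          rw [Finset.sum_add_distrib, Finset.sum_mul]
      _ ≤ ∑ i, lam i * g i + (Real.sqrt p * ‖lam‖) * (κS * D₀ ^ 2 / 2) := by
          gcongr; exact sum_abs_le_sqrt_mul_norm lam
      _ ≤ _ := by nlinarith [mul_le_mul_of_nonneg_right hε (norm_nonneg lam)]
  have b3 : ∑ i, lam i * inner ℝ (A i d) d ≤ 0 :=
    Finset.sum_nonpos fun i _ => mul_nonpos_of_nonneg_of_nonpos (hlam i) (hAneg i d)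
  have b4 : ∑ i, (lam i - mu i) * inner ℝ (A i e) e ≤ ε₀ * ‖mu - lam‖ := by
    calc _ ≤ ∑ i, |(mu - lam) i| * (κS * D₀ ^ 2) := Finset.sum_le_sum fun i _ => by
          refine (le_abs_self _).trans ?_
          rw [abs_mul, abs_sub_comm]
          refine mul_le_mul_of_nonneg_left ((abs_inner_clm_le _ (hAn i) e e).trans ?_)
            (abs_nonneg _)
          nlinarith [mul_le_mul hyp hyp (norm_nonneg e) ((norm_nonneg e).trans hyp)]
      _ = (∑ i, |(mu - lam) i|) * (κS * D₀ ^ 2) := by rw [Finset.sum_mul]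
      _ ≤ (Real.sqrt p * ‖mu - lam‖) * (κS * D₀ ^ 2) := by
          gcongr; exact sum_abs_le_sqrt_mul_norm _
      _ ≤ _ := by nlinarith [mul_le_mul_of_nonneg_right hε (norm_nonneg (mu - lam))]
  have b5 : inner ℝ v e ≤ κf * D₀ := (real_inner_le_norm _ _).trans
    (mul_le_mul hv hyp (norm_nonneg _) ((norm_nonneg _).trans hv))
  have b6 : 2 * inner ℝ d e = ‖y - x‖ ^ 2 - ‖d‖ ^ 2 - ‖e‖ ^ 2 := by
    rw [hyx, norm_add_smul_sq]; ring
  have b7 : (α + τ) * inner ℝ d e ≤ (α + τ) / 2 * (‖y - x‖ ^ 2 - ‖e‖ ^ 2) := by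
    nlinarith [mul_nonneg hατ (sq_nonneg ‖d‖)]
  have hmain : ∑ i, mu i * q i xp ≤ ‖mu - lam‖ * γ₁ + ∑ i, lam i * g i + ε₀ / 2 * ‖lam‖
      + 1 / 2 * (ε₀ * ‖mu - lam‖) + κf * D₀ + (α + τ) / 2 * (‖y - x‖ ^ 2 - ‖e‖ ^ 2) := by
    linarith
  have hfin := mul_le_mul_of_nonneg_left hmain (show 0 ≤ 2 * σ by positivity)
  -- One σ²γ₁² comes from completing the square in ‖mu - lam‖, the other from ε₀ ≤ γ₁ and ‖mu - lam‖
  -- ≤ σγ₁.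
  have hN : 2 * σ * (‖mu - lam‖ * γ₁) + σ * (ε₀ * ‖mu - lam‖) - ‖mu - lam‖ ^ 2
      ≤ 2 * σ ^ 2 * γ₁ ^ 2 := by
    have k1 : ε₀ * ‖mu - lam‖ ≤ γ₁ * (σ * γ₁) :=
      mul_le_mul hεγ hmulam (norm_nonneg _) (hε0.trans hεγ)
    linarith [sq_nonneg (‖mu - lam‖ - σ * γ₁), mul_le_mul_of_nonneg_left k1 hσ.le]
  rw [hsum]
  linarith

/-- Bound on the length of one step. -/
theorem step_length_le {x xp v : V} (c₀ : ℝ) (c : Fin p → ℝ) (w : Fin p → V)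
    (A : Fin p → V →L[ℝ] V)
    (hAneg : ∀ i u, inner ℝ (A i u) u ≤ 0) {κS : ℝ} (hAn : ∀ i, ‖A i‖ ≤ κS)
    (lam : PMQS.E p) (hlam : ∀ i, 0 ≤ lam i)
    {σ α τ κf κg D₀ νg : ℝ} (hσ : 0 < σ) (q : Fin p → V → ℝ)
    (hq : ∀ i z, q i z = c i + inner ℝ (w i) (z - x) + 1 / 2 * inner ℝ (A i (z - x)) (z - x))
    (hmin : c₀ + inner ℝ v (xp - x) + 1 / 2 * (-(∑ i, lam i * inner ℝ (A i (xp - x)) (xp - x))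
        + τ * ‖xp - x‖ ^ 2)
        + 1 / (2 * σ) * ((∑ i, (max (lam i + σ * q i xp) 0) ^ 2) - ‖lam‖ ^ 2)
        + α / 2 * ‖xp - x‖ ^ 2 ≤
      c₀ + 1 / (2 * σ) * ((∑ i, (max (lam i + σ * q i x) 0) ^ 2) - ‖lam‖ ^ 2))
    (hv : ‖v‖ ≤ κf) (hw : ∀ i, ‖w i‖ ≤ κg) (hD : ‖xp - x‖ ≤ D₀)
    (hc : ‖(WithLp.toLp 2 c : PMQS.E p)‖ ≤ νg) (hκ : 0 ≤ κg + κS * D₀ / 2) :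
    (α + τ) * ‖xp - x‖ ≤
      2 * (κf + (κg + κS * D₀ / 2) * Real.sqrt p * (‖lam‖ + σ * νg)) := by
  set d := xp - x with hd
  set κ := κg + κS * D₀ / 2 with hκdef
  have hqx : ∀ i, q i x = c i := fun i => by simp [hq]
  have hqp : ∀ i, |q i x - q i xp| ≤ κ * ‖d‖ := fun i => by
    rw [hqx, hq, abs_sub_comm]
    have := abs_inner_add_quad_le (hAn i) (hw i) hD
    convert this using 2; ring
  set a : PMQS.E p := WithLp.toLp 2 (fun i => max (lam i + σ * c i) 0) with ha
  have han : ‖a‖ ≤ ‖lam‖ + σ * νg := by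
    calc ‖a‖ ≤ ‖lam + σ • (WithLp.toLp 2 c : PMQS.E p)‖ := norm_le_of_abs_le _ _ fun i => by
          simp only [ha, PiLp.add_apply, PiLp.smul_apply, smul_eq_mul]
          rw [abs_of_nonneg (le_max_right _ _)]
          exact max_le (le_abs_self _) (abs_nonneg _)
      _ ≤ ‖lam‖ + ‖σ • (WithLp.toLp 2 c : PMQS.E p)‖ := norm_add_le _ _
      _ ≤ _ := by
          rw [norm_smul, Real.norm_eq_abs, abs_of_pos hσ]; gcongr
  have hcmp : ∀ i, (max (lam i + σ * q i x) 0) ^ 2 - (max (lam i + σ * q i xp) 0) ^ 2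
      ≤ 2 * σ * (κ * ‖d‖) * |a i| := by
    intro i
    have h1 : |a i| = max (lam i + σ * q i x) 0 := by
      simp only [ha, hqx]; rw [abs_of_nonneg (le_max_right _ _)]
    rw [h1]
    set u := lam i + σ * q i x
    set u' := lam i + σ * q i xp
    have h2 : u - u' ≤ σ * (κ * ‖d‖) := by
      have := (le_abs_self _).trans (hqp i)
      calc u - u' = σ * (q i x - q i xp) := by simp only [u, u']; ring
        _ ≤ _ := by gcongr
    -- Convexity of the squared positive part, with the slope taken at the old point x, where it is
    -- controlled by ‖lam‖ and νg.
    have h3 : (max u 0) ^ 2 - (max u' 0) ^ 2 ≤ 2 * max u 0 * (u - u') := by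
      rcases max_cases u 0 with h | h <;> rcases max_cases u' 0 with h' | h' <;>
        rw [h.1, h'.1] <;> nlinarith [sq_nonneg (u - u')]
    nlinarith [mul_le_mul_of_nonneg_left h2 (le_max_right u 0)]
  have hs : (∑ i, (max (lam i + σ * q i x) 0) ^ 2) - ∑ i, (max (lam i + σ * q i xp) 0) ^ 2
      ≤ 2 * σ * (κ * ‖d‖) * (Real.sqrt p * (‖lam‖ + σ * νg)) := by
    rw [← Finset.sum_sub_distrib]
    calc _ ≤ ∑ i, 2 * σ * (κ * ‖d‖) * |a i| := Finset.sum_le_sum fun i _ => hcmp i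
      _ = 2 * σ * (κ * ‖d‖) * ∑ i, |a i| := by rw [Finset.mul_sum]
      _ ≤ _ := by
          gcongr
          exact (sum_abs_le_sqrt_mul_norm a).trans (by gcongr)
  have b3 : ∑ i, lam i * inner ℝ (A i d) d ≤ 0 :=
    Finset.sum_nonpos fun i _ => mul_nonpos_of_nonneg_of_nonpos (hlam i) (hAneg i d)
  have b5 : -(κf * ‖d‖) ≤ inner ℝ v d := by
    have := (abs_le.1 (abs_real_inner_le_norm v d)).1
    nlinarith [mul_le_mul_of_nonneg_right hv (norm_nonneg d)]
  have hs' := mul_le_mul_of_nonneg_left hs (show 0 ≤ 1 / (2 * σ) by positivity)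
  have e1 : 1 / (2 * σ) * (2 * σ * (κ * ‖d‖) * (Real.sqrt p * (‖lam‖ + σ * νg)))
      = κ * ‖d‖ * (Real.sqrt p * (‖lam‖ + σ * νg)) := by field_simp
  rw [e1, mul_sub] at hs'
  -- Against the competitor z = x, the quadratic terms in d are bounded by terms linear in ‖d‖; one
  -- factor ‖d‖ is then cancelled, with d = 0 treated apart.
  have hfin : (α + τ) * ‖d‖ * ‖d‖ ≤ 2 * (κf + κ * Real.sqrt p * (‖lam‖ + σ * νg)) * ‖d‖ := by
    nlinarith
  rcases (norm_nonneg d).eq_or_lt with h | h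
  · rw [← h, mul_zero]
    have := (norm_nonneg v).trans hv
    have := (norm_nonneg a).trans han
    positivity
  · exact le_of_mul_le_mul_right hfin h

/-- One-step contraction towards a reference point. -/
theorem prox_step_descent {x xp y v : V} (Fx Fy : ℝ) (c g ℓ : Fin p → ℝ) (w : Fin p → V)
    (A : Fin p → V →L[ℝ] V) {κS : ℝ} (hAn : ∀ i, ‖A i‖ ≤ κS)
    (lam mu : PMQS.E p) (hlam : ∀ i, 0 ≤ lam i)
    {α τ κf κg D₀ L₀ β δ : ℝ} (hατ : 0 < α + τ)
    (hvi : 0 ≤ inner ℝ v (y - xp)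
      + ∑ i, mu i * (inner ℝ (w i) (y - xp) + inner ℝ (A i (xp - x)) (y - xp))
      - ∑ i, lam i * inner ℝ (A i (xp - x)) (y - xp) + (α + τ) * inner ℝ (xp - x) (y - xp))
    (hv : ‖v‖ ≤ κf) (hw : ∀ i, ‖w i‖ ≤ κg) (hyp : ‖y - xp‖ ≤ D₀) (hyx : ‖y - x‖ ≤ D₀)
    (hF : Fx + inner ℝ v (y - x) ≤ Fy + L₀ / 2 * ‖y - x‖ ^ 2)
    (hg : ∀ i, c i + inner ℝ (w i) (y - x) ≤ g i + ℓ i / 2 * ‖y - x‖ ^ 2)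
    (hβ : L₀ + ∑ i, ℓ i * lam i ≤ β) (hδ0 : 0 ≤ δ) (hκg : 0 ≤ κg) (hκS : 0 ≤ κS)
    (hδ : ∀ i, |mu i - lam i| ≤ δ) :
    (α + τ) / 2 * ‖y - xp‖ ^ 2 ≤ (α + τ) / 2 * ‖y - x‖ ^ 2
      + (Fy - Fx + ∑ i, lam i * (g i - c i)) + β / 2 * ‖y - x‖ ^ 2 + p * δ * κg * D₀
      + (κf + Real.sqrt p * κg * ‖mu‖ + p * δ * κS * D₀) ^ 2 / (2 * (α + τ)) := by
  set d := xp - x with hd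
  set e := y - xp with he
  have hyx' : y - x = d + e := by rw [hd, he]; abel
  have hD : 0 ≤ D₀ := (norm_nonneg _).trans hyp
  have b6 : 2 * inner ℝ d e = ‖y - x‖ ^ 2 - ‖d‖ ^ 2 - ‖e‖ ^ 2 := by
    rw [hyx', norm_add_sq_real]; ring
  have b1 : inner ℝ v e ≤ Fy - Fx + L₀ / 2 * ‖y - x‖ ^ 2 + κf * ‖d‖ := by
    have h1 : inner ℝ v e = inner ℝ v (y - x) - inner ℝ v d := by
      rw [hyx', inner_add_right]; ring
    have h2 := (abs_le.1 (abs_real_inner_le_norm v d)).1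
    nlinarith [mul_le_mul_of_nonneg_right hv (norm_nonneg d)]
  have hmwi : ∀ i, mu i * inner ℝ (w i) e ≤ lam i * (g i - c i) + (ℓ i * lam i) / 2 * ‖y - x‖ ^ 2
      + δ * κg * D₀ + κg * ‖d‖ * |mu i| := by
    intro i
    have h1 : inner ℝ (w i) e = inner ℝ (w i) (y - x) - inner ℝ (w i) d := by
      rw [hyx', inner_add_right]; ring
    have h2 : -(mu i * inner ℝ (w i) d) ≤ κg * ‖d‖ * |mu i| := by
      refine (neg_le_abs _).trans ?_
      rw [abs_mul, mul_comm]
      gcongr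
      exact (abs_real_inner_le_norm _ _).trans (by gcongr; exact hw i)
    have h3 : (mu i - lam i) * inner ℝ (w i) (y - x) ≤ δ * (κg * D₀) := by
      refine (le_abs_self _).trans ?_
      rw [abs_mul]
      refine mul_le_mul (hδ i) ((abs_real_inner_le_norm _ _).trans ?_) (abs_nonneg _) hδ0
      exact mul_le_mul (hw i) hyx (norm_nonneg _) hκg
    have h4 := mul_le_mul_of_nonneg_left (hg i) (hlam i)
    rw [h1]; nlinarith
  have hAi : ∀ i, (mu i - lam i) * inner ℝ (A i d) e ≤ δ * κS * D₀ * ‖d‖ := by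
    intro i
    refine (le_abs_self _).trans ?_
    rw [abs_mul]
    calc _ ≤ δ * (κS * ‖d‖ * D₀) := by
          refine mul_le_mul (hδ i) ((abs_inner_clm_le _ (hAn i) d e).trans ?_) (abs_nonneg _) hδ0
          gcongr
      _ = _ := by ring
  -- The matrices survive only against mu - lam. In the gradient part, mu is traded for lam only
  -- against y - x, at cost δ κg D₀ per constraint; the part against d keeps mu, which is why ‖mu‖
  -- appears.
  have hs : ∑ i, mu i * (inner ℝ (w i) e + inner ℝ (A i d) e) - ∑ i, lam i * inner ℝ (A i d) e
      ≤ ∑ i, lam i * (g i - c i) + (∑ i, ℓ i * lam i) / 2 * ‖y - x‖ ^ 2 + p * δ * κg * D₀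
        + κg * ‖d‖ * (Real.sqrt p * ‖mu‖) + p * δ * κS * D₀ * ‖d‖ := by
    have hsa : κg * ‖d‖ * ∑ i, |mu i| ≤ κg * ‖d‖ * (Real.sqrt p * ‖mu‖) := by
      gcongr; exact sum_abs_le_sqrt_mul_norm mu
    calc _ = ∑ i, (mu i * inner ℝ (w i) e + (mu i - lam i) * inner ℝ (A i d) e) := by
          rw [← Finset.sum_sub_distrib]
          exact Finset.sum_congr rfl fun i _ => by ring
      _ ≤ ∑ i, ((lam i * (g i - c i) + (ℓ i * lam i) / 2 * ‖y - x‖ ^ 2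
          + δ * κg * D₀ + κg * ‖d‖ * |mu i|) + δ * κS * D₀ * ‖d‖) :=
          Finset.sum_le_sum fun i _ => add_le_add (hmwi i) (hAi i)
      _ = ∑ i, lam i * (g i - c i) + (∑ i, ℓ i * lam i) / 2 * ‖y - x‖ ^ 2 + p * δ * κg * D₀
        + κg * ‖d‖ * (∑ i, |mu i|) + p * δ * κS * D₀ * ‖d‖ := by
          simp only [Finset.sum_add_distrib, Finset.mul_sum, Finset.sum_mul, Finset.sum_div,
            Finset.sum_const, Finset.card_univ, Fintype.card_fin, nsmul_eq_mul]
          ring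
      _ ≤ _ := by linarith
  set a := κf + Real.sqrt p * κg * ‖mu‖ + p * δ * κS * D₀ with ha
  -- Young's inequality: everything linear in ‖d‖ is absorbed by the -(α+τ)/2 ‖d‖² of the
  -- three-point identity `b6`.
  have hsq : a * ‖d‖ - (α + τ) / 2 * ‖d‖ ^ 2 ≤ a ^ 2 / (2 * (α + τ)) := by
    rw [le_div_iff₀ (by positivity)]
    nlinarith [sq_nonneg (a - (α + τ) * ‖d‖)]
  have hβ' := mul_le_mul_of_nonneg_right hβ (sq_nonneg ‖y - x‖)
  have : a * ‖d‖ = κf * ‖d‖ + κg * ‖d‖ * (Real.sqrt p * ‖mu‖) + p * δ * κS * D₀ * ‖d‖ := by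
    rw [ha]; ring
  nlinarith

end Step

/-! ### Weak convexity and its stability under expectation and nonnegative combinations. -/

theorem add_le_of_forall_add_mul_le {a b c : ℝ}
    (h : ∀ t : ℝ, 0 < t → t < 1 → a + (1 - t) * b ≤ c) : a + b ≤ c := by
  have ht : Filter.Tendsto (fun t : ℝ => a + (1 - t) * b) (nhdsWithin 0 (Set.Ioi 0))
      (nhds (a + (1 - 0) * b)) :=
    ((by fun_prop : Continuous fun t : ℝ => a + (1 - t) * b).tendsto 0).mono_left
      nhdsWithin_le_nhds
  have := le_of_tendsto ht (by
    filter_upwards [Ioo_mem_nhdsGT (zero_lt_one' ℝ)] with t ht using h t ht.1 ht.2)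
  simpa using this

section WeaklyConvex

variable {n p : ℕ} {O : Set (PMQS.E n)} {h : PMQS.E n → ℝ} {ℓ : ℝ}

theorem norm_convex_comb_sq (x y : PMQS.E n) (t : ℝ) :
    ‖(1 - t) • x + t • y‖ ^ 2
      = (1 - t) * ‖x‖ ^ 2 + t * ‖y‖ ^ 2 - t * (1 - t) * ‖y - x‖ ^ 2 := by
  rw [norm_add_sq_real, norm_sub_sq_real, inner_smul_left, inner_smul_right, norm_smul, norm_smul,
    mul_pow, mul_pow, Real.norm_eq_abs, Real.norm_eq_abs, sq_abs, sq_abs, real_inner_comm]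
  simp only [conj_trivial]; ring

/-- By `norm_convex_comb_sq` the quadratic terms combine into a multiple of ‖y - x‖². This form is
independent of the origin, and it passes directly to integrals and weighted sums. -/
theorem weaklyConvexOn_iff : PMQS.WeaklyConvexOn O ℓ h ↔ Convex ℝ O ∧ ∀ x ∈ O, ∀ y ∈ O,
    ∀ t : ℝ, 0 ≤ t → t ≤ 1 → h ((1 - t) • x + t • y)
      ≤ (1 - t) * h x + t * h y + ℓ / 2 * (t * (1 - t)) * ‖y - x‖ ^ 2 := by
  refine and_congr_right fun _ => ⟨fun H x hx y hy t h0 h1 => ?_, fun H x hx y hy a b ha hb hab => ?_⟩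
  · have := H hx hy (a := 1 - t) (b := t) (by linarith) h0 (by ring)
    simp only [smul_eq_mul] at this
    rw [norm_convex_comb_sq] at this
    linarith
  · obtain rfl : a = 1 - b := by linarith
    have := H x hx y hy b hb (by linarith)
    simp only [smul_eq_mul]
    rw [norm_convex_comb_sq]
    linarith

/-- The chord inequality of `weaklyConvexOn_iff`, divided by t, in the limit t ↓ 0. -/
theorem WeaklyConvexOn.inner_gradient_le (H : PMQS.WeaklyConvexOn O ℓ h) {x y : PMQS.E n}
    (hx : x ∈ O) (hy : y ∈ O) (hd : DifferentiableAt ℝ h x) :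
    h x + inner ℝ (gradient h x) (y - x) ≤ h y + ℓ / 2 * ‖y - x‖ ^ 2 := by
  have hline : HasDerivAt (fun t : ℝ => h (x + t • (y - x))) (inner ℝ (gradient h x) (y - x)) 0 := by
    have hg := hd.hasGradientAt.hasFDerivAt
    have hl : HasDerivAt (fun t : ℝ => x + t • (y - x)) (y - x) 0 := by
      simpa using ((hasDerivAt_id (0 : ℝ)).smul_const (y - x)).const_add x
    have hg' : HasFDerivAt h ((InnerProductSpace.toDual ℝ (PMQS.E n)) (gradient h x))
        (x + (0 : ℝ) • (y - x)) := by simpa using hg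
    exact hg'.comp_hasDerivAt (0 : ℝ) hl
  have hs := hline.tendsto_slope_zero_right
  simp only [zero_add, zero_smul, add_zero, smul_eq_mul] at hs
  have hb : Filter.Tendsto (fun t : ℝ => h y - h x + ℓ / 2 * (1 - t) * ‖y - x‖ ^ 2)
      (nhdsWithin 0 (Set.Ioi 0)) (nhds (h y - h x + ℓ / 2 * (1 - 0) * ‖y - x‖ ^ 2)) :=
    ((by fun_prop : Continuous fun t : ℝ => h y - h x + ℓ / 2 * (1 - t) * ‖y - x‖ ^ 2).tendsto
      0).mono_left nhdsWithin_le_nhds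
  have hle := le_of_tendsto_of_tendsto hs hb (by
    filter_upwards [Ioo_mem_nhdsGT (zero_lt_one' ℝ)] with t ht
    have h1 := (weaklyConvexOn_iff.1 H).2 x hx y hy t ht.1.le ht.2.le
    have h2 : (1 - t) • x + t • y = x + t • (y - x) := by
      rw [smul_sub, sub_smul, one_smul]; abel
    rw [h2] at h1
    rw [inv_mul_le_iff₀ ht.1]
    linarith)
  linarith

theorem abs_sub_le_of_gradient_le (hO : IsOpen O) (hOc : Convex ℝ O)
    (hd : DifferentiableOn ℝ h O) {κ : ℝ} (hκ : ∀ x ∈ O, ‖gradient h x‖ ≤ κ) {x y : PMQS.E n}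
    (hx : x ∈ O) (hy : y ∈ O) : |h y - h x| ≤ κ * ‖y - x‖ := by
  refine hOc.norm_image_sub_le_of_norm_fderiv_le (𝕜 := ℝ)
    (fun z hz => hd.differentiableAt (hO.mem_nhds hz)) (fun z hz => ?_) hx hy
  have := hκ z hz
  rwa [gradient, LinearIsometryEquiv.norm_map] at this

theorem WeaklyConvexOn.mono_set (H : PMQS.WeaklyConvexOn O ℓ h) {X : Set (PMQS.E n)}
    (hX : Convex ℝ X) (hXO : X ⊆ O) : PMQS.WeaklyConvexOn X ℓ h :=
  ConvexOn.subset H hXO hX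

theorem WeaklyConvexOn.mono (H : PMQS.WeaklyConvexOn O ℓ h) {ℓ' : ℝ} (hl : ℓ ≤ ℓ') :
    PMQS.WeaklyConvexOn O ℓ' h := by
  rw [weaklyConvexOn_iff] at H ⊢
  refine ⟨H.1, fun x hx y hy t h0 h1 => (H.2 x hx y hy t h0 h1).trans ?_⟩
  have : 0 ≤ t * (1 - t) := mul_nonneg h0 (by linarith)
  gcongr

theorem weaklyConvexOn_expVal {Ξ : Type*} [MeasurableSpace Ξ] {P : Measure Ξ}
    [IsProbabilityMeasure P] {H : PMQS.E n → Ξ → ℝ} (hOc : Convex ℝ O)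
    (hint : ∀ x ∈ O, Integrable (H x) P)
    (hwc : ∀ z, PMQS.WeaklyConvexOn O ℓ (fun x => H x z)) :
    PMQS.WeaklyConvexOn O ℓ (PMQS.expVal P H) := by
  rw [weaklyConvexOn_iff]
  refine ⟨hOc, fun x hx y hy t h0 h1 => ?_⟩
  have hm : (1 - t) • x + t • y ∈ O := hOc hx hy (by linarith) h0 (by ring)
  have hi : Integrable (fun z => (1 - t) * H x z + t * H y z) P :=
    ((hint x hx).const_mul _).add ((hint y hy).const_mul _)
  have := integral_mono (hint _ hm) (hi.add (integrable_const
    (ℓ / 2 * (t * (1 - t)) * ‖y - x‖ ^ 2)))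
    fun z => (weaklyConvexOn_iff.1 (hwc z)).2 x hx y hy t h0 h1
  simp only [Pi.add_apply] at this
  rw [integral_add hi (integrable_const _), integral_add ((hint x hx).const_mul _)
    ((hint y hy).const_mul _), integral_const_mul, integral_const_mul] at this
  simpa [PMQS.expVal] using this

theorem abs_expVal_sub_le {Ξ : Type*} [MeasurableSpace Ξ] {P : Measure Ξ}
    [IsProbabilityMeasure P] {H : PMQS.E n → Ξ → ℝ} (hint : ∀ x ∈ O, Integrable (H x) P) {κ : ℝ}
    (hlip : ∀ x ∈ O, ∀ y ∈ O, ∀ z, |H y z - H x z| ≤ κ * ‖y - x‖) {x y : PMQS.E n}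
    (hx : x ∈ O) (hy : y ∈ O) :
    |PMQS.expVal P H y - PMQS.expVal P H x| ≤ κ * ‖y - x‖ := by
  rw [PMQS.expVal, PMQS.expVal, ← integral_sub (hint y hy) (hint x hx)]
  have := norm_integral_le_of_norm_le_const (μ := P) (f := fun z => H y z - H x z)
    (Filter.Eventually.of_forall fun z => hlip x hx y hy z)
  simpa using this

theorem continuousOn_of_abs_sub_le {κ : ℝ}
    (hlip : ∀ x ∈ O, ∀ y ∈ O, |h y - h x| ≤ κ * ‖y - x‖) : ContinuousOn h O := by
  refine (LipschitzOnWith.of_dist_le_mul (K := κ.toNNReal) fun x hx y hy => ?_).continuousOn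
  rw [Real.dist_eq, dist_eq_norm]
  exact (hlip y hy x hx).trans (by gcongr; exact Real.le_coe_toNNReal κ)

theorem weaklyConvexOn_add_sum {f : PMQS.E n → ℝ} {g : Fin p → PMQS.E n → ℝ} {L₀ : ℝ}
    {L : Fin p → ℝ} (hf : PMQS.WeaklyConvexOn O L₀ f)
    (hg : ∀ i, PMQS.WeaklyConvexOn O (L i) (g i)) {lam : Fin p → ℝ} (hlam : ∀ i, 0 ≤ lam i) :
    PMQS.WeaklyConvexOn O (L₀ + ∑ i, L i * lam i) (fun x => f x + ∑ i, lam i * g i x) := by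
  rw [weaklyConvexOn_iff] at hf ⊢
  refine ⟨hf.1, fun x hx y hy t h0 h1 => ?_⟩
  have hs : ∑ i, lam i * g i ((1 - t) • x + t • y) ≤ ∑ i, lam i * ((1 - t) * g i x + t * g i y
      + L i / 2 * (t * (1 - t)) * ‖y - x‖ ^ 2) := Finset.sum_le_sum fun i _ =>
    mul_le_mul_of_nonneg_left ((weaklyConvexOn_iff.1 (hg i)).2 x hx y hy t h0 h1) (hlam i)
  have e : ∑ i, lam i * ((1 - t) * g i x + t * g i y
      + L i / 2 * (t * (1 - t)) * ‖y - x‖ ^ 2) = (1 - t) * ∑ i, lam i * g i x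
      + t * ∑ i, lam i * g i y + (∑ i, L i * lam i) / 2 * (t * (1 - t)) * ‖y - x‖ ^ 2 := by
    simp only [Finset.mul_sum, Finset.sum_mul, Finset.sum_div, ← Finset.sum_add_distrib]
    exact Finset.sum_congr rfl fun i _ => by ring
  have := hf.2 x hx y hy t h0 h1
  rw [e] at hs
  linarith

end WeaklyConvex

/-! ### Proximal points and the gradient of the Moreau envelope. -/

section Prox

variable {n : ℕ} {X : Set (PMQS.E n)} {h h' : PMQS.E n → ℝ} {α β : ℝ}

/-- A proximal point: a minimizer over `X` of `h(z) + (α/2)‖z - x‖²`. -/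
noncomputable def proxPt (X : Set (PMQS.E n)) (h : PMQS.E n → ℝ) (α : ℝ) (x : PMQS.E n) :
    PMQS.E n :=
  Classical.epsilon fun y => y ∈ X ∧ ∀ z ∈ X,
    h y + α / 2 * ‖y - x‖ ^ 2 ≤ h z + α / 2 * ‖z - x‖ ^ 2

theorem proxPt_spec (hX : IsCompact X) (hne : X.Nonempty) (hh : ContinuousOn h X) (x : PMQS.E n) :
    proxPt X h α x ∈ X ∧ ∀ z ∈ X,
      h (proxPt X h α x) + α / 2 * ‖proxPt X h α x - x‖ ^ 2 ≤ h z + α / 2 * ‖z - x‖ ^ 2 := by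
  refine Classical.epsilon_spec (p := fun y => y ∈ X ∧ ∀ z ∈ X,
    h y + α / 2 * ‖y - x‖ ^ 2 ≤ h z + α / 2 * ‖z - x‖ ^ 2) ?_
  obtain ⟨y, hy, hmin⟩ := hX.exists_isMinOn hne
    (hh.add (by fun_prop : ContinuousOn (fun z => α / 2 * ‖z - x‖ ^ 2) X))
  exact ⟨y, hy, fun z hz => hmin hz⟩

/-- Adding (α/2)‖· - x‖² changes the convexity modulus from -β to α - β. Comparing y with (1-t)y +
tz, dividing by t and letting t ↓ 0 gives the quadratic growth. -/
theorem prox_strong_min (hwc : PMQS.WeaklyConvexOn X β h) {x y z : PMQS.E n} (hy : y ∈ X)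
    (hmin : ∀ z ∈ X, h y + α / 2 * ‖y - x‖ ^ 2 ≤ h z + α / 2 * ‖z - x‖ ^ 2) (hz : z ∈ X) :
    h y + α / 2 * ‖y - x‖ ^ 2 + (α - β) / 2 * ‖z - y‖ ^ 2 ≤ h z + α / 2 * ‖z - x‖ ^ 2 := by
  refine add_le_of_forall_add_mul_le fun t h0 h1 => ?_
  have hm : (1 - t) • y + t • z ∈ X := hwc.1 hy hz (by linarith) h0.le (by ring)
  have h2 := (weaklyConvexOn_iff.1 hwc).2 y hy z hz t h0.le h1.le
  have h3 := hmin _ hm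
  have h4 : (1 - t) • y + t • z - x = (1 - t) • (y - x) + t • (z - x) := by
    simp only [smul_sub, sub_smul, one_smul]; abel
  rw [h4, norm_convex_comb_sq, sub_sub_sub_cancel_right] at h3
  have h5 : t * (h y + α / 2 * ‖y - x‖ ^ 2 + (1 - t) * ((α - β) / 2 * ‖z - y‖ ^ 2))
      ≤ t * (h z + α / 2 * ‖z - x‖ ^ 2) := by linarith
  exact le_of_mul_le_mul_left h5 h0

/-- Each minimizer is tested in the growth inequality of the other and the two are added. Taking h =
h' gives Lipschitz dependence on the centre; two different Lagrangians give continuity in the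
multiplier. -/
theorem prox_dist_sq_le (hwc : PMQS.WeaklyConvexOn X β h) (hwc' : PMQS.WeaklyConvexOn X β h')
    {x y x' y' : PMQS.E n} (hy : y ∈ X) (hy' : y' ∈ X)
    (hmin : ∀ z ∈ X, h y + α / 2 * ‖y - x‖ ^ 2 ≤ h z + α / 2 * ‖z - x‖ ^ 2)
    (hmin' : ∀ z ∈ X, h' y' + α / 2 * ‖y' - x'‖ ^ 2 ≤ h' z + α / 2 * ‖z - x'‖ ^ 2) :
    (α - β) * ‖y - y'‖ ^ 2 ≤ (h y' - h y) - (h' y' - h' y) + α * inner ℝ (y - y') (x - x') := by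
  have h1 := prox_strong_min hwc hy hmin hy'
  have h2 := prox_strong_min hwc' hy' hmin' hy
  rw [norm_sub_rev y' y] at h1
  have e : ‖y' - x‖ ^ 2 - ‖y - x‖ ^ 2 + ‖y - x'‖ ^ 2 - ‖y' - x'‖ ^ 2
      = 2 * inner ℝ (y - y') (x - x') := by
    simp only [norm_sub_sq_real, inner_sub_left, inner_sub_right]; ring
  have e' := congrArg (fun r => α / 2 * r) e
  linarith

theorem moreauEnv_eq {x y : PMQS.E n} (hy : y ∈ X)
    (hmin : ∀ z ∈ X, h y + α / 2 * ‖y - x‖ ^ 2 ≤ h z + α / 2 * ‖z - x‖ ^ 2) :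
    PMQS.moreauEnv X h α x = h y + α / 2 * ‖y - x‖ ^ 2 := by
  have : Nonempty X := ⟨⟨y, hy⟩⟩
  exact le_antisymm (ciInf_le ⟨_, by rintro _ ⟨z, rfl⟩; exact hmin z z.2⟩ (⟨y, hy⟩ : X))
    (le_ciInf fun z => hmin z z.2)

/-- A sandwich: y competes in the envelope at x', which bounds the increment above, and y' competes
at x, which bounds it below. The bounds differ from the linear term by O(‖x' - x‖²), because the
proximal map is Lipschitz with constant α/(α-β). -/
theorem hasGradientAt_moreauEnv (hX : IsCompact X) (hne : X.Nonempty) (hh : ContinuousOn h X)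
    (hwc : PMQS.WeaklyConvexOn X β h) (hβ : β < α) (hα : 0 < α) (x : PMQS.E n) :
    HasGradientAt (PMQS.moreauEnv X h α) (α • (x - proxPt X h α x)) x := by
  set y := proxPt X h α x with hydef
  obtain ⟨hy, hmin⟩ := proxPt_spec (α := α) hX hne hh x
  rw [← hydef] at hy hmin
  rw [hasGradientAt_iff_isLittleO]
  refine Asymptotics.IsBigO.trans_isLittleO (g := fun x' => ‖x' - x‖ ^ 2) ?_ ?_
  · refine Asymptotics.IsBigO.of_bound (α / 2 + α * (α / (α - β))) (Filter.Eventually.of_forall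
      fun x' => ?_)
    obtain ⟨hy', hmin'⟩ := proxPt_spec (α := α) hX hne hh x'
    set y' := proxPt X h α x' with hydef'
    rw [moreauEnv_eq hy hmin, moreauEnv_eq hy' hmin', Real.norm_eq_abs, norm_pow, norm_norm,
      inner_smul_left, conj_trivial]
    have hc : 0 < α - β := by linarith
    have h1 := hmin' y hy
    have h2 := hmin y' hy'
    have e1 : ‖y - x'‖ ^ 2 = ‖y - x‖ ^ 2 + 2 * inner ℝ (x - y) (x' - x) + ‖x' - x‖ ^ 2 := by
      have : y - x' = -((x - y) + (x' - x)) := by abel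
      rw [this, norm_neg, norm_add_sq_real, norm_sub_rev x y]
    have e2 : ‖y' - x'‖ ^ 2 = ‖y' - x‖ ^ 2 + 2 * inner ℝ (x - y') (x' - x) + ‖x' - x‖ ^ 2 := by
      have : y' - x' = -((x - y') + (x' - x)) := by abel
      rw [this, norm_neg, norm_add_sq_real, norm_sub_rev x y']
    have e3 : inner ℝ (x - y') (x' - x) = inner ℝ (x - y) (x' - x) + inner ℝ (y - y') (x' - x) := by
      rw [← inner_add_left]; congr 1; abel
    have h3 : ‖y - y'‖ ≤ α / (α - β) * ‖x' - x‖ := by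
      have h4 := prox_dist_sq_le hwc hwc hy hy' hmin hmin'
      have h5 : (α - β) * ‖y - y'‖ * ‖y - y'‖ ≤ α * ‖x' - x‖ * ‖y - y'‖ := by
        have := real_inner_le_norm (y - y') (x - x')
        rw [norm_sub_rev x x'] at this
        nlinarith
      rw [div_mul_eq_mul_div, le_div_iff₀ hc]
      rcases (norm_nonneg (y - y')).eq_or_lt with h0 | h0
      · rw [← h0]; simp; positivity
      · have := le_of_mul_le_mul_right h5 h0; linarith
    have h6 : |inner ℝ (y - y') (x' - x)| ≤ α / (α - β) * ‖x' - x‖ ^ 2 := by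
      refine (abs_real_inner_le_norm _ _).trans ?_
      calc _ ≤ α / (α - β) * ‖x' - x‖ * ‖x' - x‖ := by gcongr
        _ = _ := by ring
    have h7 := mul_le_mul_of_nonneg_left (abs_le.1 h6).1 hα.le
    have h8 : 0 ≤ α * (α / (α - β)) * ‖x' - x‖ ^ 2 := by positivity
    have h9 : 0 ≤ α / 2 * ‖x' - x‖ ^ 2 := by positivity
    rw [abs_le]
    constructor
    · rw [e2, e3]; linarith
    · rw [e1] at h1; linarith
  · have : (fun x' => ‖x' - x‖ ^ 2) =o[nhds x] fun x' => ‖x' - x‖ := by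
      have h0 : Filter.Tendsto (fun x' => ‖x' - x‖) (nhds x) (nhds 0) := by
        have : Continuous fun x' : PMQS.E n => ‖x' - x‖ := by fun_prop
        simpa using this.tendsto x
      exact (Asymptotics.isLittleO_pow_id (by norm_num : 1 < 2)).comp_tendsto h0
    exact this.of_norm_right

end Prox

/-! ### Independence of the past, exponential moments under negative drift, and freezing. -/

theorem history_mono {Ω Ξ : Type*} [MeasurableSpace Ξ] {ξ : ℕ → Ω → Ξ} {t k : ℕ} (h : t ≤ k) :
    PMQS.history ξ t ≤ PMQS.history ξ k := by
  refine iSup₂_le fun j hj => le_iSup₂_of_le j ?_ le_rfl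
  rw [Finset.mem_Ico] at hj ⊢
  exact ⟨hj.1, hj.2.trans_le h⟩

theorem indep_history {Ω Ξ : Type*} [MeasurableSpace Ω] [MeasurableSpace Ξ] {μ : Measure Ω}
    {ξ : ℕ → Ω → Ξ} {T : ℕ}
    (hξmeas : ∀ t ∈ Finset.Icc 1 T, Measurable (ξ t))
    (hξ : iIndepFun (fun t : Finset.Icc 1 T => ξ t) μ) {t : ℕ} (ht : t ∈ Finset.Icc 1 T) :
    Indep (PMQS.history ξ t) (MeasurableSpace.comap (ξ t) inferInstance) μ := by
  have h := indep_iSup_of_disjoint (m := fun t : Finset.Icc 1 T =>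
      MeasurableSpace.comap (ξ t) inferInstance)
    (fun i => (hξmeas i i.2).comap_le) hξ (S := {i | (i : ℕ) < t}) (T := {⟨t, ht⟩})
    (by simp)
  refine indep_of_indep_of_le_left (indep_of_indep_of_le_right h ?_) ?_
  · exact le_iSup₂_of_le (⟨t, ht⟩ : Finset.Icc 1 T) rfl le_rfl
  · refine iSup₂_le fun k hk => ?_
    rw [Finset.mem_Ico] at hk
    rw [Finset.mem_Icc] at ht
    exact le_iSup₂_of_le (⟨k, Finset.mem_Icc.2 ⟨hk.1, by omega⟩⟩ : Finset.Icc 1 T) hk.2 le_rfl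

section Prob

variable {Ω Ξ : Type*} [mΩ : MeasurableSpace Ω] [MeasurableSpace Ξ] {μ : Measure Ω}
  [IsProbabilityMeasure μ]

theorem integrable_of_abs_le {f : Ω → ℝ} (hf : Measurable f) {C : ℝ} (h : ∀ ω, |f ω| ≤ C) :
    Integrable f μ :=
  Integrable.of_bound hf.aestronglyMeasurable C (Filter.Eventually.of_forall h)

theorem exp_mul_le_exp_mul_quadratic {a b r D : ℝ} (hr : 0 < r) (hab : |b - a| ≤ D)
    (hrD : r * D ≤ 1) :
    Real.exp (r * b) ≤ Real.exp (r * a) * (1 + r * (b - a) + r ^ 2 * D ^ 2) := by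
  have h1 : |r * (b - a)| ≤ 1 := by
    rw [abs_mul, abs_of_pos hr]
    exact (mul_le_mul_of_nonneg_left hab hr.le).trans hrD
  have h2 := (abs_le.1 (Real.abs_exp_sub_one_sub_id_le h1)).2
  have h3 : (r * (b - a)) ^ 2 ≤ r ^ 2 * D ^ 2 := by
    rw [mul_pow]
    have : (b - a) ^ 2 ≤ D ^ 2 := sq_le_sq' (neg_le_of_abs_le hab) (le_of_abs_le hab)
    gcongr
  have h4 : r * b = r * a + r * (b - a) := by ring
  rw [h4, Real.exp_add]
  exact mul_le_mul_of_nonneg_left (by linarith) (Real.exp_pos _).le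

theorem abs_sub_le_mul_of_increments {Z : ℕ → ℝ} {δ : ℝ} {N t : ℕ}
    (h : ∀ k, t ≤ k → k + 1 ≤ N → |Z (k + 1) - Z k| ≤ δ) (m : ℕ) (hm : t + m ≤ N) :
    |Z (t + m) - Z t| ≤ m * δ := by
  induction m with
  | zero => simp
  | succ m ih =>
    have h1 := ih (by omega)
    have h2 := h (t + m) (by omega) (by omega)
    have h3 := abs_sub_le (Z (t + m + 1)) (Z (t + m)) (Z t)
    rw [← add_assoc]
    push_cast
    linarith

/-- Uniform exponential moment bound for a process with bounded increments whose square has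
negative drift over `m` steps. -/
theorem integral_exp_le_of_drift (ℱ : ℕ → MeasurableSpace Ω) (N m : ℕ) (hm : 1 ≤ m)
    (hℱ : ∀ t, 1 ≤ t → t ≤ N → ℱ t ≤ mΩ) (Z : ℕ → Ω → ℝ)
    (hmeas : ∀ t, 1 ≤ t → t ≤ N → Measurable[ℱ t] (Z t)) (h1 : ∀ ω, Z 1 ω = 0)
    {δ C κ r q : ℝ} (hδ : 0 ≤ δ) (hC : 0 < C) (hκ : 0 < κ) (hr : 0 < r)
    (hinc : ∀ t, 1 ≤ t → t + 1 ≤ N → ∀ ω, |Z (t + 1) ω - Z t ω| ≤ δ)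
    (hdrift : ∀ t, 1 ≤ t → t + m ≤ N → ∀ w : Ω → ℝ, Measurable[ℱ t] w → (∀ ω, 0 ≤ w ω) →
      (∃ B, ∀ ω, w ω ≤ B) →
      ∫ ω, w ω * (Z (t + m) ω ^ 2 - Z t ω ^ 2) ∂μ ≤ ∫ ω, w ω * (C - κ * Z t ω) ∂μ)
    (hrD : r * (m * δ) ≤ 1) (hq : q = r * κ / 4 - r ^ 2 * (m * δ) ^ 2) (hq0 : 0 < q) (hq1 : q ≤ 1)
    (t : ℕ) (ht1 : 1 ≤ t) (htN : t ≤ N) :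
    ∫ ω, Real.exp (r * Z t ω) ∂μ ≤ Real.exp (r * (2 * C / κ + m * δ)) / q := by
  have hbd : ∀ t, 1 ≤ t → t ≤ N → ∀ ω, |Z t ω| ≤ (t - 1 : ℕ) * δ := by
    intro t ht htN ω
    obtain ⟨k, rfl⟩ := Nat.exists_eq_add_of_le ht
    have := abs_sub_le_mul_of_increments (Z := fun t => Z t ω) (N := N) (t := 1)
      (fun k hk hkN => hinc k hk hkN ω) k htN
    simpa [h1] using this
  set D := m * δ with hD
  have hD0 : 0 ≤ D := by positivity
  -- Above this level C - κ Z ≤ -κ Z / 2.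
  set a₀ := 2 * C / κ with ha₀
  have ha₀pos : 0 < a₀ := by positivity
  set Y := Real.exp (r * (a₀ + D)) with hY
  have hYpos : 0 < Y := Real.exp_pos _
  have hintexp : ∀ t, 1 ≤ t → t ≤ N → Integrable (fun ω => Real.exp (r * Z t ω)) μ := by
    intro t ht htN
    have hm : Measurable (Z t) := (hmeas t ht htN).mono (hℱ t ht htN) le_rfl
    refine integrable_of_abs_le (by fun_prop) (C := Real.exp (r * ((t - 1 : ℕ) * δ))) fun ω => ?_
    rw [Real.abs_exp]
    gcongr
    exact le_of_abs_le (hbd t ht htN ω)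
  -- With E_t the exponential moment, the aim is E_{k+m} ≤ (1-q) E_k + Y in the inductive range,
  -- which preserves the bound Y/q. For t ≤ m the increments alone give Z ≤ D.
  induction t using Nat.strong_induction_on with
  | _ t ih =>
  by_cases htm : t ≤ m
  · have hle : ∀ ω, Real.exp (r * Z t ω) ≤ Y / q := by
      intro ω
      have h2 := le_of_abs_le (hbd t ht1 htN ω)
      have h3 : ((t - 1 : ℕ) : ℝ) * δ ≤ D := by
        rw [hD]; gcongr; omega
      have h4 : Real.exp (r * Z t ω) ≤ Y := by
        rw [hY]; gcongr; linarith
      refine h4.trans ?_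
      rw [le_div_iff₀ hq0]
      nlinarith
    have := integral_mono (hintexp t ht1 htN) (integrable_const (Y / q)) hle
    simpa using this
  · obtain ⟨k, rfl⟩ : ∃ k, t = k + m := ⟨t - m, by omega⟩
    have hk1 : 1 ≤ k := by omega
    have hkN : k ≤ N := by omega
    have ihk := ih k (by omega) hk1 hkN
    have hZk : Measurable (Z k) := (hmeas k hk1 hkN).mono (hℱ k hk1 hkN) le_rfl
    have hZt : Measurable (Z (k + m)) := (hmeas _ ht1 htN).mono (hℱ _ ht1 htN) le_rfl
    set s : Set Ω := {ω | a₀ ≤ Z k ω} with hs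
    have hsF : MeasurableSet[ℱ k] s := (hmeas k hk1 hkN) measurableSet_Ici
    have hsm : MeasurableSet s := hℱ k hk1 hkN _ hsF
    set u : Ω → ℝ := s.indicator fun ω => Real.exp (r * Z k ω) with hu
    -- For a > 0 one has b - a ≤ (b² - a²)/(2a), so this weight turns the drift of Z² into a drift
    -- of exp(rZ). Testing with weights measurable at time k plays the role of conditional
    -- expectation; the cutoff at a₀ keeps w bounded.
    set w : Ω → ℝ := s.indicator fun ω => r * Real.exp (r * Z k ω) / (2 * Z k ω) with hw
    have hwF : Measurable[ℱ k] w := by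
      refine Measurable.indicator ?_ hsF
      have := hmeas k hk1 hkN
      fun_prop
    have hwm : Measurable w := hwF.mono (hℱ k hk1 hkN) le_rfl
    have hw0 : ∀ ω, 0 ≤ w ω := fun ω => Set.indicator_nonneg (fun ω hω => by
      have : 0 < Z k ω := ha₀pos.trans_le hω
      positivity) ω
    set B := r * Real.exp (r * ((k - 1 : ℕ) * δ)) / (2 * a₀) with hB
    have hwB : ∀ ω, w ω ≤ B := by
      intro ω
      by_cases hω : ω ∈ s
      · have h2 := le_of_abs_le (hbd k hk1 hkN ω)
        have h3 : a₀ ≤ Z k ω := hω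
        simp only [hw, hB, Set.indicator_of_mem hω]
        gcongr
      · simp only [hw, Set.indicator_of_notMem hω]
        positivity
    have hdr := hdrift k hk1 htN w hwF hw0 ⟨B, hwB⟩
    have hu_int : Integrable u μ := (hintexp k hk1 hkN).indicator hsm
    have hwint : Integrable w μ := integrable_of_abs_le hwm fun ω => by
      rw [abs_of_nonneg (hw0 ω)]; exact hwB ω
    have hbdd_mul : ∀ g : Ω → ℝ, Measurable g → (∃ c, ∀ ω, |g ω| ≤ c) →
        Integrable (fun ω => w ω * g ω) μ := fun g hg ⟨c, hc⟩ =>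
      hwint.mul_bdd (c := c) hg.aestronglyMeasurable (Filter.Eventually.of_forall hc)
    have hi1 : Integrable (fun ω => w ω * (Z (k + m) ω ^ 2 - Z k ω ^ 2)) μ := by
      refine hbdd_mul _ (by fun_prop) ⟨((k + m - 1 : ℕ) * δ) ^ 2 + ((k - 1 : ℕ) * δ) ^ 2,
        fun ω => (abs_sub _ _).trans ?_⟩
      rw [abs_pow, abs_pow]
      have := hbd _ ht1 htN ω
      have := hbd k hk1 hkN ω
      gcongr
    have hi2 : Integrable (fun ω => w ω * (C - κ * Z k ω)) μ := by
      refine hbdd_mul _ (by fun_prop) ⟨C + κ * ((k - 1 : ℕ) * δ), fun ω => (abs_sub _ _).trans ?_⟩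
      rw [abs_mul, abs_of_pos hC, abs_of_pos hκ]
      have := hbd k hk1 hkN ω
      gcongr
    have hpath : ∀ ω, Real.exp (r * Z (k + m) ω) ≤ Y + (1 + r ^ 2 * D ^ 2) * u ω
        + w ω * (Z (k + m) ω ^ 2 - Z k ω ^ 2) := by
      intro ω
      have hab : |Z (k + m) ω - Z k ω| ≤ D :=
        abs_sub_le_mul_of_increments (Z := fun t => Z t ω) (N := N)
          (fun j hj hjN => hinc j (hk1.trans hj) hjN ω) m htN
      by_cases hω : ω ∈ s
      · have hpos : 0 < Z k ω := ha₀pos.trans_le hω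
        simp only [hu, hw, Set.indicator_of_mem hω]
        have h2 := exp_mul_le_exp_mul_quadratic hr hab hrD
        set a := Z k ω
        set b := Z (k + m) ω
        have h3 : r * Real.exp (r * a) * (b - a)
            ≤ r * Real.exp (r * a) / (2 * a) * (b ^ 2 - a ^ 2) := by
          rw [div_mul_eq_mul_div, le_div_iff₀ (by positivity)]
          have : 0 ≤ r * Real.exp (r * a) * (b - a) ^ 2 := by positivity
          nlinarith
        nlinarith
      · simp only [hu, hw, Set.indicator_of_notMem hω, mul_zero, zero_mul, add_zero]
        have h2 : Z k ω < a₀ := not_le.1 hω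
        have h3 := le_of_abs_le hab
        rw [hY]; gcongr; linarith
    have hpath2 : ∀ ω, w ω * (C - κ * Z k ω) ≤ -(r * κ / 4) * u ω := by
      intro ω
      by_cases hω : ω ∈ s
      · have hpos : 0 < Z k ω := ha₀pos.trans_le hω
        simp only [hu, hw, Set.indicator_of_mem hω]
        set a := Z k ω
        have h3 : a₀ ≤ a := hω
        have h4 : C ≤ κ * a / 2 := by
          rw [ha₀, div_le_iff₀ hκ] at h3; linarith
        have h5 : r * Real.exp (r * a) / (2 * a) * (C - κ * a)
            ≤ r * Real.exp (r * a) / (2 * a) * (-(κ * a / 2)) := by gcongr; linarith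
        refine h5.trans_eq ?_
        field_simp; ring
      · simp [hu, hw, Set.indicator_of_notMem hω]
    have hYu : Integrable (fun ω => Y + (1 + r ^ 2 * D ^ 2) * u ω) μ :=
      (integrable_const Y).add (hu_int.const_mul (1 + r ^ 2 * D ^ 2))
    have hI1 := integral_mono (hintexp _ ht1 htN) (hYu.add hi1) hpath
    simp only [Pi.add_apply] at hI1
    rw [integral_add hYu hi1,
      integral_add (integrable_const Y) (hu_int.const_mul _), integral_const_mul] at hI1
    have hI2 := integral_mono hi2 (hu_int.const_mul _) hpath2
    rw [integral_const_mul] at hI2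
    have hI3 : ∫ ω, u ω ∂μ ≤ ∫ ω, Real.exp (r * Z k ω) ∂μ :=
      integral_mono hu_int (hintexp k hk1 hkN)
        (Set.indicator_le_self' fun ω _ => (Real.exp_pos _).le)
    simp only [integral_const, probReal_univ, one_smul] at hI1
    -- The total coefficient of ∫ u is 1 + r²D² - rκ/4 = 1 - q.
    have hfin : (1 - q) * ∫ ω, u ω ∂μ ≤ (1 - q) * (Y / q) :=
      mul_le_mul_of_nonneg_left (hI3.trans ihk) (by linarith)
    have e : (1 - q) * (Y / q) = Y / q - Y := by field_simp
    rw [e, hq] at hfin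
    rw [hq]
    linarith

/-- Second moment bound from an exponential moment. -/
theorem integral_sq_le_of_integral_exp_le {Z : Ω → ℝ} (hZ : Measurable Z) {M r z₀ : ℝ}
    (hZ0 : ∀ ω, 0 ≤ Z ω) (hZM : ∀ ω, Z ω ≤ M) (hr : 0 < r) (hz₀ : 0 ≤ z₀)
    (h : ∫ ω, Real.exp (r * Z ω) ∂μ ≤ Real.exp (r * z₀)) :
    ∫ ω, Z ω ^ 2 ∂μ ≤ (z₀ + 1 / r) ^ 2 := by
  have hexp : Integrable (fun ω => Real.exp (r * Z ω)) μ :=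
    integrable_of_abs_le (by fun_prop) (C := Real.exp (r * M)) fun ω => by
      rw [Real.abs_exp]; gcongr; exact hZM ω
  have hsq : Integrable (fun ω => Z ω ^ 2) μ :=
    integrable_of_abs_le (by fun_prop) (C := M ^ 2) fun ω => by
      rw [abs_pow, abs_of_nonneg (hZ0 ω)]
      have := hZ0 ω
      have := hZM ω
      gcongr
  -- Beyond z₀ write Z = z₀ + y/r. Both y and y² are at most exp y, so the coefficients are exactly
  -- those of the expansion of (z₀ + 1/r)².
  have hpath : ∀ ω, Z ω ^ 2 ≤ z₀ ^ 2
      + (2 * z₀ / r + 1 / r ^ 2) * (Real.exp (-(r * z₀)) * Real.exp (r * Z ω)) := by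
    intro ω
    rw [← Real.exp_add]
    rcases le_total (Z ω) z₀ with hle | hle
    · have h1 : Z ω ^ 2 ≤ z₀ ^ 2 := by
        have := hZ0 ω
        gcongr
      have : 0 ≤ (2 * z₀ / r + 1 / r ^ 2) * Real.exp (-(r * z₀) + r * Z ω) := by positivity
      linarith
    · set y := r * (Z ω - z₀) with hy
      have hy0 : 0 ≤ y := mul_nonneg hr.le (by linarith)
      have hZy : Z ω = z₀ + y / r := by rw [hy]; field_simp; ring
      have e : -(r * z₀) + r * Z ω = y := by rw [hy]; ring
      rw [e]
      have h1 : y ≤ Real.exp y := by linarith [Real.add_one_le_exp y]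
      have h2 : y ^ 2 ≤ Real.exp y := by
        have h3 := Real.quadratic_le_exp_of_nonneg (x := y / 2) (by linarith)
        have h4 : y ≤ Real.exp (y / 2) := by nlinarith [sq_nonneg (y - 4)]
        calc y ^ 2 ≤ Real.exp (y / 2) ^ 2 := by gcongr
          _ = Real.exp y := by rw [← Real.exp_nat_mul]; congr 1; push_cast; ring
      have h5 : 2 * z₀ / r * y ≤ 2 * z₀ / r * Real.exp y := by gcongr
      have h6 : 1 / r ^ 2 * y ^ 2 ≤ 1 / r ^ 2 * Real.exp y := by gcongr
      calc Z ω ^ 2 = z₀ ^ 2 + (2 * z₀ / r * y + 1 / r ^ 2 * y ^ 2) := by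
            rw [hZy]; field_simp; ring
        _ ≤ _ := by linarith
  have hI := integral_mono hsq ((integrable_const (z₀ ^ 2)).add
    ((hexp.const_mul (Real.exp (-(r * z₀)))).const_mul (2 * z₀ / r + 1 / r ^ 2))) hpath
  simp only [Pi.add_apply] at hI
  rw [integral_add (integrable_const _) ((hexp.const_mul _).const_mul _), integral_const_mul,
    integral_const_mul] at hI
  simp only [integral_const, probReal_univ, one_smul] at hI
  have h7 : Real.exp (-(r * z₀)) * ∫ ω, Real.exp (r * Z ω) ∂μ ≤ 1 := by
    calc _ ≤ Real.exp (-(r * z₀)) * Real.exp (r * z₀) := by gcongr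
      _ = 1 := by rw [← Real.exp_add]; simp
  have h8 := mul_le_mul_of_nonneg_left h7 (show 0 ≤ 2 * z₀ / r + 1 / r ^ 2 by positivity)
  calc _ ≤ z₀ ^ 2 + (2 * z₀ / r + 1 / r ^ 2) * 1 := by linarith
    _ = _ := by field_simp; ring

theorem integral_le_of_integral_sq_le {Z : Ω → ℝ} (hZ : Integrable Z μ)
    (hZ2 : Integrable (fun ω => Z ω ^ 2) μ) {c : ℝ} (hc : 0 < c)
    (h : ∫ ω, Z ω ^ 2 ∂μ ≤ c ^ 2) : ∫ ω, Z ω ∂μ ≤ c := by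
  have := integral_mono (hZ.const_mul (2 * c)) (hZ2.add (integrable_const (c ^ 2)))
    fun ω => by
      show 2 * c * Z ω ≤ Z ω ^ 2 + c ^ 2
      nlinarith [sq_nonneg (Z ω - c)]
  simp only [Pi.add_apply] at this
  rw [integral_const_mul, integral_add hZ2 (integrable_const _)] at this
  simp only [integral_const, probReal_univ, one_smul] at this
  nlinarith

theorem history_le {ξ : ℕ → Ω → Ξ} {T : ℕ} (hξmeas : ∀ t ∈ Finset.Icc 1 T, Measurable (ξ t))
    {t : ℕ} (ht : t ≤ T + 1) : PMQS.history ξ t ≤ mΩ := by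
  refine iSup₂_le fun k hk => (hξmeas k ?_).comap_le
  rw [Finset.mem_Ico] at hk
  exact Finset.mem_Icc.2 ⟨hk.1, by omega⟩

/-- The freezing lemma: by independence the joint law is a product, and Fubini applies. Boundedness
of K is needed only along the pair (V, ζ). -/
theorem integral_comp_of_indepFun {S : Type*} [MeasurableSpace S] {P : Measure Ξ}
    [IsProbabilityMeasure P] {V : Ω → S} {ζ : Ω → Ξ} (hV : Measurable V) (hζ : Measurable ζ)
    (hind : IndepFun V ζ μ) (hlaw : μ.map ζ = P) {K : S × Ξ → ℝ} (hK : Measurable K) {C : ℝ}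
    (hKC : ∀ ω, |K (V ω, ζ ω)| ≤ C) :
    ∫ ω, K (V ω, ζ ω) ∂μ = ∫ ω, ∫ z, K (V ω, z) ∂P ∂μ := by
  have hmap := (indepFun_iff_map_prod_eq_prod_map_map hV.aemeasurable hζ.aemeasurable).1 hind
  rw [hlaw] at hmap
  have : IsProbabilityMeasure (μ.map V) := Measure.isProbabilityMeasure_map hV.aemeasurable
  have hint : Integrable K ((μ.map V).prod P) := by
    rw [← hmap, integrable_map_measure hK.aestronglyMeasurable (hV.prodMk hζ).aemeasurable]
    exact integrable_of_abs_le (hK.comp (hV.prodMk hζ)) hKC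
  rw [← integral_map (f := K) (hV.prodMk hζ).aemeasurable hK.aestronglyMeasurable, hmap,
    integral_prod _ hint, integral_map hV.aemeasurable
      (hK.stronglyMeasurable.integral_prod_right').aestronglyMeasurable]

end Prob

/-! ### Matrices as quadratic forms, and the standing assumptions. -/

theorem inner_toEuclideanCLM_comm {n : ℕ} {M : Matrix (Fin n) (Fin n) ℝ} (hM : M.IsSymm)
    (u v : PMQS.E n) : inner ℝ (Matrix.toEuclideanCLM (𝕜 := ℝ) M u) v
      = inner ℝ (Matrix.toEuclideanCLM (𝕜 := ℝ) M v) u := by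
  have h : star M = M := by
    rw [Matrix.star_eq_conjTranspose, Matrix.conjTranspose_eq_transpose_of_trivial]; exact hM
  have h2 := ContinuousLinearMap.adjoint_inner_left (Matrix.toEuclideanCLM (𝕜 := ℝ) M) v u
  rw [← ContinuousLinearMap.star_eq_adjoint, ← map_star, h] at h2
  rw [h2, real_inner_comm]

theorem inner_toEuclideanCLM_nonneg {n : ℕ} {M : Matrix (Fin n) (Fin n) ℝ} (hM : M.PosSemidef)
    (u : PMQS.E n) : 0 ≤ inner ℝ (Matrix.toEuclideanCLM (𝕜 := ℝ) M u) u := by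
  have := hM.dotProduct_mulVec_nonneg u.ofLp
  rw [EuclideanSpace.inner_eq_star_dotProduct, Matrix.ofLp_toEuclideanCLM]
  simpa using this

theorem inner_toEuclideanCLM_le {n : ℕ} {M : Matrix (Fin n) (Fin n) ℝ} {ℓ : ℝ}
    (hM : (-(ℓ • (1 : Matrix (Fin n) (Fin n) ℝ)) - M).PosSemidef)
    (u : PMQS.E n) : inner ℝ (Matrix.toEuclideanCLM (𝕜 := ℝ) M u) u ≤ -ℓ * ‖u‖ ^ 2 := by
  have := inner_toEuclideanCLM_nonneg hM u
  rw [map_sub, map_neg, map_smul, map_one] at this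
  simp only [_root_.sub_apply, _root_.neg_apply,
    _root_.smul_apply, one_apply_eq_self, inner_sub_left, inner_neg_left,
    inner_smul_left, conj_trivial, real_inner_self_eq_norm_sq] at this
  linarith

theorem quadForm_Sigma0 {n p : ℕ} (τ : ℝ) (lam : PMQS.E p)
    (S : Fin p → Matrix (Fin n) (Fin n) ℝ) (u : PMQS.E n) :
    PMQS.quadForm (PMQS.Sigma0 τ lam S) u
      = -(∑ i, lam i * inner ℝ (Matrix.toEuclideanCLM (𝕜 := ℝ) (S i) u) u) + τ * ‖u‖ ^ 2 := by
  rw [PMQS.quadForm, PMQS.Sigma0, map_add, map_neg, map_smul, map_one, map_sum]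
  simp only [map_smul, _root_.add_apply, _root_.neg_apply,
    _root_.sum_apply, _root_.smul_apply, one_apply_eq_self,
    inner_add_left, inner_neg_left, sum_inner, inner_smul_left, conj_trivial,
    real_inner_self_eq_norm_sq]

/-- The standing assumptions on the problem, the samples, the parameters and the run. -/
structure Assumptions {n p : ℕ} {Ω Ξ : Type*} [MeasurableSpace Ω] [MeasurableSpace Ξ]
    (μ : Measure Ω) (P : Measure Ξ) (X₀ O₀ : Set (PMQS.E n)) (F : PMQS.E n → Ξ → ℝ)
    (G : Fin p → PMQS.E n → Ξ → ℝ) (D₀ νg κf κg ε₀ L₀ : ℝ) (L : Fin p → ℝ) (T : ℕ)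
    (σ α τ : ℝ) (ξ : ℕ → Ω → Ξ) (x₁ : PMQS.E n)
    (S : ℕ → Fin p → Ω → Matrix (Fin n) (Fin n) ℝ) (x : ℕ → Ω → PMQS.E n)
    (lam : ℕ → Ω → PMQS.E p) (κS γ₁ γ₂ : ℝ) : Prop where
  p_pos : 1 ≤ p
  closed : IsClosed X₀
  convex : Convex ℝ X₀
  isOpen : IsOpen O₀
  convexO : Convex ℝ O₀
  sub : X₀ ⊆ O₀
  Fmeas : ∀ x ∈ O₀, Measurable (F x)
  Gmeas : ∀ i, ∀ x ∈ O₀, Measurable (G i x)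
  Fint : ∀ x ∈ O₀, Integrable (F x) P
  Fdiff : ∀ z, DifferentiableOn ℝ (fun x => F x z) O₀
  Gdiff : ∀ i z, DifferentiableOn ℝ (fun x => G i x z) O₀
  D₀_pos : 0 < D₀
  νg_pos : 0 < νg
  κf_pos : 0 < κf
  κg_pos : 0 < κg
  diam : ∀ x ∈ X₀, ∀ z ∈ X₀, ‖x - z‖ ≤ D₀
  Gbdd : ∀ x ∈ O₀, ∀ z, ‖(WithLp.toLp 2 (fun i => G i x z) : PMQS.E p)‖ ≤ νg
  Fgrad : ∀ x ∈ O₀, ∀ z, ‖gradient (fun y => F y z) x‖ ≤ κf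
  Ggrad : ∀ i, ∀ x ∈ O₀, ∀ z, ‖gradient (fun y => G i y z) x‖ ≤ κg
  ε₀_pos : 0 < ε₀
  slater : ∃ xhat ∈ X₀, ∀ i, PMQS.expVal P (G i) xhat ≤ -ε₀
  L₀_pos : 0 < L₀
  L_pos : ∀ i, 0 < L i
  Fwc : ∀ z, PMQS.WeaklyConvexOn O₀ L₀ (fun x => F x z)
  Gwc : ∀ i z, PMQS.WeaklyConvexOn O₀ (L i) (fun x => G i x z)
  T_pos : 1 ≤ T
  σ_pos : 0 < σ
  α_pos : 0 < α
  τ_pos : 0 < τ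
  ξmeas : ∀ t ∈ Finset.Icc 1 T, Measurable (ξ t)
  ξindep : iIndepFun (fun t : Finset.Icc 1 T => ξ t) μ
  ξlaw : ∀ t ∈ Finset.Icc 1 T, μ.map (ξ t) = P
  x₁_mem : x₁ ∈ X₀
  run : PMQS.IsRun X₀ F G σ α τ T x₁ ξ S x lam
  κS_pos : 0 < κS
  S_le : ∀ t ∈ Finset.Icc 1 T, ∀ i ω,
    (-(L i • (1 : Matrix (Fin n) (Fin n) ℝ)) - S t i ω).PosSemidef
  S_norm : ∀ t ∈ Finset.Icc 1 T, ∀ i ω, ‖Matrix.toEuclideanCLM (𝕜 := ℝ) (S t i ω)‖ ≤ κS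
  κSε : Real.sqrt p * κS * D₀ ^ 2 ≤ ε₀
  γ₁_eq : γ₁ = PMQS.gamma1 p νg κg κS D₀
  γ₂_eq : γ₂ = PMQS.gamma2 νg κg κS D₀
  αβ : ∀ k ∈ Finset.Icc 1 T, 2 * PMQS.betaK L₀ L γ₂ k σ < α

/-! ### Pathwise consequences for the iterates. -/

namespace Assumptions

variable {n p : ℕ} {Ω Ξ : Type*} [MeasurableSpace Ω] [MeasurableSpace Ξ]
    {μ : Measure Ω} {P : Measure Ξ} {X₀ O₀ : Set (PMQS.E n)} {F : PMQS.E n → Ξ → ℝ}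
    {G : Fin p → PMQS.E n → Ξ → ℝ} {D₀ νg κf κg ε₀ L₀ : ℝ} {L : Fin p → ℝ} {T : ℕ}
    {σ α τ : ℝ} {ξ : ℕ → Ω → Ξ} {x₁ : PMQS.E n}
    {S : ℕ → Fin p → Ω → Matrix (Fin n) (Fin n) ℝ} {x : ℕ → Ω → PMQS.E n}
    {lam : ℕ → Ω → PMQS.E p} {κS γ₁ γ₂ : ℝ}

theorem mem_Icc_add_one {T t : ℕ} (ht : t ∈ Finset.Icc 1 T) : t ∈ Finset.Icc 1 (T + 1) := by
  rw [Finset.mem_Icc] at ht ⊢; omega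

theorem add_one_mem_Icc {T t : ℕ} (ht : t ∈ Finset.Icc 1 T) : t + 1 ∈ Finset.Icc 1 (T + 1) := by
  rw [Finset.mem_Icc] at ht ⊢; omega

section Deterministic

variable (h : Assumptions μ P X₀ O₀ F G D₀ νg κf κg ε₀ L₀ L T σ α τ ξ x₁ S x lam κS γ₁ γ₂)
include h

theorem x_mem {t : ℕ} (ht : t ∈ Finset.Icc 1 (T + 1)) (ω : Ω) : x t ω ∈ X₀ := by
  rw [Finset.mem_Icc] at ht
  obtain rfl | h1 := ht.1.eq_or_lt
  · rw [h.run.x_one]; exact h.x₁_mem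
  · obtain ⟨k, rfl⟩ : ∃ k, t = k + 1 := ⟨t - 1, by omega⟩
    exact h.run.x_mem k (Finset.mem_Icc.2 ⟨by omega, by omega⟩) ω

theorem lam_nonneg {t : ℕ} (ht : t ∈ Finset.Icc 1 (T + 1)) (ω : Ω) (i : Fin p) :
    0 ≤ lam t ω i := by
  rw [Finset.mem_Icc] at ht
  obtain rfl | h1 := ht.1.eq_or_lt
  · rw [h.run.lam_one]; simp
  · obtain ⟨k, rfl⟩ : ∃ k, t = k + 1 := ⟨t - 1, by omega⟩
    rw [h.run.lam_step k (Finset.mem_Icc.2 ⟨by omega, by omega⟩) ω i]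
    exact le_max_right _ _

theorem abs_G_le {y : PMQS.E n} (hy : y ∈ O₀) (i : Fin p) (z : Ξ) : |G i y z| ≤ νg :=
  (abs_apply_le_norm (WithLp.toLp 2 (fun i => G i y z)) i).trans (h.Gbdd y hy z)

theorem F_lip {y y' : PMQS.E n} (hy : y ∈ O₀) (hy' : y' ∈ O₀) (z : Ξ) :
    |F y' z - F y z| ≤ κf * ‖y' - y‖ :=
  abs_sub_le_of_gradient_le h.isOpen h.convexO (h.Fdiff z) (fun x hx => h.Fgrad x hx z) hy hy'

theorem G_lip (i : Fin p) {y y' : PMQS.E n} (hy : y ∈ O₀) (hy' : y' ∈ O₀) (z : Ξ) :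
    |G i y' z - G i y z| ≤ κg * ‖y' - y‖ :=
  abs_sub_le_of_gradient_le h.isOpen h.convexO (h.Gdiff i z) (fun x hx => h.Ggrad i x hx z) hy hy'

theorem γ₂_pos : 0 < γ₂ := by
  have := h.νg_pos; have := h.κg_pos; have := h.κS_pos; have := h.D₀_pos
  rw [h.γ₂_eq, PMQS.gamma2]; positivity

theorem νg_le_γ₁ : νg ≤ γ₁ := by
  have := h.κg_pos; have := h.κS_pos; have := h.D₀_pos
  rw [h.γ₁_eq, PMQS.gamma1]
  have : 0 ≤ Real.sqrt p * (κg * D₀ + 1 / 2 * κS * D₀ ^ 2) := by positivity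
  linarith

theorem γ₁_pos : 0 < γ₁ := h.νg_pos.trans_le h.νg_le_γ₁

theorem abs_quadModel_sub_le {t : ℕ} (ht : t ∈ Finset.Icc 1 T) (ω : Ω) (i : Fin p)
    {y : PMQS.E n} (hy : y ∈ X₀) :
    |PMQS.quadModel (fun z => G i z (ξ t ω)) (S t i ω) (x t ω) y - G i (x t ω) (ξ t ω)|
      ≤ (κg + κS * D₀ / 2) * ‖y - x t ω‖ := by
  have hx := h.x_mem (mem_Icc_add_one ht) ω
  have := abs_inner_add_quad_le (h.S_norm t ht i ω) (h.Ggrad i _ (h.sub hx) (ξ t ω))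
    (h.diam y hy _ hx)
  rw [PMQS.quadModel, PMQS.quadForm]
  convert this using 2; ring

theorem abs_quadModel_le {t : ℕ} (ht : t ∈ Finset.Icc 1 T) (ω : Ω) (i : Fin p)
    {y : PMQS.E n} (hy : y ∈ X₀) :
    |PMQS.quadModel (fun z => G i z (ξ t ω)) (S t i ω) (x t ω) y| ≤ γ₂ := by
  have hx := h.x_mem (mem_Icc_add_one ht) ω
  have h1 := h.abs_quadModel_sub_le ht ω i hy
  have h2 := h.abs_G_le (h.sub hx) i (ξ t ω)
  have h3 := h.diam y hy _ hx
  have h4 : (κg + κS * D₀ / 2) * ‖y - x t ω‖ ≤ (κg + κS * D₀ / 2) * D₀ := by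
    have := h.κg_pos; have := h.κS_pos; have := h.D₀_pos
    gcongr
  have h5 := abs_sub_abs_le_abs_sub
    (PMQS.quadModel (fun z => G i z (ξ t ω)) (S t i ω) (x t ω) y) (G i (x t ω) (ξ t ω))
  rw [h.γ₂_eq, PMQS.gamma2]
  linarith

theorem norm_quadModel_le {t : ℕ} (ht : t ∈ Finset.Icc 1 T) (ω : Ω)
    {y : PMQS.E n} (hy : y ∈ X₀) :
    ‖(WithLp.toLp 2 (fun i => PMQS.quadModel (fun z => G i z (ξ t ω)) (S t i ω) (x t ω) y) :
      PMQS.E p)‖ ≤ γ₁ := by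
  have hx := h.x_mem (mem_Icc_add_one ht) ω
  have hC : 0 ≤ (κg + κS * D₀ / 2) * D₀ := by
    have := h.κg_pos; have := h.κS_pos; have := h.D₀_pos
    positivity
  set a : PMQS.E p := WithLp.toLp 2 (fun i => G i (x t ω) (ξ t ω))
  set b : PMQS.E p :=
    WithLp.toLp 2 (fun i => PMQS.quadModel (fun z => G i z (ξ t ω)) (S t i ω) (x t ω) y)
  have h1 : ‖b - a‖ ≤ Real.sqrt p * ((κg + κS * D₀ / 2) * D₀) := by
    refine norm_le_sqrt_mul _ hC fun i => (h.abs_quadModel_sub_le ht ω i hy).trans ?_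
    have := h.κg_pos; have := h.κS_pos; have := h.D₀_pos
    have := h.diam y hy _ hx
    gcongr
  have h2 : ‖a‖ ≤ νg := h.Gbdd _ (h.sub hx) (ξ t ω)
  have h3 := norm_le_norm_add_norm_sub a b
  rw [norm_sub_rev] at h3
  have h4 : γ₁ = νg + Real.sqrt p * ((κg + κS * D₀ / 2) * D₀) := by
    rw [h.γ₁_eq, PMQS.gamma1]; ring
  linarith

theorem abs_lam_sub_le {t : ℕ} (ht : t ∈ Finset.Icc 1 T) (ω : Ω) (i : Fin p) :
    |lam (t + 1) ω i - lam t ω i| ≤ σ * |PMQS.quadModel (fun z => G i z (ξ t ω)) (S t i ω)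
      (x t ω) (x (t + 1) ω)| := by
  rw [h.run.lam_step t ht ω i]
  refine (abs_max_add_zero_sub_le (h.lam_nonneg (mem_Icc_add_one ht) ω i)).trans_eq ?_
  rw [abs_mul, abs_of_pos h.σ_pos]

theorem abs_lam_sub_le_γ₂ {t : ℕ} (ht : t ∈ Finset.Icc 1 T) (ω : Ω) (i : Fin p) :
    |lam (t + 1) ω i - lam t ω i| ≤ σ * γ₂ :=
  (h.abs_lam_sub_le ht ω i).trans (mul_le_mul_of_nonneg_left
    (h.abs_quadModel_le ht ω i (h.run.x_mem t ht ω)) h.σ_pos.le)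

theorem norm_lam_sub_le {t : ℕ} (ht : t ∈ Finset.Icc 1 T) (ω : Ω) :
    ‖lam (t + 1) ω - lam t ω‖ ≤ σ * γ₁ := by
  calc _ ≤ ‖σ • (WithLp.toLp 2 (fun i => PMQS.quadModel (fun z => G i z (ξ t ω)) (S t i ω)
        (x t ω) (x (t + 1) ω)) : PMQS.E p)‖ := norm_le_of_abs_le _ _ fun i => by
        simpa [abs_mul, abs_of_pos h.σ_pos] using h.abs_lam_sub_le ht ω i
    _ ≤ _ := by
        rw [norm_smul, Real.norm_eq_abs, abs_of_pos h.σ_pos]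
        exact mul_le_mul_of_nonneg_left (h.norm_quadModel_le ht ω (h.run.x_mem t ht ω)) h.σ_pos.le

theorem abs_norm_lam_sub_le {t : ℕ} (ht : t ∈ Finset.Icc 1 T) (ω : Ω) :
    |‖lam (t + 1) ω‖ - ‖lam t ω‖| ≤ σ * γ₁ :=
  (abs_norm_sub_norm_le _ _).trans (h.norm_lam_sub_le ht ω)

theorem lam_le {t : ℕ} (ht : t ∈ Finset.Icc 1 (T + 1)) (ω : Ω) (i : Fin p) :
    lam t ω i ≤ (t - 1 : ℕ) * (σ * γ₂) := by
  rw [Finset.mem_Icc] at ht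
  obtain ⟨k, rfl⟩ := Nat.exists_eq_add_of_le ht.1
  have := abs_sub_le_mul_of_increments (Z := fun t => lam t ω i) (N := T + 1) (t := 1)
    (fun k hk hkN => h.abs_lam_sub_le_γ₂ (Finset.mem_Icc.2 ⟨hk, by omega⟩) ω i) k ht.2
  rw [h.run.lam_one] at this
  simpa using (le_abs_self _).trans this

theorem norm_lam_le {t : ℕ} (ht : t ∈ Finset.Icc 1 (T + 1)) (ω : Ω) :
    ‖lam t ω‖ ≤ T * (σ * γ₁) := by
  rw [Finset.mem_Icc] at ht
  obtain ⟨k, rfl⟩ := Nat.exists_eq_add_of_le ht.1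
  have := abs_sub_le_mul_of_increments (Z := fun t => ‖lam t ω‖) (N := T + 1) (t := 1)
    (fun k hk hkN => h.abs_norm_lam_sub_le (Finset.mem_Icc.2 ⟨hk, by omega⟩) ω) k ht.2
  rw [h.run.lam_one, norm_zero, sub_zero] at this
  refine ((le_abs_self _).trans this).trans ?_
  have := h.σ_pos; have := h.γ₁_pos
  gcongr
  omega

/-- Starting from 0, each multiplier component grows by at most σγ₂ per round. This is the origin of
β_t: the bound on α then makes every proximal problem strongly convex, whatever the realization. -/
theorem lagrangian_modulus_le {t : ℕ} (ht : t ∈ Finset.Icc 1 T) (ω : Ω) :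
    L₀ + ∑ i, L i * lam t ω i ≤ PMQS.betaK L₀ L γ₂ t σ := by
  rw [PMQS.betaK, Finset.sum_mul, Finset.sum_mul]
  refine add_le_add le_rfl (Finset.sum_le_sum fun i _ => ?_)
  have h1 := h.lam_le (mem_Icc_add_one ht) ω i
  have h2 : ((t - 1 : ℕ) : ℝ) * (σ * γ₂) ≤ t * (σ * γ₂) := by
    have := h.σ_pos; have := h.γ₂_pos
    gcongr; omega
  nlinarith [mul_le_mul_of_nonneg_left (h1.trans h2) (h.L_pos i).le]

theorem clm_symm {t : ℕ} (ht : t ∈ Finset.Icc 1 T) (ω : Ω) (i : Fin p) (u v : PMQS.E n) :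
    inner ℝ (Matrix.toEuclideanCLM (𝕜 := ℝ) (S t i ω) u) v
      = inner ℝ (Matrix.toEuclideanCLM (𝕜 := ℝ) (S t i ω) v) u :=
  inner_toEuclideanCLM_comm (h.run.S_symm t ht i ω) u v

theorem clm_le {t : ℕ} (ht : t ∈ Finset.Icc 1 T) (ω : Ω) (i : Fin p) (u : PMQS.E n) :
    inner ℝ (Matrix.toEuclideanCLM (𝕜 := ℝ) (S t i ω) u) u ≤ -L i * ‖u‖ ^ 2 :=
  inner_toEuclideanCLM_le (h.S_le t ht i ω) u

theorem clm_nonpos {t : ℕ} (ht : t ∈ Finset.Icc 1 T) (ω : Ω) (i : Fin p) (u : PMQS.E n) :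
    inner ℝ (Matrix.toEuclideanCLM (𝕜 := ℝ) (S t i ω) u) u ≤ 0 :=
  (h.clm_le ht ω i u).trans (by nlinarith [mul_nonneg (h.L_pos i).le (sq_nonneg ‖u‖)])

theorem argmin {t : ℕ} (ht : t ∈ Finset.Icc 1 T) (ω : Ω) {z : PMQS.E n} (hz : z ∈ X₀) :
    F (x t ω) (ξ t ω)
      + inner ℝ (gradient (fun z => F z (ξ t ω)) (x t ω)) (x (t + 1) ω - x t ω)
      + 1 / 2 * (-(∑ i, lam t ω i * inner ℝ (Matrix.toEuclideanCLM (𝕜 := ℝ) (S t i ω)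
          (x (t + 1) ω - x t ω)) (x (t + 1) ω - x t ω)) + τ * ‖x (t + 1) ω - x t ω‖ ^ 2)
      + 1 / (2 * σ) * ((∑ i, (max (lam t ω i + σ * PMQS.quadModel (fun z => G i z (ξ t ω))
          (S t i ω) (x t ω) (x (t + 1) ω)) 0) ^ 2) - ‖lam t ω‖ ^ 2)
      + α / 2 * ‖x (t + 1) ω - x t ω‖ ^ 2 ≤
    F (x t ω) (ξ t ω)
      + inner ℝ (gradient (fun z => F z (ξ t ω)) (x t ω)) (z - x t ω)
      + 1 / 2 * (-(∑ i, lam t ω i * inner ℝ (Matrix.toEuclideanCLM (𝕜 := ℝ) (S t i ω)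
          (z - x t ω)) (z - x t ω)) + τ * ‖z - x t ω‖ ^ 2)
      + 1 / (2 * σ) * ((∑ i, (max (lam t ω i + σ * PMQS.quadModel (fun z => G i z (ξ t ω))
          (S t i ω) (x t ω) z) 0) ^ 2) - ‖lam t ω‖ ^ 2)
      + α / 2 * ‖z - x t ω‖ ^ 2 := by
  have := isMinOn_iff.1 (h.run.x_argmin t ht ω) z hz
  simp only [PMQS.augLag] at this
  rw [PMQS.quadModel, PMQS.quadModel, quadForm_Sigma0, quadForm_Sigma0] at this
  exact this

theorem variational {t : ℕ} (ht : t ∈ Finset.Icc 1 T) (ω : Ω) {y : PMQS.E n} (hy : y ∈ X₀) :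
    0 ≤ inner ℝ (gradient (fun z => F z (ξ t ω)) (x t ω)) (y - x (t + 1) ω)
      + ∑ i, lam (t + 1) ω i * (inner ℝ (gradient (fun z => G i z (ξ t ω)) (x t ω))
          (y - x (t + 1) ω) + inner ℝ (Matrix.toEuclideanCLM (𝕜 := ℝ) (S t i ω)
          (x (t + 1) ω - x t ω)) (y - x (t + 1) ω))
      - ∑ i, lam t ω i * inner ℝ (Matrix.toEuclideanCLM (𝕜 := ℝ) (S t i ω)
          (x (t + 1) ω - x t ω)) (y - x (t + 1) ω)
      + (α + τ) * inner ℝ (x (t + 1) ω - x t ω) (y - x (t + 1) ω) := by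
  have := subproblem_variational_inequality h.convex (h.run.x_mem t ht ω) hy
    (F (x t ω) (ξ t ω)) (gradient (fun z => F z (ξ t ω)) (x t ω))
    (fun i => G i (x t ω) (ξ t ω)) (fun i => gradient (fun z => G i z (ξ t ω)) (x t ω))
    (fun i => Matrix.toEuclideanCLM (𝕜 := ℝ) (S t i ω)) (fun i => h.clm_symm ht ω i)
    (lam t ω) h.σ_pos
    (fun i => PMQS.quadModel (fun z => G i z (ξ t ω)) (S t i ω) (x t ω))
    (fun _ _ => rfl) (fun z hz => h.argmin ht ω hz)
  simpa only [h.run.lam_step t ht ω] using this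

theorem G_gradient_ineq {t : ℕ} (ht : t ∈ Finset.Icc 1 T) (ω : Ω) (i : Fin p) {y : PMQS.E n}
    (hy : y ∈ X₀) :
    G i (x t ω) (ξ t ω) + inner ℝ (gradient (fun z => G i z (ξ t ω)) (x t ω)) (y - x t ω)
      ≤ G i y (ξ t ω) + L i / 2 * ‖y - x t ω‖ ^ 2 := by
  have hx := h.sub (h.x_mem (mem_Icc_add_one ht) ω)
  exact WeaklyConvexOn.inner_gradient_le (h.Gwc i (ξ t ω)) hx (h.sub hy)
    ((h.Gdiff i (ξ t ω)).differentiableAt (h.isOpen.mem_nhds hx))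

theorem F_gradient_ineq {t : ℕ} (ht : t ∈ Finset.Icc 1 T) (ω : Ω) {y : PMQS.E n}
    (hy : y ∈ X₀) :
    F (x t ω) (ξ t ω) + inner ℝ (gradient (fun z => F z (ξ t ω)) (x t ω)) (y - x t ω)
      ≤ F y (ξ t ω) + L₀ / 2 * ‖y - x t ω‖ ^ 2 := by
  have hx := h.sub (h.x_mem (mem_Icc_add_one ht) ω)
  exact WeaklyConvexOn.inner_gradient_le (h.Fwc (ξ t ω)) hx (h.sub hy)
    ((h.Fdiff (ξ t ω)).differentiableAt (h.isOpen.mem_nhds hx))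

theorem norm_lam_sq_drift (hεγ : ε₀ ≤ γ₁) {t : ℕ} (ht : t ∈ Finset.Icc 1 T) (ω : Ω)
    {y : PMQS.E n} (hy : y ∈ X₀) :
    ‖lam (t + 1) ω‖ ^ 2 - ‖lam t ω‖ ^ 2 ≤ 2 * σ * κf * D₀ + 2 * σ ^ 2 * γ₁ ^ 2
      + σ * (α + τ) * (‖y - x t ω‖ ^ 2 - ‖y - x (t + 1) ω‖ ^ 2)
      + 2 * σ * ∑ i, lam t ω i * G i y (ξ t ω) + σ * ε₀ * ‖lam t ω‖ := by
  have hx := h.x_mem (mem_Icc_add_one ht) ω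
  refine multiplier_drift (fun i => G i (x t ω) (ξ t ω)) (fun i => G i y (ξ t ω))
    (fun i => gradient (fun z => G i z (ξ t ω)) (x t ω))
    (fun i => Matrix.toEuclideanCLM (𝕜 := ℝ) (S t i ω)) (fun i => h.clm_symm ht ω i)
    (fun i => h.clm_nonpos ht ω i) (fun i => h.S_norm t ht i ω) _ _
    (h.lam_nonneg (mem_Icc_add_one ht) ω) h.σ_pos (by linarith [h.α_pos, h.τ_pos])
    (fun i => PMQS.quadModel (fun z => G i z (ξ t ω)) (S t i ω) (x t ω))
    (fun _ _ => rfl) (h.run.lam_step t ht ω) (h.variational ht ω hy)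
    h.κS_pos.le (h.Fgrad _ (h.sub hx) _) (h.diam y hy _ (h.run.x_mem t ht ω)) (fun i => ?_)
    (h.norm_quadModel_le ht ω hy) (h.norm_lam_sub_le ht ω) h.κSε hεγ h.ε₀_pos.le
  -- The form ⟨Σu, u⟩ lies between -κS‖u‖² and -L i‖u‖², so the weak-convexity error L i/2 · ‖u‖² is
  -- at most κS D₀²/2.
  have h1 := h.G_gradient_ineq ht ω i hy
  have h2 := h.clm_le ht ω i (y - x t ω)
  have h3 := (abs_le.1 (abs_inner_clm_le _ (h.S_norm t ht i ω) (y - x t ω) (y - x t ω))).1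
  have h4 := h.diam y hy _ hx
  have h5 : κS * ‖y - x t ω‖ * ‖y - x t ω‖ ≤ κS * D₀ * D₀ := by
    have := h.κS_pos; have := h.D₀_pos
    gcongr
  linarith

theorem step_le {t : ℕ} (ht : t ∈ Finset.Icc 1 T) (ω : Ω) :
    (α + τ) * ‖x (t + 1) ω - x t ω‖ ≤
      2 * (κf + (κg + κS * D₀ / 2) * Real.sqrt p * (‖lam t ω‖ + σ * νg)) := by
  have hx := h.x_mem (mem_Icc_add_one ht) ω
  have hm := h.argmin ht ω hx
  simp only [sub_self, inner_zero_right, map_zero, norm_zero, mul_zero, Finset.sum_const_zero,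
    neg_zero, add_zero, ne_eq, OfNat.ofNat_ne_zero, not_false_eq_true, zero_pow] at hm
  have := h.κg_pos; have := h.κS_pos; have := h.D₀_pos
  exact step_length_le (F (x t ω) (ξ t ω)) (fun i => G i (x t ω) (ξ t ω))
    (fun i => gradient (fun z => G i z (ξ t ω)) (x t ω))
    (fun i => Matrix.toEuclideanCLM (𝕜 := ℝ) (S t i ω))
    (fun i => h.clm_nonpos ht ω i) (fun i => h.S_norm t ht i ω) _
    (h.lam_nonneg (mem_Icc_add_one ht) ω) h.σ_pos
    (fun i => PMQS.quadModel (fun z => G i z (ξ t ω)) (S t i ω) (x t ω))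
    (fun _ _ => rfl) hm (h.Fgrad _ (h.sub hx) _)
    (fun i => h.Ggrad i _ (h.sub hx) _) (h.diam _ (h.run.x_mem t ht ω) _ hx)
    (h.Gbdd _ (h.sub hx) _) (by positivity)

theorem prox_descent {t : ℕ} (ht : t ∈ Finset.Icc 1 T) (ω : Ω) {y : PMQS.E n} (hy : y ∈ X₀) :
    (α + τ) / 2 * ‖y - x (t + 1) ω‖ ^ 2 ≤ (α + τ) / 2 * ‖y - x t ω‖ ^ 2
      + (F y (ξ t ω) - F (x t ω) (ξ t ω)
        + ∑ i, lam t ω i * (G i y (ξ t ω) - G i (x t ω) (ξ t ω)))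
      + PMQS.betaK L₀ L γ₂ t σ / 2 * ‖y - x t ω‖ ^ 2 + p * (σ * γ₂) * κg * D₀
      + (κf + Real.sqrt p * κg * ‖lam (t + 1) ω‖ + p * (σ * γ₂) * κS * D₀) ^ 2
        / (2 * (α + τ)) := by
  have hx := h.x_mem (mem_Icc_add_one ht) ω
  exact prox_step_descent _ _ _ _ L (fun i => gradient (fun z => G i z (ξ t ω)) (x t ω))
    (fun i => Matrix.toEuclideanCLM (𝕜 := ℝ) (S t i ω)) (fun i => h.S_norm t ht i ω) _ _
    (h.lam_nonneg (mem_Icc_add_one ht) ω) (add_pos h.α_pos h.τ_pos) (h.variational ht ω hy)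
    (h.Fgrad _ (h.sub hx) _) (fun i => h.Ggrad i _ (h.sub hx) _)
    (h.diam y hy _ (h.run.x_mem t ht ω)) (h.diam y hy _ hx) (h.F_gradient_ineq ht ω hy)
    (fun i => h.G_gradient_ineq ht ω i hy) (h.lagrangian_modulus_le ht ω)
    (mul_nonneg h.σ_pos.le h.γ₂_pos.le) h.κg_pos.le h.κS_pos.le (h.abs_lam_sub_le_γ₂ ht ω)

end Deterministic

end Assumptions

/-! ### Measurability, and replacing samples by expectations. -/

theorem ContinuousOn.measurable_comp_of_mem {Ω : Type*} {m : MeasurableSpace Ω} {A B : Type*}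
    [TopologicalSpace A] [MeasurableSpace A] [BorelSpace A] [TopologicalSpace B]
    [MeasurableSpace B] [BorelSpace B] {f : A → B}
    {X : Set A} (hf : ContinuousOn f X) {Y : Ω → A} (hY : Measurable Y) (hYX : ∀ ω, Y ω ∈ X) :
    Measurable fun ω => f (Y ω) :=
  (continuousOn_iff_continuous_domRestrict.1 hf).measurable.comp (hY.subtype_mk (h := hYX))

namespace Assumptions

variable {n p : ℕ} {Ω Ξ : Type*} [mΩ : MeasurableSpace Ω] [MeasurableSpace Ξ]
    {μ : Measure Ω} {P : Measure Ξ} {X₀ O₀ : Set (PMQS.E n)} {F : PMQS.E n → Ξ → ℝ}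
    {G : Fin p → PMQS.E n → Ξ → ℝ} {D₀ νg κf κg ε₀ L₀ : ℝ} {L : Fin p → ℝ} {T : ℕ}
    {σ α τ : ℝ} {ξ : ℕ → Ω → Ξ} {x₁ : PMQS.E n}
    {S : ℕ → Fin p → Ω → Matrix (Fin n) (Fin n) ℝ} {x : ℕ → Ω → PMQS.E n}
    {lam : ℕ → Ω → PMQS.E p} {κS γ₁ γ₂ : ℝ}

section Measurability

variable (h : Assumptions μ P X₀ O₀ F G D₀ νg κf κg ε₀ L₀ L T σ α τ ξ x₁ S x lam κS γ₁ γ₂)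
include h

theorem history_le {t : ℕ} (ht : t ∈ Finset.Icc 1 (T + 1)) : PMQS.history ξ t ≤ mΩ :=
  _root_.history_le h.ξmeas (Finset.mem_Icc.1 ht).2

theorem x_measurable {t : ℕ} (ht : t ∈ Finset.Icc 1 (T + 1)) : Measurable (x t) :=
  (h.run.x_adapted t ht).mono (h.history_le ht) le_rfl

theorem lam_measurable {t : ℕ} (ht : t ∈ Finset.Icc 1 (T + 1)) : Measurable (lam t) :=
  (h.run.lam_adapted t ht).mono (h.history_le ht) le_rfl

/-- A Carathéodory function, continuous in the point and measurable in the sample, is jointly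
measurable. The subtype is needed because F is controlled only on O₀. -/
theorem F_uncurry_measurable : Measurable (Function.uncurry fun (a : X₀) (z : Ξ) => F a z) :=
  measurable_uncurry_of_continuous_of_measurable
    (fun z => continuousOn_iff_continuous_domRestrict.1 ((h.Fdiff z).continuousOn.mono h.sub))
    (fun a => h.Fmeas a (h.sub a.2))

theorem G_uncurry_measurable (i : Fin p) :
    Measurable (Function.uncurry fun (a : X₀) (z : Ξ) => G i a z) :=
  measurable_uncurry_of_continuous_of_measurable
    (fun z => continuousOn_iff_continuous_domRestrict.1 ((h.Gdiff i z).continuousOn.mono h.sub))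
    (fun a => h.Gmeas i a (h.sub a.2))

theorem indepFun_sample {A : Type*} [MeasurableSpace A] {t : ℕ} (ht : t ∈ Finset.Icc 1 T)
    {V : Ω → A} (hV : Measurable[PMQS.history ξ t] V) : IndepFun V (ξ t) μ :=
  indep_of_indep_of_le_left (indep_history h.ξmeas h.ξindep ht) hV.comap_le

theorem G_comp_measurable {t : ℕ} (ht : t ∈ Finset.Icc 1 T) (i : Fin p) {Y : Ω → PMQS.E n}
    (hY : Measurable Y) (hYX : ∀ ω, Y ω ∈ X₀) : Measurable fun ω => G i (Y ω) (ξ t ω) :=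
  (h.G_uncurry_measurable i).comp ((hY.subtype_mk (h := hYX)).prodMk (h.ξmeas t ht))

theorem F_comp_measurable {t : ℕ} (ht : t ∈ Finset.Icc 1 T) {Y : Ω → PMQS.E n}
    (hY : Measurable Y) (hYX : ∀ ω, Y ω ∈ X₀) : Measurable fun ω => F (Y ω) (ξ t ω) :=
  h.F_uncurry_measurable.comp ((hY.subtype_mk (h := hYX)).prodMk (h.ξmeas t ht))

variable [IsProbabilityMeasure P]

theorem G_integrable (i : Fin p) {y : PMQS.E n} (hy : y ∈ O₀) : Integrable (G i y) P :=
  integrable_of_abs_le (h.Gmeas i y hy) (h.abs_G_le hy i)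

/-- Cauchy–Schwarz is applied under the integral, where the whole vector G has norm at most νg;
hence no factor √p. -/
theorem abs_sum_mul_expVal_le (a : PMQS.E p) {y : PMQS.E n} (hy : y ∈ O₀) :
    |∑ i, a i * PMQS.expVal P (G i) y| ≤ ‖a‖ * νg := by
  have e : ∑ i, a i * PMQS.expVal P (G i) y = ∫ z, ∑ i, a i * G i y z ∂P := by
    rw [integral_finsetSum _ fun i _ => (h.G_integrable i hy).const_mul _]
    simp only [integral_const_mul, PMQS.expVal]
  rw [e]
  have := norm_integral_le_of_norm_le_const (μ := P) (f := fun z => ∑ i, a i * G i y z)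
    (C := ‖a‖ * νg) (Filter.Eventually.of_forall fun z => by
      have h1 := sum_mul_le_norm_mul_norm a (WithLp.toLp 2 (fun i => G i y z))
      have h2 := sum_mul_le_norm_mul_norm (-a) (WithLp.toLp 2 (fun i => G i y z))
      have h3 := mul_le_mul_of_nonneg_left (h.Gbdd y hy z) (norm_nonneg a)
      rw [norm_neg] at h2
      simp only [PiLp.neg_apply, neg_mul, Finset.sum_neg_distrib] at h2
      rw [Real.norm_eq_abs, abs_le]
      constructor <;> linarith)
  simpa using this

theorem abs_expVal_G_le (i : Fin p) {y : PMQS.E n} (hy : y ∈ O₀) :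
    |PMQS.expVal P (G i) y| ≤ νg := by
  have := norm_integral_le_of_norm_le_const (μ := P) (f := fun z => G i y z) (C := νg)
    (Filter.Eventually.of_forall fun z => h.abs_G_le hy i z)
  simpa [PMQS.expVal] using this

theorem ε₀_le_γ₁ : ε₀ ≤ γ₁ := by
  obtain ⟨y, hy, hg⟩ := h.slater
  have i : Fin p := ⟨0, h.p_pos⟩
  have h1 := (abs_le.1 (h.abs_expVal_G_le i (h.sub hy))).1
  linarith [hg i, h.νg_le_γ₁]

theorem expVal_G_continuousOn (i : Fin p) : ContinuousOn (PMQS.expVal P (G i)) X₀ :=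
  (continuousOn_of_abs_sub_le (κ := κg) fun _ ha _ hb => abs_expVal_sub_le
    (fun _ hx => h.G_integrable i hx) (fun _ hx _ hy z => h.G_lip i hx hy z) ha hb).mono h.sub

theorem expVal_F_lip {a b : PMQS.E n} (ha : a ∈ O₀) (hb : b ∈ O₀) :
    |PMQS.expVal P F b - PMQS.expVal P F a| ≤ κf * ‖b - a‖ :=
  abs_expVal_sub_le h.Fint (fun _ hx _ hy z => h.F_lip hx hy z) ha hb

theorem expVal_F_continuousOn : ContinuousOn (PMQS.expVal P F) X₀ :=
  (continuousOn_of_abs_sub_le (κ := κf) fun _ ha _ hb => h.expVal_F_lip ha hb).mono h.sub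

variable [IsProbabilityMeasure μ]

theorem integral_mul_G {t : ℕ} (ht : t ∈ Finset.Icc 1 T) (i : Fin p) {w : Ω → ℝ}
    (hw : Measurable[PMQS.history ξ t] w) {B : ℝ} (hwB : ∀ ω, |w ω| ≤ B) {Y : Ω → PMQS.E n}
    (hY : Measurable[PMQS.history ξ t] Y) (hYX : ∀ ω, Y ω ∈ X₀) :
    ∫ ω, w ω * G i (Y ω) (ξ t ω) ∂μ = ∫ ω, w ω * PMQS.expVal P (G i) (Y ω) ∂μ := by
  have hle := h.history_le (mem_Icc_add_one ht)
  have hV : Measurable[PMQS.history ξ t] fun ω => (w ω, (⟨Y ω, hYX ω⟩ : X₀)) :=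
    hw.prodMk (hY.subtype_mk (h := hYX))
  have hK : Measurable fun a : (ℝ × X₀) × Ξ => a.1.1 * G i a.1.2 a.2 := by
    have := (h.G_uncurry_measurable i).comp
      ((measurable_snd.comp measurable_fst).prodMk measurable_snd :
        Measurable fun a : (ℝ × X₀) × Ξ => (a.1.2, a.2))
    exact (measurable_fst.comp measurable_fst).mul this
  have := integral_comp_of_indepFun (C := B * νg) (hV.mono hle le_rfl) (h.ξmeas t ht)
    (h.indepFun_sample ht hV) (h.ξlaw t ht) hK (fun ω => by
      rw [abs_mul]
      exact mul_le_mul (hwB ω) (h.abs_G_le (h.sub (hYX ω)) i _) (abs_nonneg _)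
        ((abs_nonneg _).trans (hwB ω)))
  simpa only [integral_const_mul, PMQS.expVal] using this

/-- F itself has no uniform bound, but its differences over X₀ are at most κf D₀; freezing is
therefore applied to the difference. -/
theorem integral_F_sub {t : ℕ} (ht : t ∈ Finset.Icc 1 T) {Y Y' : Ω → PMQS.E n}
    (hY : Measurable[PMQS.history ξ t] Y) (hYX : ∀ ω, Y ω ∈ X₀)
    (hY' : Measurable[PMQS.history ξ t] Y') (hYX' : ∀ ω, Y' ω ∈ X₀) :
    ∫ ω, (F (Y ω) (ξ t ω) - F (Y' ω) (ξ t ω)) ∂μ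
      = ∫ ω, (PMQS.expVal P F (Y ω) - PMQS.expVal P F (Y' ω)) ∂μ := by
  have hle := h.history_le (mem_Icc_add_one ht)
  have hV : Measurable[PMQS.history ξ t] fun ω => ((⟨Y ω, hYX ω⟩ : X₀), (⟨Y' ω, hYX' ω⟩ : X₀)) :=
    (hY.subtype_mk (h := hYX)).prodMk (hY'.subtype_mk (h := hYX'))
  have hK : Measurable fun a : (X₀ × X₀) × Ξ => F a.1.1 a.2 - F a.1.2 a.2 := by
    have h1 := h.F_uncurry_measurable.comp
      ((measurable_fst.comp measurable_fst).prodMk measurable_snd :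
        Measurable fun a : (X₀ × X₀) × Ξ => (a.1.1, a.2))
    have h2 := h.F_uncurry_measurable.comp
      ((measurable_snd.comp measurable_fst).prodMk measurable_snd :
        Measurable fun a : (X₀ × X₀) × Ξ => (a.1.2, a.2))
    exact h1.sub h2
  have := integral_comp_of_indepFun (C := κf * D₀) (hV.mono hle le_rfl) (h.ξmeas t ht)
    (h.indepFun_sample ht hV) (h.ξlaw t ht) hK (fun ω =>
      (h.F_lip (h.sub (hYX' ω)) (h.sub (hYX ω)) _).trans (mul_le_mul_of_nonneg_left
        (h.diam _ (hYX ω) _ (hYX' ω)) h.κf_pos.le))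
  simp only at this
  rw [this]
  refine integral_congr_ae (Filter.Eventually.of_forall fun ω => ?_)
  exact integral_sub (h.Fint _ (h.sub (hYX ω))) (h.Fint _ (h.sub (hYX' ω)))

/-- One-step drift in expectation, with a weight known at an earlier time. -/
theorem weighted_drift {y : PMQS.E n} (hy : y ∈ X₀)
    (hg : ∀ i, PMQS.expVal P (G i) y ≤ -ε₀) {t k : ℕ} (htk : t ≤ k)
    (hk : k ∈ Finset.Icc 1 T) {w : Ω → ℝ} (hw : Measurable[PMQS.history ξ t] w)
    (hw0 : ∀ ω, 0 ≤ w ω) {B : ℝ} (hwB : ∀ ω, w ω ≤ B) :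
    ∫ ω, w ω * (‖lam (k + 1) ω‖ ^ 2 - ‖lam k ω‖ ^ 2) ∂μ ≤
      ∫ ω, w ω * (2 * σ * κf * D₀ + 2 * σ ^ 2 * γ₁ ^ 2
        + σ * (α + τ) * (‖y - x k ω‖ ^ 2 - ‖y - x (k + 1) ω‖ ^ 2) - σ * ε₀ * ‖lam k ω‖) ∂μ := by
  have hk' := mem_Icc_add_one hk
  have hk1 := add_one_mem_Icc hk
  have hwk : Measurable[PMQS.history ξ k] w := hw.mono (history_mono htk) le_rfl
  have hwm : Measurable w := hwk.mono (h.history_le hk') le_rfl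
  have hwabs : ∀ ω, |w ω| ≤ B := fun ω => by rw [abs_of_nonneg (hw0 ω)]; exact hwB ω
  have hwint : Integrable w μ := integrable_of_abs_le hwm hwabs
  have mul_int : ∀ g : Ω → ℝ, Measurable g → ∀ c, (∀ ω, |g ω| ≤ c) →
      Integrable (fun ω => w ω * g ω) μ := fun g hg c hc =>
    hwint.mul_bdd (c := c) hg.aestronglyMeasurable (Filter.Eventually.of_forall hc)
  have hlk := h.lam_measurable hk'
  have hlk1 := h.lam_measurable hk1
  have hxk := h.x_measurable hk'
  have hxk1 := h.x_measurable hk1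
  have isq : ∀ j ∈ Finset.Icc 1 (T + 1), Integrable (fun ω => w ω * ‖lam j ω‖ ^ 2) μ :=
    fun j hj => mul_int _ ((h.lam_measurable hj).norm.pow_const 2) ((T * (σ * γ₁)) ^ 2) fun ω => by
      rw [abs_pow, abs_norm]
      have := h.norm_lam_le hj ω
      gcongr
  have inm : Integrable (fun ω => w ω * ‖lam k ω‖) μ :=
    mul_int _ hlk.norm (T * (σ * γ₁)) fun ω => by rw [abs_norm]; exact h.norm_lam_le hk' ω
  have ix : ∀ j ∈ Finset.Icc 1 (T + 1), Integrable (fun ω => w ω * ‖y - x j ω‖ ^ 2) μ :=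
    fun j hj => mul_int _ (((h.x_measurable hj).const_sub y).norm.pow_const 2) (D₀ ^ 2) fun ω => by
      rw [abs_pow, abs_norm]
      have := h.diam y hy _ (h.x_mem hj ω)
      gcongr
  have wl_meas : ∀ i, Measurable[PMQS.history ξ k] fun ω => w ω * lam k ω i := fun i =>
    hwk.mul ((measurable_pi_apply i).comp
      ((PiLp.continuous_ofLp 2 _).measurable.comp (h.run.lam_adapted k hk')))
  have wl_bdd : ∀ i ω, |w ω * lam k ω i| ≤ B * (T * (σ * γ₁)) := fun i ω => by
    rw [abs_mul]
    exact mul_le_mul (hwabs ω) ((abs_apply_le_norm _ i).trans (h.norm_lam_le hk' ω))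
      (abs_nonneg _) ((abs_nonneg _).trans (hwabs ω))
  have iG : ∀ i, Integrable (fun ω => (w ω * lam k ω i) * G i y (ξ k ω)) μ := fun i =>
    (integrable_of_abs_le ((wl_meas i).mono (h.history_le hk') le_rfl) (wl_bdd i)).mul_bdd
      (c := νg) (h.G_comp_measurable hk i measurable_const (fun _ => hy)).aestronglyMeasurable
      (Filter.Eventually.of_forall fun ω => h.abs_G_le (h.sub hy) i _)
  have ig : ∀ i, Integrable (fun ω => (w ω * lam k ω i) * PMQS.expVal P (G i) y) μ := fun i =>
    (integrable_of_abs_le ((wl_meas i).mono (h.history_le hk') le_rfl) (wl_bdd i)).mul_const _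
  -- R is the part of the pathwise drift that does not contain G i y (ξ k); only the remaining part
  -- is averaged over the fresh sample.
  set R : Ω → ℝ := fun ω => w ω * (2 * σ * κf * D₀ + 2 * σ ^ 2 * γ₁ ^ 2)
    + σ * (α + τ) * (w ω * ‖y - x k ω‖ ^ 2 - w ω * ‖y - x (k + 1) ω‖ ^ 2)
    + σ * ε₀ * (w ω * ‖lam k ω‖) with hR
  have iR : Integrable R μ := ((hwint.mul_const _).add
    (((ix k hk').sub (ix _ hk1)).const_mul _)).add (inm.const_mul _)
  have iGs : Integrable (fun ω => 2 * σ * ∑ i, (w ω * lam k ω i) * G i y (ξ k ω)) μ :=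
    (integrable_finsetSum _ fun i _ => iG i).const_mul _
  have igs : Integrable (fun ω => 2 * σ * ∑ i, (w ω * lam k ω i) * PMQS.expVal P (G i) y) μ :=
    (integrable_finsetSum _ fun i _ => ig i).const_mul _
  have step1 : ∫ ω, w ω * (‖lam (k + 1) ω‖ ^ 2 - ‖lam k ω‖ ^ 2) ∂μ
      ≤ ∫ ω, (R ω + 2 * σ * ∑ i, (w ω * lam k ω i) * G i y (ξ k ω)) ∂μ := by
    refine integral_mono (((isq _ hk1).sub (isq k hk')).congr (Filter.Eventually.of_forall
      fun ω => by simp only [Pi.sub_apply]; ring)) (iR.add iGs) fun ω => ?_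
    have h1 := mul_le_mul_of_nonneg_left (h.norm_lam_sq_drift h.ε₀_le_γ₁ hk ω hy) (hw0 ω)
    refine h1.trans_eq ?_
    simp only [hR, mul_assoc, ← Finset.mul_sum]
    ring
  have step2 : ∫ ω, (R ω + 2 * σ * ∑ i, (w ω * lam k ω i) * G i y (ξ k ω)) ∂μ
      = ∫ ω, (R ω + 2 * σ * ∑ i, (w ω * lam k ω i) * PMQS.expVal P (G i) y) ∂μ := by
    rw [integral_add iR iGs, integral_add iR igs, integral_const_mul, integral_const_mul,
      integral_finsetSum _ fun i _ => iG i, integral_finsetSum _ fun i _ => ig i]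
    congr 2
    exact Finset.sum_congr rfl fun i _ => h.integral_mul_G hk i (wl_meas i) (wl_bdd i)
      measurable_const (fun _ => hy)
  rw [step2] at step1
  refine step1.trans ?_
  -- R carries +σε₀‖λ‖, and the Slater point contributes -2σε₀‖λ‖, since ‖λ‖ ≤ ∑ λ_i for λ ≥ 0. The
  -- net drift is -σε₀‖λ‖.
  have hR' : ∀ ω, R ω - 2 * (σ * ε₀ * (w ω * ‖lam k ω‖)) = w ω * (2 * σ * κf * D₀
      + 2 * σ ^ 2 * γ₁ ^ 2 + σ * (α + τ) * (‖y - x k ω‖ ^ 2 - ‖y - x (k + 1) ω‖ ^ 2)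
      - σ * ε₀ * ‖lam k ω‖) := fun ω => by simp only [hR]; ring
  refine integral_mono (iR.add igs) ((iR.sub ((inm.const_mul (σ * ε₀)).const_mul 2)).congr
    (Filter.Eventually.of_forall hR')) fun ω => ?_
  have h1 : ∑ i, (w ω * lam k ω i) * PMQS.expVal P (G i) y ≤ -(ε₀ * (w ω * ‖lam k ω‖)) := by
    have h2 := norm_le_sum_of_nonneg _ (h.lam_nonneg hk' ω)
    calc _ ≤ ∑ i, (w ω * lam k ω i) * (-ε₀) := Finset.sum_le_sum fun i _ =>
          mul_le_mul_of_nonneg_left (hg i) (mul_nonneg (hw0 ω) (h.lam_nonneg hk' ω i))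
      _ = -(ε₀ * (w ω * ∑ i, lam k ω i)) := by
          rw [← Finset.sum_mul, ← Finset.mul_sum]; ring
      _ ≤ _ := by
          have := h.ε₀_pos
          have := hw0 ω
          gcongr
  have h3 := mul_le_mul_of_nonneg_left h1 (show 0 ≤ 2 * σ by linarith [h.σ_pos])
  simp only [hR]
  linarith

end Measurability

end Assumptions

/-! ### Numerical comparison with ψ. -/

theorem upperGamma_nonneg (a : ℝ) {b : ℝ} (hb : 0 ≤ b) : 0 ≤ PMQS.upperGamma a b :=
  setIntegral_nonneg measurableSet_Ioi fun _ hu =>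
    mul_nonneg (Real.rpow_nonneg (hb.trans hu.out.le) _) (Real.exp_pos _).le

/-- Here log 128 = 7 log 2 > 4.85. The value 19/4 is what `multiplier_threshold_le_psi` requires. -/
theorem log_bound {γ₁ ε₀ : ℝ} (hε : 0 < ε₀) (hεγ : ε₀ ≤ γ₁) :
    19 / 4 ≤ Real.log (128 * γ₁ ^ 2 / ε₀ ^ 2) := by
  have h1 : (128 : ℝ) ≤ 128 * γ₁ ^ 2 / ε₀ ^ 2 := by
    rw [le_div_iff₀ (by positivity)]; gcongr
  have h2 : Real.log 128 = 7 * Real.log 2 := by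
    rw [show (128 : ℝ) = 2 ^ 7 by norm_num, Real.log_pow]; norm_num
  have := Real.log_le_log (by norm_num) h1
  linarith [Real.log_two_gt_d9]

/-- The left side is z₀ + 1/r from the moment bound, with M = ⌈s⌉. In units of V = σγ₁²/ε₀, using M
≤ 2s, the logarithmic term costs 12sVℓ of the available 16sVℓ. The rest exceeds its counterparts in
ψ by at most (4 + 1 + 2 + 12)sV = 19sV, which the remaining 4sVℓ covers. -/
theorem multiplier_threshold_le_psi {γ₁ ε₀ D₀ κf νg σ α τ s M : ℝ} (hε : 0 < ε₀) (hεγ : ε₀ ≤ γ₁)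
    (hσ : 0 < σ) (hατ : 0 ≤ α + τ) (hs : 1 ≤ s) (hsM : s ≤ M) (hMs : M ≤ s + 1) :
    2 * (M * (2 * σ * κf * D₀ + 2 * σ ^ 2 * γ₁ ^ 2 + σ * ε₀ * ((M - 1) * (σ * γ₁)))
        + σ * (α + τ) * D₀ ^ 2) / (σ * ε₀ * M) + M * (σ * γ₁)
      + 6 * M * σ * γ₁ ^ 2 / ε₀ * Real.log (72 * γ₁ ^ 2 / ε₀ ^ 2) + 6 * M * σ * γ₁ ^ 2 / ε₀
      ≤ PMQS.psi γ₁ ε₀ D₀ κf νg σ α τ s := by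
  have hγ : 0 < γ₁ := hε.trans_le hεγ
  have hM : 0 < M := by linarith
  have hs0 : 0 < s := by linarith
  have e1 : 2 * (M * (2 * σ * κf * D₀ + 2 * σ ^ 2 * γ₁ ^ 2 + σ * ε₀ * ((M - 1) * (σ * γ₁)))
        + σ * (α + τ) * D₀ ^ 2) / (σ * ε₀ * M)
      = 4 * κf * D₀ / ε₀ + 4 * (σ * γ₁ ^ 2 / ε₀) + 2 * (M - 1) * (σ * γ₁)
        + 2 * (α + τ) * D₀ ^ 2 / (ε₀ * M) := by
    field_simp
    ring
  set ℓ := Real.log (128 * γ₁ ^ 2 / ε₀ ^ 2) with hℓ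
  have hℓ1 : 19 / 4 ≤ ℓ := log_bound hε hεγ
  have hlog : Real.log (72 * γ₁ ^ 2 / ε₀ ^ 2) ≤ ℓ := by
    refine Real.log_le_log (by positivity) ?_
    gcongr; norm_num
  set V := σ * γ₁ ^ 2 / ε₀ with hV
  have hV0 : 0 < V := by positivity
  have hγV : σ * γ₁ ≤ V := by
    rw [hV, le_div_iff₀ hε]
    have : σ * γ₁ * ε₀ ≤ σ * γ₁ * γ₁ := by gcongr
    linarith
  have e2 : 6 * M * σ * γ₁ ^ 2 / ε₀ = 6 * M * V := by rw [hV]; ring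
  have e3 : (16 * γ₁ ^ 2 / ε₀ * ℓ) * σ * s = 16 * V * s * ℓ := by rw [hV]; ring
  have h1 : 2 * (α + τ) * D₀ ^ 2 / (ε₀ * M) ≤ 2 * (α + τ) * D₀ ^ 2 / (ε₀ * s) := by
    gcongr
  have hM2 : M ≤ 2 * s := by linarith
  have h2 : 6 * M * V * Real.log (72 * γ₁ ^ 2 / ε₀ ^ 2) + 6 * M * V ≤ 12 * s * V * (ℓ + 1) := by
    calc _ ≤ 6 * M * V * ℓ + 6 * M * V := by gcongr
      _ = 6 * M * V * (ℓ + 1) := by ring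
      _ ≤ 6 * (2 * s) * V * (ℓ + 1) := by gcongr
      _ = _ := by ring
  have h3 : V ≤ s * V := le_mul_of_one_le_left hV0.le hs
  have h4 : (M - 1) * (σ * γ₁) ≤ s * (σ * γ₁) := by gcongr; linarith
  have h5 : M * (σ * γ₁) ≤ 2 * (s * V) := by
    calc M * (σ * γ₁) ≤ (2 * s) * V := by gcongr
      _ = _ := by ring
  have h6 : 4 * (19 / 4) * (s * V) ≤ 4 * ℓ * (s * V) := by gcongr
  have h7 : 0 ≤ ε₀ * σ * s / 4 := by positivity
  have h8 : 0 ≤ 2 * σ * νg ^ 2 / ε₀ := by positivity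
  rw [e1, e2, PMQS.psi, PMQS.vartheta, ← hℓ, add_mul, add_mul, e3]
  nlinarith

/-! ### Uniform moment bounds for the multipliers. -/

namespace Assumptions

variable {n p : ℕ} {Ω Ξ : Type*} [mΩ : MeasurableSpace Ω] [MeasurableSpace Ξ]
    {μ : Measure Ω} {P : Measure Ξ} {X₀ O₀ : Set (PMQS.E n)} {F : PMQS.E n → Ξ → ℝ}
    {G : Fin p → PMQS.E n → Ξ → ℝ} {D₀ νg κf κg ε₀ L₀ : ℝ} {L : Fin p → ℝ} {T : ℕ}
    {σ α τ : ℝ} {ξ : ℕ → Ω → Ξ} {x₁ : PMQS.E n}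
    {S : ℕ → Fin p → Ω → Matrix (Fin n) (Fin n) ℝ} {x : ℕ → Ω → PMQS.E n}
    {lam : ℕ → Ω → PMQS.E p} {κS γ₁ γ₂ : ℝ}

section Moments

variable [IsProbabilityMeasure μ]
variable (h : Assumptions μ P X₀ O₀ F G D₀ νg κf κg ε₀ L₀ L T σ α τ ξ x₁ S x lam κS γ₁ γ₂)
include h

theorem norm_lam_integrable {t : ℕ} (ht : t ∈ Finset.Icc 1 (T + 1)) :
    Integrable (fun ω => ‖lam t ω‖) μ :=
  integrable_of_abs_le (h.lam_measurable ht).norm (C := T * (σ * γ₁)) fun ω => by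
    rw [abs_norm]; exact h.norm_lam_le ht ω

theorem norm_lam_sq_integrable {t : ℕ} (ht : t ∈ Finset.Icc 1 (T + 1)) :
    Integrable (fun ω => ‖lam t ω‖ ^ 2) μ :=
  integrable_of_abs_le ((h.lam_measurable ht).norm.pow_const 2) (C := (T * (σ * γ₁)) ^ 2)
    fun ω => by
      rw [abs_pow, abs_norm]
      have := h.norm_lam_le ht ω
      gcongr

variable [IsProbabilityMeasure P]

/-- Over a block of M + 1 rounds the distances to the Slater point telescope, so (α+τ)D₀² is paid
once per block. Within the block ‖λ‖ falls at most Mσγ₁ below its initial value, so the drift can be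
expressed by ‖λ^t‖ alone. -/
theorem weighted_multistep_drift (M t : ℕ) (ht1 : 1 ≤ t) (htM : t + (M + 1) ≤ T + 1)
    {w : Ω → ℝ} (hw : Measurable[PMQS.history ξ t] w) (hw0 : ∀ ω, 0 ≤ w ω) {B : ℝ}
    (hwB : ∀ ω, w ω ≤ B) :
    ∫ ω, w ω * (‖lam (t + (M + 1)) ω‖ ^ 2 - ‖lam t ω‖ ^ 2) ∂μ ≤
      ∫ ω, w ω * (((M + 1 : ℕ) * (2 * σ * κf * D₀ + 2 * σ ^ 2 * γ₁ ^ 2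
        + σ * ε₀ * (M * (σ * γ₁))) + σ * (α + τ) * D₀ ^ 2)
        - σ * ε₀ * (M + 1 : ℕ) * ‖lam t ω‖) ∂μ := by
  obtain ⟨y, hy, hg⟩ := h.slater
  have hmem : ∀ j ≤ M + 1, t + j ∈ Finset.Icc 1 (T + 1) := fun j hj =>
    Finset.mem_Icc.2 ⟨by omega, by omega⟩
  have ht : t ∈ Finset.Icc 1 (T + 1) := hmem 0 (by omega)
  have hwm : Measurable w := hw.mono (h.history_le ht) le_rfl
  have hwint : Integrable w μ := integrable_of_abs_le hwm (C := B) fun ω => by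
    rw [abs_of_nonneg (hw0 ω)]; exact hwB ω
  have mul_int : ∀ g : Ω → ℝ, Measurable g → ∀ c, (∀ ω, |g ω| ≤ c) →
      Integrable (fun ω => w ω * g ω) μ := fun g hg c hc =>
    hwint.mul_bdd (c := c) hg.aestronglyMeasurable (Filter.Eventually.of_forall hc)
  have isq : ∀ j ≤ M + 1, Integrable (fun ω => w ω * ‖lam (t + j) ω‖ ^ 2) μ :=
    fun j hj => mul_int _ ((h.lam_measurable (hmem j hj)).norm.pow_const 2)
      ((T * (σ * γ₁)) ^ 2) fun ω => by
      rw [abs_pow, abs_norm]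
      have := h.norm_lam_le (hmem j hj) ω
      gcongr
  have inm : ∀ j ≤ M + 1, Integrable (fun ω => w ω * ‖lam (t + j) ω‖) μ :=
    fun j hj => mul_int _ (h.lam_measurable (hmem j hj)).norm (T * (σ * γ₁)) fun ω => by
      rw [abs_norm]; exact h.norm_lam_le (hmem j hj) ω
  have ix : ∀ j ≤ M + 1, Integrable (fun ω => w ω * ‖y - x (t + j) ω‖ ^ 2) μ :=
    fun j hj => mul_int _ (((h.x_measurable (hmem j hj)).const_sub y).norm.pow_const 2)
      (D₀ ^ 2) fun ω => by
      rw [abs_pow, abs_norm]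
      have := h.diam y hy _ (h.x_mem (hmem j hj) ω)
      gcongr
  set c := 2 * σ * κf * D₀ + 2 * σ ^ 2 * γ₁ ^ 2 with hc
  set W := ∫ ω, w ω ∂μ with hW
  set a : ℕ → ℝ := fun j => ∫ ω, w ω * ‖lam (t + j) ω‖ ^ 2 ∂μ with ha
  set d : ℕ → ℝ := fun j => ∫ ω, w ω * ‖y - x (t + j) ω‖ ^ 2 ∂μ with hd
  set z : ℕ → ℝ := fun j => ∫ ω, w ω * ‖lam (t + j) ω‖ ∂μ with hz
  have key : ∀ j ≤ M, a (j + 1) - a j ≤ c * W + σ * (α + τ) * (d j - d (j + 1))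
      - σ * ε₀ * z j := by
    intro j hj
    have h1 := h.weighted_drift hy hg (t := t) (k := t + j) (by omega)
      (Finset.mem_Icc.2 ⟨by omega, by omega⟩) hw hw0 hwB
    have e1 : ∫ ω, w ω * (‖lam (t + j + 1) ω‖ ^ 2 - ‖lam (t + j) ω‖ ^ 2) ∂μ
        = a (j + 1) - a j := by
      simp only [mul_sub]
      exact integral_sub (isq (j + 1) (by omega)) (isq j (by omega))
    have ixd : Integrable (fun ω => w ω * ‖y - x (t + j) ω‖ ^ 2
        - w ω * ‖y - x (t + (j + 1)) ω‖ ^ 2) μ := (ix j (by omega)).sub (ix (j + 1) (by omega))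
    have icd : Integrable (fun ω => c * w ω + σ * (α + τ) * (w ω * ‖y - x (t + j) ω‖ ^ 2
        - w ω * ‖y - x (t + (j + 1)) ω‖ ^ 2)) μ := (hwint.const_mul c).add (ixd.const_mul _)
    have e2 : ∫ ω, w ω * (c + σ * (α + τ) * (‖y - x (t + j) ω‖ ^ 2 - ‖y - x (t + j + 1) ω‖ ^ 2)
        - σ * ε₀ * ‖lam (t + j) ω‖) ∂μ
        = c * W + σ * (α + τ) * (d j - d (j + 1)) - σ * ε₀ * z j := by
      rw [hd, hz, hW]
      simp only
      rw [← integral_sub (ix j (by omega)) (ix (j + 1) (by omega)), ← integral_const_mul,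
        ← integral_const_mul, ← integral_const_mul, ← integral_add (hwint.const_mul c)
        (ixd.const_mul _), ← integral_sub icd ((inm j (by omega)).const_mul _)]
      refine integral_congr_ae (Filter.Eventually.of_forall fun ω => ?_)
      simp only [← add_assoc]; ring
    rw [e1, e2] at h1
    exact h1
  have hzj : ∀ j ≤ M, z 0 - M * (σ * γ₁) * W ≤ z j := by
    intro j hj
    rw [hz, hW]
    simp only
    rw [← integral_const_mul, ← integral_sub (inm 0 (by omega)) (hwint.const_mul _)]
    refine integral_mono ((inm 0 (by omega)).sub (hwint.const_mul _)) (inm j (by omega))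
      fun ω => ?_
    have h1 := abs_sub_le_mul_of_increments (Z := fun t => ‖lam t ω‖) (N := T + 1) (t := t)
      (δ := σ * γ₁) (fun k hk hkN => h.abs_norm_lam_sub_le (Finset.mem_Icc.2 ⟨by omega, by omega⟩) ω)
      j (by omega)
    have h2 : (j : ℝ) * (σ * γ₁) ≤ M * (σ * γ₁) := by
      have := h.σ_pos; have := h.γ₁_pos
      gcongr
    have h3 : ‖lam (t + 0) ω‖ - M * (σ * γ₁) ≤ ‖lam (t + j) ω‖ := by
      rw [add_zero]; linarith [(abs_le.1 h1).1]
    have h4 := mul_le_mul_of_nonneg_left h3 (hw0 ω)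
    simp only
    linarith
  have hind : ∀ j ≤ M + 1, a j - a 0 ≤ j * (c + σ * ε₀ * (M * (σ * γ₁))) * W
      + σ * (α + τ) * (d 0 - d j) - j * (σ * ε₀ * z 0) := by
    intro j
    induction j with
    | zero => intro _; simp
    | succ j ih =>
      intro hj
      have h1 := ih (by omega)
      have h2 := key j (by omega)
      have h3 := mul_le_mul_of_nonneg_left (hzj j (by omega))
        (mul_nonneg h.σ_pos.le h.ε₀_pos.le)
      push_cast
      linarith
  have hd0 : d 0 ≤ D₀ ^ 2 * W := by
    rw [hd, hW]
    simp only
    rw [← integral_const_mul]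
    refine integral_mono (ix 0 (by omega)) (hwint.const_mul _) fun ω => ?_
    simp only
    rw [mul_comm (D₀ ^ 2)]
    have := h.diam y hy _ (h.x_mem (hmem 0 (by omega)) ω)
    have := hw0 ω
    gcongr
  have hdM : 0 ≤ d (M + 1) := integral_nonneg fun ω => mul_nonneg (hw0 ω) (sq_nonneg _)
  have hfin := hind (M + 1) le_rfl
  have e1 : ∫ ω, w ω * (‖lam (t + (M + 1)) ω‖ ^ 2 - ‖lam t ω‖ ^ 2) ∂μ = a (M + 1) - a 0 := by
    simp only [mul_sub]
    exact integral_sub (isq (M + 1) (by omega)) (isq 0 (by omega))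
  rw [e1]
  have e2 : ∀ C κ : ℝ, ∫ ω, w ω * (C - κ * ‖lam t ω‖) ∂μ = C * W - κ * z 0 := by
    intro C κ
    rw [hz, hW]
    simp only
    rw [← integral_const_mul, ← integral_const_mul, ← integral_sub (hwint.const_mul _)
      ((inm 0 (by omega)).const_mul _)]
    refine integral_congr_ae (Filter.Eventually.of_forall fun ω => ?_)
    simp only [add_zero]; ring
  rw [e2]
  have h5 := mul_le_mul_of_nonneg_left (show d 0 - d (M + 1) ≤ D₀ ^ 2 * W by linarith)
    (show 0 ≤ σ * (α + τ) from mul_nonneg h.σ_pos.le (add_pos h.α_pos h.τ_pos).le)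
  linarith

variable {s ψ : ℝ}

/-- Uniform second moment bound for the multipliers. -/
theorem integral_norm_lam_sq_le (hs : 1 ≤ s)
    (hψ : ψ = PMQS.psi γ₁ ε₀ D₀ κf νg σ α τ s) {t : ℕ} (ht : t ∈ Finset.Icc 1 (T + 1)) :
    0 < ψ ∧ ∫ ω, ‖lam t ω‖ ^ 2 ∂μ ≤ ψ ^ 2 := by
  -- The block length is ⌈s⌉, which lies between s and s + 1.
  obtain ⟨M, hM⟩ : ∃ M, ⌈s⌉₊ = M + 1 :=
    ⟨⌈s⌉₊ - 1, by have : 0 < ⌈s⌉₊ := Nat.ceil_pos.2 (by linarith)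
                  omega⟩
  have hsM : s ≤ (M + 1 : ℕ) := hM ▸ Nat.le_ceil s
  have hMs : ((M + 1 : ℕ) : ℝ) ≤ s + 1 := hM ▸ (Nat.ceil_lt_add_one (by linarith)).le
  have hσ := h.σ_pos
  have hε := h.ε₀_pos
  have hγ := h.γ₁_pos
  have hεγ := h.ε₀_le_γ₁
  have hατ := add_pos h.α_pos h.τ_pos
  have hD := h.D₀_pos
  have hκf := h.κf_pos
  set m : ℝ := ((M + 1 : ℕ) : ℝ) with hm
  have hm1 : (M : ℝ) = m - 1 := by rw [hm]; push_cast; ring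
  have hm0 : 0 < m := by linarith
  have hM0 : (0 : ℝ) ≤ M := Nat.cast_nonneg M
  set C := m * (2 * σ * κf * D₀ + 2 * σ ^ 2 * γ₁ ^ 2 + σ * ε₀ * (M * (σ * γ₁)))
    + σ * (α + τ) * D₀ ^ 2 with hC
  set κ := σ * ε₀ * m with hκ
  -- With this r, rκ/4 = ε₀²/(24γ₁²) and (r m σγ₁)² = ε₀²/(36γ₁²); the difference is q =
  -- ε₀²/(72γ₁²). Moreover r m σγ₁ = ε₀/(6γ₁) ≤ 1.
  set r := ε₀ / (6 * m * σ * γ₁ ^ 2) with hr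
  set q := ε₀ ^ 2 / (72 * γ₁ ^ 2) with hq
  have hC0 : 0 < C := by positivity
  have hκ0 : 0 < κ := by positivity
  have hr0 : 0 < r := by positivity
  have hq0 : 0 < q := by positivity
  rw [Finset.mem_Icc] at ht
  have hexp := integral_exp_le_of_drift (μ := μ) (PMQS.history ξ) (T + 1) (M + 1) (by omega)
    (fun t h1 h2 => h.history_le (Finset.mem_Icc.2 ⟨h1, h2⟩)) (fun t ω => ‖lam t ω‖)
    (fun t h1 h2 => measurable_norm.comp (h.run.lam_adapted t (Finset.mem_Icc.2 ⟨h1, h2⟩)))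
    (fun ω => by rw [h.run.lam_one, norm_zero]) (δ := σ * γ₁) (C := C) (κ := κ) (r := r) (q := q)
    (by positivity) hC0 hκ0 hr0
    (fun t h1 h2 ω => h.abs_norm_lam_sub_le (Finset.mem_Icc.2 ⟨h1, by omega⟩) ω)
    (fun t h1 h2 w hw hw0 ⟨B, hwB⟩ => h.weighted_multistep_drift M t h1 h2 hw hw0 hwB)
    (by
      have : r * (m * (σ * γ₁)) = ε₀ / γ₁ / 6 := by rw [hr]; field_simp
      rw [← hm, this]
      have : ε₀ / γ₁ ≤ 1 := (div_le_one hγ).2 hεγ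
      linarith)
    (by rw [← hm, hr, hκ, hq]; field_simp; norm_num) hq0
    (by
      rw [hq, div_le_one (by positivity)]
      have : ε₀ ^ 2 ≤ γ₁ ^ 2 := by gcongr
      nlinarith [sq_nonneg γ₁])
    t ht.1 ht.2
  rw [← hm] at hexp
  set lg := Real.log (72 * γ₁ ^ 2 / ε₀ ^ 2) with hlg
  have hlg0 : 0 ≤ lg := by
    refine Real.log_nonneg ?_
    rw [le_div_iff₀ (by positivity)]
    have : ε₀ ^ 2 ≤ γ₁ ^ 2 := by gcongr
    nlinarith [sq_nonneg γ₁]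
  set z₀ := 2 * C / κ + m * (σ * γ₁) + 6 * m * σ * γ₁ ^ 2 / ε₀ * lg with hz₀
  have hz₀0 : 0 ≤ z₀ := by positivity
  -- The factor 1/q moves into the exponent; log(1/q)/r is the logarithmic term of z₀.
  have hexp' : Real.exp (r * (2 * C / κ + m * (σ * γ₁))) / q = Real.exp (r * z₀) := by
    have e : r * z₀ = r * (2 * C / κ + m * (σ * γ₁)) + lg := by
      rw [hz₀, hr]; field_simp
    rw [e, Real.exp_add, hlg, Real.exp_log (by positivity), hq]
    field_simp
  rw [hexp'] at hexp
  have hsq := integral_sq_le_of_integral_exp_le (h.lam_measurable (Finset.mem_Icc.2 ht)).norm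
    (fun ω => norm_nonneg _) (fun ω => h.norm_lam_le (Finset.mem_Icc.2 ht) ω) hr0 hz₀0 hexp
  have hle : z₀ + 1 / r ≤ ψ := by
    have := multiplier_threshold_le_psi (κf := κf) (D₀ := D₀) (νg := νg) hε hεγ hσ hατ.le hs hsM hMs
    rw [← hψ, ← hm1] at this
    refine le_trans (le_of_eq ?_) this
    have : 1 / r = 6 * m * σ * γ₁ ^ 2 / ε₀ := by rw [hr, one_div_div]
    rw [this]
  have hpos : 0 < z₀ + 1 / r := by positivity
  exact ⟨hpos.trans_le hle, hsq.trans (by gcongr)⟩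

theorem integral_norm_lam_le (hs : 1 ≤ s)
    (hψ : ψ = PMQS.psi γ₁ ε₀ D₀ κf νg σ α τ s) {t : ℕ} (ht : t ∈ Finset.Icc 1 (T + 1)) :
    ∫ ω, ‖lam t ω‖ ∂μ ≤ ψ :=
  integral_le_of_integral_sq_le (h.norm_lam_integrable ht) (h.norm_lam_sq_integrable ht)
    (h.integral_norm_lam_sq_le hs hψ ht).1 (h.integral_norm_lam_sq_le hs hψ ht).2

end Moments

end Assumptions

/-! ### Telescoping and the constraint violation. -/

theorem sum_Icc_one_succ {A : Type*} [AddCommMonoid A] (f : ℕ → A) (T : ℕ) :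
    ∑ t ∈ Finset.Icc 1 (T + 1), f t = ∑ t ∈ Finset.Icc 1 T, f t + f (T + 1) :=
  Finset.sum_Icc_succ_top (by omega) f

theorem sum_sub_le_of_le_succ {a b : ℕ → ℝ} {T : ℕ} (hT : 1 ≤ T)
    (h : ∀ t, 1 ≤ t → t + 1 ≤ T → a (t + 1) ≤ b t) :
    ∑ t ∈ Finset.Icc 1 T, (a t - b t) ≤ a 1 - b T := by
  induction T, hT using Nat.le_induction with
  | base => simp
  | succ T hT ih =>
    rw [sum_Icc_one_succ]
    linarith [ih fun t h1 h2 => h t h1 (by omega), h T hT le_rfl]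

/-- ψ² is the first summand of π and the others are nonnegative; so the second-moment bound ψ² may
be weakened to π. -/
theorem le_piBound {γ₁ ε₀ νg σ s θ ψ : ℝ} {T : ℕ} (hε : 0 ≤ ε₀) (hν : 0 ≤ νg)
    (hσ : 0 ≤ σ) (hs : 0 ≤ s) (hθ : 0 < θ) (hψ : 0 ≤ ψ) :
    ψ ^ 2 ≤ PMQS.piBound γ₁ ε₀ νg σ s θ ψ T := by
  have g1 := upperGamma_nonneg (3 / θ) zero_le_one
  have g2 := upperGamma_nonneg (2 / θ) zero_le_one
  have g3 := upperGamma_nonneg (1 / θ) zero_le_one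
  have t1 : 0 ≤ (T : ℝ) ^ θ / (θ + 1) :=
    div_nonneg (Real.rpow_nonneg (Nat.cast_nonneg T) _) (by linarith)
  have t2 : 0 ≤ (T : ℝ) ^ (2 * θ) / (2 * θ + 1) :=
    div_nonneg (Real.rpow_nonneg (Nat.cast_nonneg T) _) (by linarith)
  have t3 : 0 ≤ γ₁ ^ 4 := by positivity
  rw [PMQS.piBound]
  have a1 : 0 ≤ 32 * ψ * (γ₁ ^ 2 / ε₀) * σ * s * ((T : ℝ) ^ θ / (θ + 1)) := by positivity
  have a2 : 0 ≤ 256 * (γ₁ ^ 4 / ε₀ ^ 2) * σ ^ 2 * s ^ 2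
      * ((T : ℝ) ^ (2 * θ) / (2 * θ + 1)) := by positivity
  have a3 : 0 ≤ 2 * σ * νg * (ψ + 16 * (γ₁ ^ 2 / ε₀) * σ * s * ((T : ℝ) ^ θ / (θ + 1))) := by
    positivity
  have a4 : 0 ≤ (σ * νg) ^ 2 / (T * θ) * (PMQS.upperGamma (3 / θ) 1
      + 2 * PMQS.upperGamma (2 / θ) 1 + PMQS.upperGamma (1 / θ) 1) := by positivity
  linarith [sq_nonneg (σ * νg)]

namespace Assumptions

variable {n p : ℕ} {Ω Ξ : Type*} [mΩ : MeasurableSpace Ω] [MeasurableSpace Ξ]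
    {μ : Measure Ω} {P : Measure Ξ} {X₀ O₀ : Set (PMQS.E n)} {F : PMQS.E n → Ξ → ℝ}
    {G : Fin p → PMQS.E n → Ξ → ℝ} {D₀ νg κf κg ε₀ L₀ : ℝ} {L : Fin p → ℝ} {T : ℕ}
    {σ α τ : ℝ} {ξ : ℕ → Ω → Ξ} {x₁ : PMQS.E n}
    {S : ℕ → Fin p → Ω → Matrix (Fin n) (Fin n) ℝ} {x : ℕ → Ω → PMQS.E n}
    {lam : ℕ → Ω → PMQS.E p} {κS γ₁ γ₂ : ℝ}

section Feasibility

variable (h : Assumptions μ P X₀ O₀ F G D₀ νg κf κg ε₀ L₀ L T σ α τ ξ x₁ S x lam κS γ₁ γ₂)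
include h

/-- The positive part dominates its argument, so the model value at x^{t+1} is at most the increment
over σ. Passing back to x^t costs (κg + κS D₀/2)‖x^{t+1} - x^t‖, bounded by `step_le`. -/
theorem G_le_multiplier_increment {t : ℕ} (ht : t ∈ Finset.Icc 1 T) (ω : Ω) (i : Fin p) :
    G i (x t ω) (ξ t ω) ≤ 1 / σ * (lam (t + 1) ω i - lam t ω i)
      + 1 / (α + τ) * ((2 * κg + κS * D₀) * κf
        + (2 * κg + κS * D₀) * (κg + κS * D₀ / 2) * Real.sqrt p * νg * σ
        + (2 * κg + κS * D₀) * (κg + κS * D₀ / 2) * Real.sqrt p * ‖lam t ω‖) := by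
  have hσ := h.σ_pos
  have hατ := add_pos h.α_pos h.τ_pos
  have hκ : 0 ≤ κg + κS * D₀ / 2 := by
    have := h.κg_pos; have := h.κS_pos; have := h.D₀_pos
    positivity
  have h1 := (abs_le.1 (h.abs_quadModel_sub_le ht ω i (h.run.x_mem t ht ω))).1
  have h2 : lam t ω i + σ * PMQS.quadModel (fun z => G i z (ξ t ω)) (S t i ω) (x t ω)
      (x (t + 1) ω) ≤ lam (t + 1) ω i := by
    rw [h.run.lam_step t ht ω i]; exact le_max_left _ _
  have h3 : PMQS.quadModel (fun z => G i z (ξ t ω)) (S t i ω) (x t ω) (x (t + 1) ω)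
      ≤ 1 / σ * (lam (t + 1) ω i - lam t ω i) := by
    rw [one_div_mul_eq_div, le_div_iff₀ hσ]; linarith
  have h4 : (κg + κS * D₀ / 2) * ‖x (t + 1) ω - x t ω‖ ≤
      1 / (α + τ) * ((2 * κg + κS * D₀) * κf
        + (2 * κg + κS * D₀) * (κg + κS * D₀ / 2) * Real.sqrt p * νg * σ
        + (2 * κg + κS * D₀) * (κg + κS * D₀ / 2) * Real.sqrt p * ‖lam t ω‖) := by
    rw [one_div_mul_eq_div, le_div_iff₀ hατ]
    have := mul_le_mul_of_nonneg_left (h.step_le ht ω) hκ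
    linarith
  linarith

theorem isCompact : IsCompact X₀ := by
  refine Metric.isCompact_of_isClosed_isBounded h.closed (Metric.isBounded_iff.2 ⟨D₀, ?_⟩)
  intro a ha b hb
  rw [dist_eq_norm]; exact h.diam a ha b hb

theorem betaK_lt {t : ℕ} (ht : t ∈ Finset.Icc 1 T) : PMQS.betaK L₀ L γ₂ t σ < α := by
  have := h.αβ t ht
  linarith [h.α_pos]

theorem lam_apply_measurable {t : ℕ} (ht : t ∈ Finset.Icc 1 (T + 1)) (i : Fin p) :
    Measurable[PMQS.history ξ t] fun ω => lam t ω i :=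
  (measurable_pi_apply i).comp ((PiLp.continuous_ofLp 2 _).measurable.comp (h.run.lam_adapted t ht))

theorem lam_apply_integrable [IsProbabilityMeasure μ] {t : ℕ} (ht : t ∈ Finset.Icc 1 (T + 1)) (i : Fin p) :
    Integrable (fun ω => lam t ω i) μ :=
  integrable_of_abs_le ((h.lam_apply_measurable ht i).mono (h.history_le ht) le_rfl)
    fun ω => (abs_apply_le_norm _ i).trans (h.norm_lam_le ht ω)

variable [IsProbabilityMeasure P]

theorem expVal_G_comp_measurable {t : ℕ} (i : Fin p) {Y : Ω → PMQS.E n}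
    (hY : Measurable[PMQS.history ξ t] Y) (hYX : ∀ ω, Y ω ∈ X₀) :
    Measurable[PMQS.history ξ t] fun ω => PMQS.expVal P (G i) (Y ω) :=
  (h.expVal_G_continuousOn i).measurable_comp_of_mem hY hYX

variable [IsProbabilityMeasure μ]

theorem expVal_G_x_integrable {t : ℕ} (ht : t ∈ Finset.Icc 1 T) (i : Fin p) :
    Integrable (fun ω => PMQS.expVal P (G i) (x t ω)) μ := by
  have ht' := mem_Icc_add_one ht
  exact integrable_of_abs_le ((h.expVal_G_comp_measurable i (h.run.x_adapted t ht')
    (h.x_mem ht')).mono (h.history_le ht') le_rfl)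
    fun ω => h.abs_expVal_G_le i (h.sub (h.x_mem ht' ω))

theorem integral_sum_expVal_G_le {s ψ : ℝ} (hs : 1 ≤ s)
    (hψ : ψ = PMQS.psi γ₁ ε₀ D₀ κf νg σ α τ s) {ρ₁ ρ₂ : ℝ}
    (hρ₁ : ρ₁ = (2 * κg + κS * D₀) * κf)
    (hρ₂ : ρ₂ = (2 * κg + κS * D₀) * (κg + κS * D₀ / 2) * Real.sqrt p) (i : Fin p) :
    (1 / (T : ℝ)) * ∫ ω, ∑ t ∈ Finset.Icc 1 T, PMQS.expVal P (G i) (x t ω) ∂μ ≤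
        1 / (σ * T) * ψ + 1 / (α + τ) * (ρ₁ + ρ₂ * νg * σ + ρ₂ * ψ) := by
  have hσ := h.σ_pos
  have hατ := add_pos h.α_pos h.τ_pos
  have hT : (0 : ℝ) < T := by exact_mod_cast h.T_pos
  have hρ₂0 : 0 ≤ ρ₂ := by
    have := h.κg_pos; have := h.κS_pos; have := h.D₀_pos
    rw [hρ₂]; positivity
  have step : ∀ t ∈ Finset.Icc 1 T, ∫ ω, PMQS.expVal P (G i) (x t ω) ∂μ
      ≤ 1 / σ * (∫ ω, lam (t + 1) ω i ∂μ) - 1 / σ * (∫ ω, lam t ω i ∂μ)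
        + 1 / (α + τ) * (ρ₁ + ρ₂ * νg * σ + ρ₂ * ψ) := by
    intro t ht
    have ht' := mem_Icc_add_one ht
    have e := h.integral_mul_G ht i (w := fun _ => 1) measurable_const (B := 1) (by simp)
      (h.run.x_adapted t ht') (h.x_mem ht')
    simp only [one_mul] at e
    rw [← e]
    have i1 := h.lam_apply_integrable (add_one_mem_Icc ht) i
    have i0 := h.lam_apply_integrable ht' i
    have in0 := h.norm_lam_integrable ht'
    have iG : Integrable (fun ω => G i (x t ω) (ξ t ω)) μ :=
      integrable_of_abs_le (h.G_comp_measurable ht i (h.x_measurable ht') (h.x_mem ht'))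
        fun ω => h.abs_G_le (h.sub (h.x_mem ht' ω)) i _
    have ia : Integrable (fun ω => 1 / σ * (lam (t + 1) ω i - lam t ω i)) μ :=
      (i1.sub i0).const_mul (1 / σ)
    have ib : Integrable (fun ω => 1 / (α + τ) * (ρ₁ + ρ₂ * νg * σ + ρ₂ * ‖lam t ω‖)) μ :=
      ((integrable_const (ρ₁ + ρ₂ * νg * σ)).add (in0.const_mul ρ₂)).const_mul (1 / (α + τ))
    have hm := integral_mono iG (ia.add ib) (fun ω => by
        have := h.G_le_multiplier_increment ht ω i
        rw [← hρ₂, ← hρ₁] at this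
        exact this)
    simp only [Pi.add_apply] at hm
    rw [integral_add ia ib,
      integral_const_mul, integral_const_mul, integral_sub i1 i0,
      integral_add (integrable_const _) (in0.const_mul _), integral_const_mul] at hm
    simp only [integral_const, probReal_univ, one_smul] at hm
    have hl := mul_le_mul_of_nonneg_left (h.integral_norm_lam_le hs hψ ht') hρ₂0
    have hl' := mul_le_mul_of_nonneg_left hl (one_div_nonneg.2 hατ.le)
    linarith
  have hsum := Finset.sum_le_sum step
  rw [← integral_finsetSum _ fun t ht => h.expVal_G_x_integrable ht i, Finset.sum_add_distrib,
    Finset.sum_const, Nat.card_Icc, Nat.add_sub_cancel, nsmul_eq_mul] at hsum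
  -- Since λ¹ = 0, only the last multiplier remains, and its mean is at most ψ.
  have htel : ∑ t ∈ Finset.Icc 1 T, (1 / σ * (∫ ω, lam (t + 1) ω i ∂μ)
      - 1 / σ * (∫ ω, lam t ω i ∂μ)) ≤ 1 / σ * ψ := by
    have h1 := sum_sub_le_of_le_succ (a := fun t => -(1 / σ * (∫ ω, lam t ω i ∂μ)))
      (b := fun t => -(1 / σ * (∫ ω, lam (t + 1) ω i ∂μ))) h.T_pos (fun t _ _ => le_rfl)
    have h2 : ∫ ω, lam (T + 1) ω i ∂μ ≤ ψ := by
      have hTm : T + 1 ∈ Finset.Icc 1 (T + 1) := Finset.mem_Icc.2 ⟨by omega, le_rfl⟩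
      refine (integral_mono (h.lam_apply_integrable hTm i) (h.norm_lam_integrable hTm)
        fun ω => (le_abs_self _).trans (abs_apply_le_norm _ i)).trans
        (h.integral_norm_lam_le hs hψ hTm)
    have h3 : ∫ ω, lam 1 ω i ∂μ = 0 := by simp [h.run.lam_one]
    have h4 := mul_le_mul_of_nonneg_left h2 (one_div_nonneg.2 hσ.le)
    simp only [h3, mul_zero, neg_zero, zero_sub, neg_neg] at h1
    refine (Finset.sum_congr rfl fun t _ => ?_).trans_le (h1.trans h4)
    ring
  have := mul_le_mul_of_nonneg_left (hsum.trans (add_le_add htel le_rfl))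
    (one_div_nonneg.2 hT.le)
  refine this.trans_eq ?_
  field_simp

end Feasibility

/-! ### Proximal points of the Lagrangian along the run. -/

section Stationarity

variable [IsProbabilityMeasure P]
variable (h : Assumptions μ P X₀ O₀ F G D₀ νg κf κg ε₀ L₀ L T σ α τ ξ x₁ S x lam κS γ₁ γ₂)
include h

theorem lagrangian_continuousOn (l : PMQS.E p) : ContinuousOn (PMQS.lagrangian P F G l) X₀ :=
  h.expVal_F_continuousOn.add (continuousOn_finsetSum _ fun i _ =>
    continuousOn_const.mul (h.expVal_G_continuousOn i))

theorem lagrangian_weaklyConvexOn {t : ℕ} (ht : t ∈ Finset.Icc 1 T) (ω : Ω) :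
    PMQS.WeaklyConvexOn X₀ (PMQS.betaK L₀ L γ₂ t σ) (PMQS.lagrangian P F G (lam t ω)) :=
  WeaklyConvexOn.mono (WeaklyConvexOn.mono_set (weaklyConvexOn_add_sum (weaklyConvexOn_expVal h.convexO h.Fint h.Fwc)
    (fun i => weaklyConvexOn_expVal h.convexO (fun _ hx => h.G_integrable i hx) (h.Gwc i))
    (h.lam_nonneg (mem_Icc_add_one ht) ω)) h.convex h.sub) (h.lagrangian_modulus_le ht ω)

theorem proxPt_mem_and_min (l : PMQS.E p) (z : PMQS.E n) :
    proxPt X₀ (PMQS.lagrangian P F G l) α z ∈ X₀ ∧ ∀ y ∈ X₀,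
      PMQS.lagrangian P F G l (proxPt X₀ (PMQS.lagrangian P F G l) α z)
        + α / 2 * ‖proxPt X₀ (PMQS.lagrangian P F G l) α z - z‖ ^ 2
      ≤ PMQS.lagrangian P F G l y + α / 2 * ‖y - z‖ ^ 2 :=
  proxPt_spec h.isCompact ⟨x₁, h.x₁_mem⟩ (h.lagrangian_continuousOn l) z

/-- This supplies measurability of the proximal point with respect to the past. By `prox_dist_sq_le`
the squared displacement is at most (2νg‖Δλ‖ + αD₀‖Δx‖)/(α-β), because the Lagrangian is linear in
λ. -/
theorem proxPt_continuousOn {β : ℝ} (hβ : β < α) :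
    ContinuousOn (fun a : PMQS.E p × PMQS.E n => proxPt X₀ (PMQS.lagrangian P F G a.1) α a.2)
      {a | PMQS.WeaklyConvexOn X₀ β (PMQS.lagrangian P F G a.1)} := by
  intro a ha
  have hc : 0 < α - β := by linarith
  set y := fun a : PMQS.E p × PMQS.E n => proxPt X₀ (PMQS.lagrangian P F G a.1) α a.2 with hy
  rw [ContinuousWithinAt, tendsto_iff_norm_sub_tendsto_zero]
  have hlim : Filter.Tendsto (fun b : PMQS.E p × PMQS.E n =>
      Real.sqrt ((2 * νg * ‖b.1 - a.1‖ + α * D₀ * ‖b.2 - a.2‖) / (α - β)))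
      (nhdsWithin a {a | PMQS.WeaklyConvexOn X₀ β (PMQS.lagrangian P F G a.1)}) (nhds 0) := by
    have hcont : Continuous fun b : PMQS.E p × PMQS.E n =>
      Real.sqrt ((2 * νg * ‖b.1 - a.1‖ + α * D₀ * ‖b.2 - a.2‖) / (α - β)) := by fun_prop
    have := hcont.tendsto a
    simp only [sub_self, norm_zero, mul_zero, add_zero, zero_div, Real.sqrt_zero] at this
    exact this.mono_left nhdsWithin_le_nhds
  refine squeeze_zero' (Filter.Eventually.of_forall fun _ => norm_nonneg _) ?_ hlim
  filter_upwards [self_mem_nhdsWithin] with b hb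
  obtain ⟨hya, hmina⟩ := h.proxPt_mem_and_min a.1 a.2
  obtain ⟨hyb, hminb⟩ := h.proxPt_mem_and_min b.1 b.2
  have h1 := prox_dist_sq_le hb ha hyb hya hminb hmina
  have e : (PMQS.lagrangian P F G b.1 (y a) - PMQS.lagrangian P F G b.1 (y b))
      - (PMQS.lagrangian P F G a.1 (y a) - PMQS.lagrangian P F G a.1 (y b))
      = ∑ i, (b.1 - a.1) i * PMQS.expVal P (G i) (y a)
        - ∑ i, (b.1 - a.1) i * PMQS.expVal P (G i) (y b) := by
    simp only [PMQS.lagrangian, PiLp.sub_apply, sub_mul, Finset.sum_sub_distrib]; ring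
  have h2 := (abs_le.1 (h.abs_sum_mul_expVal_le (b.1 - a.1) (h.sub hya))).2
  have h3 := (abs_le.1 (h.abs_sum_mul_expVal_le (b.1 - a.1) (h.sub hyb))).1
  have h4 : inner ℝ (y b - y a) (b.2 - a.2) ≤ D₀ * ‖b.2 - a.2‖ :=
    (real_inner_le_norm _ _).trans (mul_le_mul_of_nonneg_right (h.diam _ hyb _ hya)
      (norm_nonneg _))
  have h5 := mul_le_mul_of_nonneg_left h4 h.α_pos.le
  refine Real.le_sqrt_of_sq_le ?_
  rw [le_div_iff₀ hc]
  simp only [hy] at e h2 h3 h5 ⊢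
  linarith

theorem proxPt_measurable {t : ℕ} (ht : t ∈ Finset.Icc 1 T) : Measurable[PMQS.history ξ t]
    fun ω => proxPt X₀ (PMQS.lagrangian P F G (lam t ω)) α (x t ω) :=
  ContinuousOn.measurable_comp_of_mem (m := PMQS.history ξ t)
    (f := fun a : PMQS.E p × PMQS.E n => proxPt X₀ (PMQS.lagrangian P F G a.1) α a.2)
    (Y := fun ω => (lam t ω, x t ω)) (h.proxPt_continuousOn (h.betaK_lt ht))
    ((h.run.lam_adapted t (mem_Icc_add_one ht)).prodMk (h.run.x_adapted t (mem_Icc_add_one ht)))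
    (fun ω => h.lagrangian_weaklyConvexOn ht ω)

theorem hasGradientAt_env {t : ℕ} (ht : t ∈ Finset.Icc 1 T) (ω : Ω) :
    HasGradientAt (PMQS.moreauEnv X₀ (PMQS.lagrangian P F G (lam t ω)) α)
      (α • (x t ω - proxPt X₀ (PMQS.lagrangian P F G (lam t ω)) α (x t ω))) (x t ω) :=
  hasGradientAt_moreauEnv h.isCompact ⟨x₁, h.x₁_mem⟩ (h.lagrangian_continuousOn _)
    (h.lagrangian_weaklyConvexOn ht ω) (h.betaK_lt ht) h.α_pos _

end Stationarity

end Assumptions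

/-! ### Expected descent of the envelope and the stationarity bound. -/

namespace Assumptions

variable {n p : ℕ} {Ω Ξ : Type*} [mΩ : MeasurableSpace Ω] [MeasurableSpace Ξ]
    {μ : Measure Ω} {P : Measure Ξ} {X₀ O₀ : Set (PMQS.E n)} {F : PMQS.E n → Ξ → ℝ}
    {G : Fin p → PMQS.E n → Ξ → ℝ} {D₀ νg κf κg ε₀ L₀ : ℝ} {L : Fin p → ℝ} {T : ℕ}
    {σ α τ : ℝ} {ξ : ℕ → Ω → Ξ} {x₁ : PMQS.E n}
    {S : ℕ → Fin p → Ω → Matrix (Fin n) (Fin n) ℝ} {x : ℕ → Ω → PMQS.E n}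
    {lam : ℕ → Ω → PMQS.E p} {κS γ₁ γ₂ : ℝ}

section Descent

variable (h : Assumptions μ P X₀ O₀ F G D₀ νg κf κg ε₀ L₀ L T σ α τ ξ x₁ S x lam κS γ₁ γ₂)
include h

section Bounded

variable [IsProbabilityMeasure μ]

theorem norm_sub_sq_integrable {Y Y' : Ω → PMQS.E n} (hY : Measurable Y) (hY' : Measurable Y')
    (hYX : ∀ ω, Y ω ∈ X₀) (hYX' : ∀ ω, Y' ω ∈ X₀) :
    Integrable (fun ω => ‖Y ω - Y' ω‖ ^ 2) μ :=
  integrable_of_abs_le ((hY.sub hY').norm.pow_const 2) (C := D₀ ^ 2) fun ω => by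
    rw [abs_pow, abs_norm]
    have := h.diam _ (hYX ω) _ (hYX' ω)
    gcongr

end Bounded

variable [IsProbabilityMeasure P]

theorem abs_expVal_F_le {y : PMQS.E n} (hy : y ∈ X₀) :
    |PMQS.expVal P F y| ≤ |PMQS.expVal P F x₁| + κf * D₀ := by
  have h1 := h.expVal_F_lip (h.sub h.x₁_mem) (h.sub hy)
  have h2 := abs_sub_abs_le_abs_sub (PMQS.expVal P F y) (PMQS.expVal P F x₁)
  have h3 := mul_le_mul_of_nonneg_left (h.diam y hy _ h.x₁_mem) h.κf_pos.le
  linarith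

theorem gradient_env_sq {t : ℕ} (ht : t ∈ Finset.Icc 1 T) (ω : Ω) :
    ‖gradient (PMQS.moreauEnv X₀ (PMQS.lagrangian P F G (lam t ω)) α) (x t ω)‖ ^ 2
      = α ^ 2 * ‖proxPt X₀ (PMQS.lagrangian P F G (lam t ω)) α (x t ω) - x t ω‖ ^ 2 := by
  rw [(h.hasGradientAt_env ht ω).gradient, norm_smul, mul_pow, Real.norm_eq_abs, sq_abs,
    norm_sub_rev]

variable [IsProbabilityMeasure μ]

theorem lagrangian_comp_integrable {j : ℕ} (hj : j ∈ Finset.Icc 1 (T + 1)) {Y : Ω → PMQS.E n}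
    (hY : Measurable Y) (hYX : ∀ ω, Y ω ∈ X₀) :
    Integrable (fun ω => PMQS.lagrangian P F G (lam j ω) (Y ω)) μ := by
  refine Integrable.add (integrable_of_abs_le (h.expVal_F_continuousOn.measurable_comp_of_mem
    hY hYX) fun ω => h.abs_expVal_F_le (hYX ω)) (integrable_finsetSum _ fun i _ => ?_)
  exact (h.lam_apply_integrable hj i).mul_bdd (c := νg)
    ((h.expVal_G_continuousOn i).measurable_comp_of_mem hY hYX).aestronglyMeasurable
    (Filter.Eventually.of_forall fun ω => h.abs_expVal_G_le i (h.sub (hYX ω)))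

/-- Y, x^t and λ^t are all determined before ξ_t, so freezing applies to each sampled term. -/
theorem integral_sample_lagrangian_sub {t : ℕ} (ht : t ∈ Finset.Icc 1 T) {Y : Ω → PMQS.E n}
    (hY : Measurable[PMQS.history ξ t] Y) (hYX : ∀ ω, Y ω ∈ X₀) :
    Integrable (fun ω => F (Y ω) (ξ t ω) - F (x t ω) (ξ t ω)
      + ∑ i, lam t ω i * (G i (Y ω) (ξ t ω) - G i (x t ω) (ξ t ω))) μ ∧
    ∫ ω, (F (Y ω) (ξ t ω) - F (x t ω) (ξ t ω)
      + ∑ i, lam t ω i * (G i (Y ω) (ξ t ω) - G i (x t ω) (ξ t ω))) ∂μ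
    = ∫ ω, (PMQS.lagrangian P F G (lam t ω) (Y ω)
      - PMQS.lagrangian P F G (lam t ω) (x t ω)) ∂μ := by
  have ht' := mem_Icc_add_one ht
  have hle := h.history_le ht'
  have hYm : Measurable Y := hY.mono hle le_rfl
  have hx := h.run.x_adapted t ht'
  have hxm := h.x_measurable ht'
  have hxX := h.x_mem ht'
  have iF : Integrable (fun ω => F (Y ω) (ξ t ω) - F (x t ω) (ξ t ω)) μ :=
    integrable_of_abs_le ((h.F_comp_measurable ht hYm hYX).sub (h.F_comp_measurable ht hxm hxX))
      (C := κf * D₀) fun ω => (h.F_lip (h.sub (hxX ω)) (h.sub (hYX ω)) _).trans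
        (mul_le_mul_of_nonneg_left (h.diam _ (hYX ω) _ (hxX ω)) h.κf_pos.le)
  have iG : ∀ (Z : Ω → PMQS.E n), Measurable Z → (∀ ω, Z ω ∈ X₀) → ∀ i,
      Integrable (fun ω => lam t ω i * G i (Z ω) (ξ t ω)) μ := fun Z hZ hZX i =>
    (h.lam_apply_integrable ht' i).mul_bdd (c := νg)
      (h.G_comp_measurable ht i hZ hZX).aestronglyMeasurable
      (Filter.Eventually.of_forall fun ω => h.abs_G_le (h.sub (hZX ω)) i _)
  have ig : ∀ (Z : Ω → PMQS.E n), Measurable Z → (∀ ω, Z ω ∈ X₀) → ∀ i,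
      Integrable (fun ω => lam t ω i * PMQS.expVal P (G i) (Z ω)) μ := fun Z hZ hZX i =>
    (h.lam_apply_integrable ht' i).mul_bdd (c := νg)
      ((h.expVal_G_continuousOn i).measurable_comp_of_mem hZ hZX).aestronglyMeasurable
      (Filter.Eventually.of_forall fun ω => h.abs_expVal_G_le i (h.sub (hZX ω)))
  have iGs : ∀ i, Integrable
      (fun ω => lam t ω i * (G i (Y ω) (ξ t ω) - G i (x t ω) (ξ t ω))) μ := fun i => by
    simp only [mul_sub]
    exact (iG Y hYm hYX i).sub (iG _ hxm hxX i)
  have igs : ∀ i, Integrable (fun ω => lam t ω i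
      * (PMQS.expVal P (G i) (Y ω) - PMQS.expVal P (G i) (x t ω))) μ := fun i => by
    simp only [mul_sub]
    exact (ig Y hYm hYX i).sub (ig _ hxm hxX i)
  have if' : Integrable (fun ω => PMQS.expVal P F (Y ω) - PMQS.expVal P F (x t ω)) μ :=
    (integrable_of_abs_le (h.expVal_F_continuousOn.measurable_comp_of_mem hYm hYX)
      fun ω => h.abs_expVal_F_le (hYX ω)).sub
    (integrable_of_abs_le (h.expVal_F_continuousOn.measurable_comp_of_mem hxm hxX)
      fun ω => h.abs_expVal_F_le (hxX ω))
  have isum := integrable_finsetSum Finset.univ fun i _ => iGs i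
  refine ⟨iF.add isum, ?_⟩
  have e : ∀ ω, PMQS.lagrangian P F G (lam t ω) (Y ω) - PMQS.lagrangian P F G (lam t ω) (x t ω)
      = (PMQS.expVal P F (Y ω) - PMQS.expVal P F (x t ω)) + ∑ i, lam t ω i
      * (PMQS.expVal P (G i) (Y ω) - PMQS.expVal P (G i) (x t ω)) := fun ω => by
    simp only [PMQS.lagrangian, mul_sub, Finset.sum_sub_distrib]; ring
  simp only [e]
  rw [integral_add iF isum, integral_add if' (integrable_finsetSum _ fun i _ => igs i),
    h.integral_F_sub ht hY hYX hx hxX, integral_finsetSum _ fun i _ => iGs i,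
    integral_finsetSum _ fun i _ => igs i]
  congr 1
  refine Finset.sum_congr rfl fun i _ => ?_
  simp only [mul_sub]
  rw [integral_sub (iG Y hYm hYX i) (iG _ hxm hxX i), integral_sub (ig Y hYm hYX i)
    (ig _ hxm hxX i)]
  have hb : ∀ ω, |lam t ω i| ≤ T * (σ * γ₁) := fun ω =>
    (abs_apply_le_norm _ i).trans (h.norm_lam_le ht' ω)
  rw [h.integral_mul_G ht i (h.lam_apply_measurable ht' i) hb hY hYX,
    h.integral_mul_G ht i (h.lam_apply_measurable ht' i) hb hx hxX]

/-- Expected decrease of the Moreau envelope along one step. -/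
theorem expected_descent {s ψ : ℝ} (hs : 1 ≤ s) (hψ : ψ = PMQS.psi γ₁ ε₀ D₀ κf νg σ α τ s)
    {t : ℕ} (ht : t ∈ Finset.Icc 1 T) {Y : Ω → PMQS.E n}
    (hYdef : ∀ ω, Y ω = proxPt X₀ (PMQS.lagrangian P F G (lam t ω)) α (x t ω)) :
    α ^ 2 * ∫ ω, ‖Y ω - x t ω‖ ^ 2 ∂μ ≤ 2 * (α + τ)
        * (∫ ω, (PMQS.lagrangian P F G (lam t ω) (Y ω) + α / 2 * ‖Y ω - x t ω‖ ^ 2) ∂μ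
          - ∫ ω, (PMQS.lagrangian P F G (lam (t + 1) ω) (Y ω)
            + α / 2 * ‖Y ω - x (t + 1) ω‖ ^ 2) ∂μ)
      + 2 * (α + τ) * (σ * γ₁ * νg) + 2 * α * (p * (σ * γ₂) * κg * D₀)
      + 2 * α * (α + τ)⁻¹ * ((κf + p * (σ * γ₂) * κS * D₀) ^ 2 + p * κg ^ 2 * ψ ^ 2) := by
  have ht' := mem_Icc_add_one ht
  have ht1 := add_one_mem_Icc ht
  have hατ := add_pos h.α_pos h.τ_pos
  have hα := h.α_pos
  have hYF : Measurable[PMQS.history ξ t] Y := by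
    rw [funext hYdef]; exact h.proxPt_measurable ht
  have hYm : Measurable Y := hYF.mono (h.history_le ht') le_rfl
  have hYX : ∀ ω, Y ω ∈ X₀ := fun ω => by rw [hYdef]; exact (h.proxPt_mem_and_min _ _).1
  have hxm := h.x_measurable ht'
  have hxX := h.x_mem ht'
  have iV := h.norm_sub_sq_integrable (μ := μ) hYm hxm hYX hxX
  have iV1 := h.norm_sub_sq_integrable (μ := μ) hYm (h.x_measurable ht1) hYX (h.x_mem ht1)
  have iM := (h.lagrangian_comp_integrable ht' hYm hYX).add (iV.const_mul (α / 2))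
  have iN := (h.lagrangian_comp_integrable ht1 hYm hYX).add (iV1.const_mul (α / 2))
  obtain ⟨iH, eH⟩ := h.integral_sample_lagrangian_sub ht hYF hYX
  have il := (h.lagrangian_comp_integrable ht' hYm hYX).sub
    (h.lagrangian_comp_integrable ht' hxm hxX)
  have iL := h.norm_lam_sq_integrable (μ := μ) ht1
  set β := PMQS.betaK L₀ L γ₂ t σ with hβ
  set b := κf + p * (σ * γ₂) * κS * D₀ with hb
  set A := p * (σ * γ₂) * κg * D₀ with hA
  set H : Ω → ℝ := fun ω => F (Y ω) (ξ t ω) - F (x t ω) (ξ t ω)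
      + ∑ i, lam t ω i * (G i (Y ω) (ξ t ω) - G i (x t ω) (ξ t ω)) with hH
  -- pathwise estimate, scaled by `2(α+τ)`
  have hpath : ∀ ω, 2 * (α + τ) * (PMQS.lagrangian P F G (lam (t + 1) ω) (Y ω)
      + α / 2 * ‖Y ω - x (t + 1) ω‖ ^ 2) ≤
      2 * (α + τ) * (PMQS.lagrangian P F G (lam t ω) (Y ω) + α / 2 * ‖Y ω - x t ω‖ ^ 2)
      + 2 * α * H ω + α * β * ‖Y ω - x t ω‖ ^ 2
      + (2 * α * (α + τ)⁻¹ * (p * κg ^ 2)) * ‖lam (t + 1) ω‖ ^ 2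
      + (2 * (α + τ) * (σ * γ₁ * νg) + 2 * α * A + 2 * α * (α + τ)⁻¹ * b ^ 2) := by
    intro ω
    have h1 := h.prox_descent ht ω (hYX ω)
    have h2 : PMQS.lagrangian P F G (lam (t + 1) ω) (Y ω)
        - PMQS.lagrangian P F G (lam t ω) (Y ω) ≤ σ * γ₁ * νg := by
      have e : PMQS.lagrangian P F G (lam (t + 1) ω) (Y ω)
          - PMQS.lagrangian P F G (lam t ω) (Y ω)
          = ∑ i, (lam (t + 1) ω - lam t ω) i * PMQS.expVal P (G i) (Y ω) := by
        simp only [PMQS.lagrangian, PiLp.sub_apply, sub_mul, Finset.sum_sub_distrib]; ring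
      rw [e]
      exact ((le_abs_self _).trans (h.abs_sum_mul_expVal_le _ (h.sub (hYX ω)))).trans
        (mul_le_mul_of_nonneg_right (h.norm_lam_sub_le ht ω) h.νg_pos.le)
    -- By (u+v)² ≤ 2u² + 2v², the random part enters only through ‖λ^{t+1}‖², whose mean is bounded
    -- by ψ².
    have h3 : (κf + Real.sqrt p * κg * ‖lam (t + 1) ω‖ + p * (σ * γ₂) * κS * D₀) ^ 2
        / (2 * (α + τ)) ≤ (b ^ 2 + p * κg ^ 2 * ‖lam (t + 1) ω‖ ^ 2) * (α + τ)⁻¹ := by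
      rw [div_le_iff₀ (by positivity)]
      have e : (b ^ 2 + p * κg ^ 2 * ‖lam (t + 1) ω‖ ^ 2) * (α + τ)⁻¹ * (2 * (α + τ))
          = 2 * b ^ 2 + 2 * (Real.sqrt p * κg * ‖lam (t + 1) ω‖) ^ 2 := by
        rw [mul_pow, mul_pow, Real.sq_sqrt (Nat.cast_nonneg p)]
        field_simp
      rw [e, hb]
      nlinarith [sq_nonneg ((κf + p * (σ * γ₂) * κS * D₀)
        - Real.sqrt p * κg * ‖lam (t + 1) ω‖)]
    -- The factor 2α turns (α+τ)/2 ‖·‖² into 2(α+τ) times the envelope's penalty α/2 ‖·‖².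
    have h4 := mul_le_mul_of_nonneg_left (h1.trans (add_le_add le_rfl h3))
      (show 0 ≤ 2 * α by linarith)
    have h5 := mul_le_mul_of_nonneg_left h2 (show 0 ≤ 2 * (α + τ) by linarith)
    simp only [hH]
    linarith
  -- Strong minimality gives the coefficient -α + β/2, and 2β < α weakens it to -(α+β)/2. Multiplied
  -- by 2α and added to the error αβ, it leaves exactly -α².
  have hpath2 : ∀ ω, PMQS.lagrangian P F G (lam t ω) (Y ω)
      - PMQS.lagrangian P F G (lam t ω) (x t ω) ≤ (-(α / 2) - β / 2) * ‖Y ω - x t ω‖ ^ 2 := by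
    intro ω
    have hmin := h.proxPt_mem_and_min (lam t ω) (x t ω)
    rw [← hYdef] at hmin
    have h1 := prox_strong_min (h.lagrangian_weaklyConvexOn ht ω) hmin.1 hmin.2 (hxX ω)
    rw [sub_self, norm_zero, norm_sub_rev (x t ω)] at h1
    have h2 := h.αβ t ht
    have h3 : 0 ≤ (α / 2 - β) * ‖Y ω - x t ω‖ ^ 2 := mul_nonneg (by linarith) (sq_nonneg _)
    linarith
  have hI2 := integral_mono il (iV.const_mul (-(α / 2) - β / 2)) hpath2
  have i1 := (iM.const_mul (2 * (α + τ))).add (iH.const_mul (2 * α))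
  have i2 := i1.add (iV.const_mul (α * β))
  have i3 := i2.add (iL.const_mul (2 * α * (α + τ)⁻¹ * (p * κg ^ 2)))
  have hI1 := integral_mono (iN.const_mul (2 * (α + τ))) (i3.add (integrable_const
    (2 * (α + τ) * (σ * γ₁ * νg) + 2 * α * A + 2 * α * (α + τ)⁻¹ * b ^ 2))) hpath
  rw [integral_add' i3 (integrable_const _), integral_add' i2 (iL.const_mul _),
    integral_add' i1 (iV.const_mul _), integral_add' (iM.const_mul _) (iH.const_mul _)] at hI1
  simp only [integral_const_mul, integral_const, probReal_univ, one_smul] at hI1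
  simp only [Pi.sub_apply, integral_const_mul] at hI2
  rw [← eH] at hI2
  simp only [Pi.add_apply] at hI1
  have hlam := mul_le_mul_of_nonneg_left (h.integral_norm_lam_sq_le hs hψ ht1).2
    (show 0 ≤ 2 * α * (α + τ)⁻¹ * (p * κg ^ 2) by positivity)
  have hI2' := mul_le_mul_of_nonneg_left hI2 (show 0 ≤ 2 * α by linarith)
  linarith

theorem sum_integral_prox_dist_le {s ψ : ℝ} (hs : 1 ≤ s)
    (hψ : ψ = PMQS.psi γ₁ ε₀ D₀ κf νg σ α τ s) {Y : ℕ → Ω → PMQS.E n}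
    (hYdef : ∀ t ω, Y t ω = proxPt X₀ (PMQS.lagrangian P F G (lam t ω)) α (x t ω)) :
    ∑ t ∈ Finset.Icc 1 T, α ^ 2 * ∫ ω, ‖Y t ω - x t ω‖ ^ 2 ∂μ ≤
      2 * (α + τ) * (PMQS.expVal P F x₁ - (⨅ z : X₀, PMQS.expVal P F z) + νg * ψ)
      + T * (2 * (α + τ) * (σ * γ₁ * νg) + 2 * α * (p * (σ * γ₂) * κg * D₀)
      + 2 * α * (α + τ)⁻¹ * ((κf + p * (σ * γ₂) * κS * D₀) ^ 2 + p * κg ^ 2 * ψ ^ 2)) := by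
  have hατ := add_pos h.α_pos h.τ_pos
  set a : ℕ → ℝ := fun t => ∫ ω, (PMQS.lagrangian P F G (lam t ω) (Y t ω)
    + α / 2 * ‖Y t ω - x t ω‖ ^ 2) ∂μ with ha
  set b : ℕ → ℝ := fun t => ∫ ω, (PMQS.lagrangian P F G (lam (t + 1) ω) (Y t ω)
    + α / 2 * ‖Y t ω - x (t + 1) ω‖ ^ 2) ∂μ with hb
  have hYX : ∀ t ω, Y t ω ∈ X₀ := fun t ω => by rw [hYdef]; exact (h.proxPt_mem_and_min _ _).1
  have hmin : ∀ t ω, ∀ z ∈ X₀, PMQS.lagrangian P F G (lam t ω) (Y t ω)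
      + α / 2 * ‖Y t ω - x t ω‖ ^ 2 ≤ PMQS.lagrangian P F G (lam t ω) z
      + α / 2 * ‖z - x t ω‖ ^ 2 := fun t ω => by
    rw [hYdef]; exact (h.proxPt_mem_and_min _ _).2
  have hYm : ∀ t ∈ Finset.Icc 1 T, Measurable (Y t) := fun t ht => by
    rw [funext (hYdef t)]
    exact (h.proxPt_measurable ht).mono (h.history_le (mem_Icc_add_one ht)) le_rfl
  have iM : ∀ t ∈ Finset.Icc 1 T, Integrable (fun ω => PMQS.lagrangian P F G (lam t ω) (Y t ω)
      + α / 2 * ‖Y t ω - x t ω‖ ^ 2) μ := fun t ht =>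
    (h.lagrangian_comp_integrable (mem_Icc_add_one ht) (hYm t ht) (hYX t)).add
      ((h.norm_sub_sq_integrable (hYm t ht) (h.x_measurable (mem_Icc_add_one ht)) (hYX t)
        (h.x_mem (mem_Icc_add_one ht))).const_mul _)
  have iN : ∀ t ∈ Finset.Icc 1 T, Integrable (fun ω =>
      PMQS.lagrangian P F G (lam (t + 1) ω) (Y t ω) + α / 2 * ‖Y t ω - x (t + 1) ω‖ ^ 2) μ :=
    fun t ht => (h.lagrangian_comp_integrable (add_one_mem_Icc ht) (hYm t ht) (hYX t)).add
      ((h.norm_sub_sq_integrable (hYm t ht) (h.x_measurable (add_one_mem_Icc ht)) (hYX t)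
        (h.x_mem (add_one_mem_Icc ht))).const_mul _)
  have h1T : 1 ∈ Finset.Icc 1 T := Finset.mem_Icc.2 ⟨le_rfl, h.T_pos⟩
  have hTT : T ∈ Finset.Icc 1 T := Finset.mem_Icc.2 ⟨h.T_pos, le_rfl⟩
  -- Y t is an admissible competitor in the envelope at time t + 1, whence a (t + 1) ≤ b t.
  have htel : ∑ t ∈ Finset.Icc 1 T, (a t - b t) ≤ a 1 - b T :=
    sum_sub_le_of_le_succ h.T_pos fun t h1 h2 =>
      integral_mono (iM (t + 1) (Finset.mem_Icc.2 ⟨by omega, h2⟩))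
        (iN t (Finset.mem_Icc.2 ⟨h1, by omega⟩)) fun ω => hmin (t + 1) ω _ (hYX t ω)
  have ha1 : a 1 ≤ PMQS.expVal P F x₁ := by
    have := integral_mono (iM 1 h1T) (integrable_const (PMQS.expVal P F x₁)) fun ω => by
      have := hmin 1 ω x₁ h.x₁_mem
      simpa [h.run.x_one, h.run.lam_one, PMQS.lagrangian] using this
    simpa using this
  have hTm := add_one_mem_Icc hTT
  -- The final Lagrangian falls below inf f by at most νg‖λ^{T+1}‖, of mean at most νgψ.
  have hbT : (⨅ z : X₀, PMQS.expVal P F z) - νg * ψ ≤ b T := by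
    have hbdd : BddBelow (Set.range fun z : X₀ => PMQS.expVal P F z) :=
      ⟨-(|PMQS.expVal P F x₁| + κf * D₀), by
        rintro _ ⟨z, rfl⟩; exact (abs_le.1 (h.abs_expVal_F_le z.2)).1⟩
    have h1 := integral_mono ((integrable_const (⨅ z : X₀, PMQS.expVal P F z)).sub
      ((h.norm_lam_integrable (μ := μ) hTm).const_mul νg)) (iN T hTT) fun ω => by
        have h2 := ciInf_le hbdd ⟨Y T ω, hYX T ω⟩
        have h3 := (abs_le.1 (h.abs_sum_mul_expVal_le (lam (T + 1) ω) (h.sub (hYX T ω)))).1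
        have h4 : 0 ≤ α / 2 * ‖Y T ω - x (T + 1) ω‖ ^ 2 := by
          have := h.α_pos
          positivity
        simp only [PMQS.lagrangian, Pi.sub_apply] at h2 ⊢
        linarith
    rw [integral_sub' (integrable_const _) ((h.norm_lam_integrable hTm).const_mul νg),
      integral_const_mul] at h1
    simp only [integral_const, probReal_univ, one_smul] at h1
    have h5 := mul_le_mul_of_nonneg_left (h.integral_norm_lam_le hs hψ hTm) h.νg_pos.le
    exact le_trans (by linarith) h1
  have hsum := Finset.sum_le_sum fun t ht => h.expected_descent hs hψ ht (hYdef t)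
  simp only [add_assoc] at hsum
  rw [Finset.sum_add_distrib, Finset.sum_const, Nat.card_Icc,
    Nat.add_sub_cancel, nsmul_eq_mul] at hsum
  have h6 := mul_le_mul_of_nonneg_left (show ∑ t ∈ Finset.Icc 1 T, (a t - b t) ≤
    PMQS.expVal P F x₁ - (⨅ z : X₀, PMQS.expVal P F z) + νg * ψ by linarith)
    (show 0 ≤ 2 * (α + τ) by linarith)
  rw [Finset.mul_sum] at h6
  simp only [add_assoc] at h6 ⊢
  exact hsum.trans (add_le_add h6 le_rfl)

theorem gradient_env_sq_integrable {t : ℕ} (ht : t ∈ Finset.Icc 1 T) : Integrable (fun ω =>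
    ‖gradient (PMQS.moreauEnv X₀ (PMQS.lagrangian P F G (lam t ω)) α) (x t ω)‖ ^ 2) μ := by
  simp only [h.gradient_env_sq ht]
  have ht' := mem_Icc_add_one ht
  exact (h.norm_sub_sq_integrable ((h.proxPt_measurable ht).mono (h.history_le ht') le_rfl)
    (h.x_measurable ht') (fun ω => (h.proxPt_mem_and_min _ _).1) (h.x_mem ht')).const_mul _

theorem integral_mean_gradient_env_sq_le {s θ ψ : ℝ} (hs : 1 ≤ s) (hθ : 0 < θ)
    (hψ : ψ = PMQS.psi γ₁ ε₀ D₀ κf νg σ α τ s) :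
    ∫ ω, (1 / (T : ℝ)) * ∑ t ∈ Finset.Icc 1 T,
        ‖gradient (PMQS.moreauEnv X₀ (PMQS.lagrangian P F G (lam t ω)) α) (x t ω)‖ ^ 2 ∂μ ≤
        4 * (α + τ) / T * (PMQS.expVal P F x₁ - ⨅ z : X₀, PMQS.expVal P F z)
        + 4 * νg * ψ * (α + τ) / T
        + 4 * (α + τ) * νg * γ₁ * σ
        + 4 * α * σ * D₀ * γ₂ * p * (κg + κS * D₀)
        + 4 * α * (α + τ)⁻¹ * (κf + σ * γ₂ * p * (κg + κS * D₀)) ^ 2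
        + 4 * p * κg ^ 2 * α * (α + τ)⁻¹ * PMQS.piBound γ₁ ε₀ νg σ s θ ψ T
        + 8 * α * (α + τ)⁻¹ * σ * (p * κg ^ 2 * γ₁) * ψ
        + 4 * α * (α + τ)⁻¹ * σ ^ 2 * γ₁ ^ 2 * p * κg ^ 2 := by
  have hα := h.α_pos
  have hτ := h.τ_pos
  have hσ := h.σ_pos
  have hγ₁ := h.γ₁_pos
  have hγ₂ := h.γ₂_pos
  have hκg := h.κg_pos
  have hκf := h.κf_pos
  have hκS := h.κS_pos
  have hD := h.D₀_pos
  have hν := h.νg_pos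
  have hψ0 : 0 < ψ := (h.integral_norm_lam_sq_le hs hψ (t := 1)
    (Finset.mem_Icc.2 ⟨le_rfl, by omega⟩)).1
  have hT : (0 : ℝ) < T := by exact_mod_cast h.T_pos
  have hp : (0 : ℝ) ≤ p := Nat.cast_nonneg p
  have hgap : 0 ≤ PMQS.expVal P F x₁ - ⨅ z : X₀, PMQS.expVal P F z := by
    have hbdd : BddBelow (Set.range fun z : X₀ => PMQS.expVal P F z) :=
      ⟨-(|PMQS.expVal P F x₁| + κf * D₀), by
        rintro _ ⟨z, rfl⟩; exact (abs_le.1 (h.abs_expVal_F_le z.2)).1⟩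
    linarith [ciInf_le hbdd ⟨x₁, h.x₁_mem⟩]
  have hπ := le_piBound (γ₁ := γ₁) (T := T) h.ε₀_pos.le hν.le hσ.le (zero_le_one.trans hs) hθ hψ0.le
  rw [integral_const_mul, integral_finsetSum _ fun t ht => h.gradient_env_sq_integrable ht]
  have e : ∑ t ∈ Finset.Icc 1 T, ∫ ω,
      ‖gradient (PMQS.moreauEnv X₀ (PMQS.lagrangian P F G (lam t ω)) α) (x t ω)‖ ^ 2 ∂μ
      = ∑ t ∈ Finset.Icc 1 T, α ^ 2 * ∫ ω,
        ‖proxPt X₀ (PMQS.lagrangian P F G (lam t ω)) α (x t ω) - x t ω‖ ^ 2 ∂μ :=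
    Finset.sum_congr rfl fun t ht => by
      simp only [h.gradient_env_sq ht, integral_const_mul]
  rw [e]
  have h1 := mul_le_mul_of_nonneg_left (h.sum_integral_prox_dist_le hs hψ (fun _ _ => rfl))
    (one_div_nonneg.2 hT.le)
  refine h1.trans ?_
  set Δ := PMQS.expVal P F x₁ - ⨅ z : X₀, PMQS.expVal P F z
  set Q := PMQS.piBound γ₁ ε₀ νg σ s θ ψ T
  set ι := (α + τ)⁻¹ with hι
  have hι0 : 0 < ι := inv_pos.2 (by linarith)
  have e2 : 1 / (T : ℝ) * (2 * (α + τ) * (Δ + νg * ψ)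
      + T * (2 * (α + τ) * (σ * γ₁ * νg) + 2 * α * (p * (σ * γ₂) * κg * D₀)
      + 2 * α * ι * ((κf + p * (σ * γ₂) * κS * D₀) ^ 2 + p * κg ^ 2 * ψ ^ 2)))
      = 2 * (α + τ) / T * Δ + 2 * νg * ψ * (α + τ) / T + 2 * (α + τ) * νg * γ₁ * σ
        + 2 * α * σ * D₀ * γ₂ * p * κg + 2 * α * ι * (κf + σ * γ₂ * p * (κS * D₀)) ^ 2
        + 2 * p * κg ^ 2 * α * ι * ψ ^ 2 := by
    field_simp
    ring
  rw [e2]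
  -- The bound `e2` is sharper than the stated one: termwise each 2 relaxes to 4, κS D₀ to κg + κS
  -- D₀ and ψ² to π, while the last two terms are added for free.
  have t1 : 2 * (α + τ) / T * Δ ≤ 4 * (α + τ) / T * Δ := by gcongr; norm_num
  have t2 : 2 * νg * ψ * (α + τ) / T ≤ 4 * νg * ψ * (α + τ) / T := by gcongr; norm_num
  have t3 : 2 * (α + τ) * νg * γ₁ * σ ≤ 4 * (α + τ) * νg * γ₁ * σ := by gcongr; norm_num
  have t4 : 2 * α * σ * D₀ * γ₂ * p * κg ≤ 4 * α * σ * D₀ * γ₂ * p * (κg + κS * D₀) := by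
    gcongr
    · norm_num
    · linarith [mul_pos hκS hD]
  have t5 : 2 * α * ι * (κf + σ * γ₂ * p * (κS * D₀)) ^ 2
      ≤ 4 * α * ι * (κf + σ * γ₂ * p * (κg + κS * D₀)) ^ 2 := by
    gcongr
    · norm_num
    · linarith
  have t6 : 2 * p * κg ^ 2 * α * ι * ψ ^ 2 ≤ 4 * p * κg ^ 2 * α * ι * Q := by
    gcongr
    norm_num
  have t7 : 0 ≤ 8 * α * ι * σ * (p * κg ^ 2 * γ₁) * ψ := by positivity
  have t8 : 0 ≤ 4 * α * ι * σ ^ 2 * γ₁ ^ 2 * p * κg ^ 2 := by positivity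
  linarith

end Descent

end Assumptions

theorem mainTheorem5 {n p : ℕ} (hp : 1 ≤ p)
    {Ω Ξ : Type*} [MeasurableSpace Ω] [MeasurableSpace Ξ]
    (μ : Measure Ω) [IsProbabilityMeasure μ] (P : Measure Ξ) [IsProbabilityMeasure P]
    -- the problem
    (X₀ O₀ : Set (PMQS.E n)) (hX₀ : IsClosed X₀) (hX₀c : Convex ℝ X₀)
    (hO₀ : IsOpen O₀) (hO₀c : Convex ℝ O₀) (hXO : X₀ ⊆ O₀)
    (F : PMQS.E n → Ξ → ℝ) (G : Fin p → PMQS.E n → Ξ → ℝ)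
    (hFmeas : ∀ x ∈ O₀, Measurable (F x)) (hGmeas : ∀ i, ∀ x ∈ O₀, Measurable (G i x))
    (hFint : ∀ x ∈ O₀, Integrable (F x) P)
    (hFdiff : ∀ z, DifferentiableOn ℝ (fun x => F x z) O₀)
    (hGdiff : ∀ i z, DifferentiableOn ℝ (fun x => G i x z) O₀)
    -- (A2), (A3), (A4)
    (D₀ νg κf κg : ℝ) (hD₀ : 0 < D₀) (hνg : 0 < νg) (hκf : 0 < κf) (hκg : 0 < κg)
    (hdiam : ∀ x ∈ X₀, ∀ z ∈ X₀, ‖x - z‖ ≤ D₀)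
    (hGbdd : ∀ x ∈ O₀, ∀ z, ‖(WithLp.toLp 2 (fun i => G i x z) : PMQS.E p)‖ ≤ νg)
    (hFgrad : ∀ x ∈ O₀, ∀ z, ‖gradient (fun y => F y z) x‖ ≤ κf)
    (hGgrad : ∀ i, ∀ x ∈ O₀, ∀ z, ‖gradient (fun y => G i y z) x‖ ≤ κg)
    -- (A5)
    (ε₀ : ℝ) (hε₀ : 0 < ε₀)
    (hSlater : ∃ xhat ∈ X₀, ∀ i, PMQS.expVal P (G i) xhat ≤ -ε₀)
    -- (A6)
    (L₀ : ℝ) (L : Fin p → ℝ) (hL₀ : 0 < L₀) (hL : ∀ i, 0 < L i)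
    (hFwc : ∀ z, PMQS.WeaklyConvexOn O₀ L₀ (fun x => F x z))
    (hGwc : ∀ i z, PMQS.WeaklyConvexOn O₀ (L i) (fun x => G i x z))
    -- (A1) and the run of the method
    (T : ℕ) (hT : 1 ≤ T) (σ α τ : ℝ) (hσ : 0 < σ) (hα : 0 < α) (hτ : 0 < τ)
    (ξ : ℕ → Ω → Ξ) (hξmeas : ∀ t ∈ Finset.Icc 1 T, Measurable (ξ t))
    (hξindep : iIndepFun (fun t : Finset.Icc 1 T => ξ t) μ)
    (hξlaw : ∀ t ∈ Finset.Icc 1 T, μ.map (ξ t) = P)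
    (x₁ : PMQS.E n) (hx₁ : x₁ ∈ X₀)
    (S : ℕ → Fin p → Ω → Matrix (Fin n) (Fin n) ℝ)
    (x : ℕ → Ω → PMQS.E n) (lam : ℕ → Ω → PMQS.E p)
    (hrun : PMQS.IsRun X₀ F G σ α τ T x₁ ξ S x lam)
    -- choice of the matrices and of the parameters
    (κS : ℝ) (hκS : 0 < κS)
    (hSle : ∀ t ∈ Finset.Icc 1 T, ∀ i ω,
      (-(L i • (1 : Matrix (Fin n) (Fin n) ℝ)) - S t i ω).PosSemidef)
    (hSnorm : ∀ t ∈ Finset.Icc 1 T, ∀ i ω, ‖Matrix.toEuclideanCLM (𝕜 := ℝ) (S t i ω)‖ ≤ κS)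
    (hκSε : Real.sqrt p * κS * D₀ ^ 2 ≤ ε₀)
    (γ₁ γ₂ : ℝ) (hγ₁ : γ₁ = PMQS.gamma1 p νg κg κS D₀) (hγ₂ : γ₂ = PMQS.gamma2 νg κg κS D₀)
    (hαβ : ∀ k ∈ Finset.Icc 1 T,
      max (2 * PMQS.betaK L₀ L γ₂ k σ) (p * (κg + κS * D₀ / 2) ^ 2 * σ) < α)
    (s : ℝ) (hs : 1 ≤ s) (θ : ℝ) (hθ : 0 < θ)
    (ψ : ℝ) (hψ : ψ = PMQS.psi γ₁ ε₀ D₀ κf νg σ α τ s)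
    (ρ₁ ρ₂ : ℝ) (hρ₁ : ρ₁ = (2 * κg + κS * D₀) * κf)
    (hρ₂ : ρ₂ = (2 * κg + κS * D₀) * (κg + κS * D₀ / 2) * Real.sqrt p)
    -- the Moreau envelope of `L(·, λ^t) + δ_{X₀}` with parameter `1/α`
    (env : ℕ → Ω → PMQS.E n → ℝ)
    (henv : ∀ t ω, env t ω = PMQS.moreauEnv X₀ (PMQS.lagrangian P F G (lam t ω)) α) :
    -- (i)
    ((∀ t ∈ Finset.Icc 1 T,
        (∀ ω, DifferentiableAt ℝ (env t ω) (x t ω)) ∧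
        Integrable (fun ω => ‖gradient (env t ω) (x t ω)‖ ^ 2) μ) ∧
      ∫ ω, (1 / (T : ℝ)) * ∑ t ∈ Finset.Icc 1 T, ‖gradient (env t ω) (x t ω)‖ ^ 2 ∂μ ≤
        4 * (α + τ) / T * (PMQS.expVal P F x₁ - ⨅ z : X₀, PMQS.expVal P F z)
        + 4 * νg * ψ * (α + τ) / T
        + 4 * (α + τ) * νg * γ₁ * σ
        + 4 * α * σ * D₀ * γ₂ * p * (κg + κS * D₀)
        + 4 * α * (α + τ)⁻¹ * (κf + σ * γ₂ * p * (κg + κS * D₀)) ^ 2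
        + 4 * p * κg ^ 2 * α * (α + τ)⁻¹ * PMQS.piBound γ₁ ε₀ νg σ s θ ψ T
        + 8 * α * (α + τ)⁻¹ * σ * (p * κg ^ 2 * γ₁) * ψ
        + 4 * α * (α + τ)⁻¹ * σ ^ 2 * γ₁ ^ 2 * p * κg ^ 2) ∧
    -- (ii)
    (∀ i,
      (∀ t ∈ Finset.Icc 1 T, Integrable (fun ω => PMQS.expVal P (G i) (x t ω)) μ) ∧
      (1 / (T : ℝ)) * ∫ ω, ∑ t ∈ Finset.Icc 1 T, PMQS.expVal P (G i) (x t ω) ∂μ ≤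
        1 / (σ * T) * ψ + 1 / (α + τ) * (ρ₁ + ρ₂ * νg * σ + ρ₂ * ψ)) := by
  have A : Assumptions μ P X₀ O₀ F G D₀ νg κf κg ε₀ L₀ L T σ α τ ξ x₁ S x lam κS γ₁ γ₂ :=
    { p_pos := hp, closed := hX₀, convex := hX₀c, isOpen := hO₀, convexO := hO₀c, sub := hXO,
      Fmeas := hFmeas, Gmeas := hGmeas, Fint := hFint, Fdiff := hFdiff, Gdiff := hGdiff,
      D₀_pos := hD₀, νg_pos := hνg, κf_pos := hκf, κg_pos := hκg, diam := hdiam, Gbdd := hGbdd,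
      Fgrad := hFgrad, Ggrad := hGgrad, ε₀_pos := hε₀, slater := hSlater, L₀_pos := hL₀,
      L_pos := hL, Fwc := hFwc, Gwc := hGwc, T_pos := hT, σ_pos := hσ, α_pos := hα, τ_pos := hτ,
      ξmeas := hξmeas, ξindep := hξindep, ξlaw := hξlaw, x₁_mem := hx₁, run := hrun,
      κS_pos := hκS, S_le := hSle, S_norm := hSnorm, κSε := hκSε, γ₁_eq := hγ₁, γ₂_eq := hγ₂,
      αβ := fun k hk => (le_max_left _ _).trans_lt (hαβ k hk) }
  simp only [henv]
  exact ⟨⟨fun t ht => ⟨fun ω => (A.hasGradientAt_env ht ω).differentiableAt,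
      A.gradient_env_sq_integrable ht⟩, A.integral_mean_gradient_env_sq_le hs hθ hψ⟩,
    fun i => ⟨fun t ht => A.expVal_G_x_integrable ht i,
      A.integral_sum_expVal_G_le hs hψ hρ₁ hρ₂ i⟩⟩
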